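/- Let $(M,g_{ab})$ be a smooth 4-dimensional Lorentzian spacetime of signature $(+---)$ with a spinor structure (spinor bundle with spinor metric $\epsilon_{AB}$, $g_{ab}=\epsilon_{AB}\bar\epsilon_{A'B'}$), and fix a pair of null directions, i.e. two complementary smooth line subbundles of the spinor bundle, spanned locally by the two members of a spin dyad $\{o^A,\iota^A\}$, $o_A\iota^A=1$. For a dyad along these directions put $\ell^a=o^A\bar o^{A'}$, $n^a=\iota^A\bar\iota^{A'}$, $m^a=o^A\bar\iota^{A'}$ and $$J_a{}^b=i(\ell_a n^b-n_a\ell^b+\bar m_a m^b-m_a\bar m^b).$$ Let $w_0,w_1\in\mathbb R$ with $w_0+w_1+1=0$. (a) $J$ is a (complex-valued) almost-complex structure with $J_a{}^cJ_b{}^dg_{cd}=g_{ab}$. It does not depend on the dyad along the two directions nor on the metric in the conformal class $[g]$. There is a unique complex Weyl connection $\slashed\nabla_a$ (torsion-free, $\slashed\nabla_a g_{bc}=-2f_ag_{bc}$ for a complex 1-form $f_a$) with $\slashed\nabla_bJ_a{}^b=0$. (b) The conformal null tetrads $N_{\bf a}=(\ell,n,m,\bar m)$ (that is, $\hat g(\ell,n)=-\hat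 g(m,\bar m)=1$ and all other products zero, for some $\hat g\in[g]$) with $\ell,n$ along the two given null directions and $m$ in the complex line of $o^A\bar\iota^{A'}$ form a principal bundle $B$ with group $G_o=\mathbb R^\times\times U(1)\times\mathbb R^+$ acting by $\ell\to\Omega^{2w_0}a\ell$, $n\to\Omega^{2w_1}a^{-1}n$, $m\to\Omega^{w_0+w_1}zm$. Likewise the conformal spin dyads along the two directions (those with $\hat\epsilon_{AB}o^A\iota^B=1$ for some $\hat\epsilon=\Omega\epsilon$, $\Omega>0$) form a principal bundle $\widetilde B$ with group $\mathbb C^\times\times\mathbb R^+$ acting by $o\to\Omega^{w_0}\lambda o$, $\iota\to\Omega^{w_1}\lambda^{-1}\iota$, which maps to $B$ over $a=|\lambda|^2$, $z=\lambda/\bar\lambda$. Let $\slashed\omega_a{}^{\bf b}{}_{\bf c}=N^{\bf b}_b\slashed\nabla_aN^b_{\bf c}$ in a local section of $B$. Under a change of section in $B$ the off-diagonal components transform homogeneously. The diagonal components transform with an inhomogeneous term; they take values in the complexified Lie algebra of $G_o$ and amount to $\psi_a=(K_a,L_a,f_a)$, where $$K=w_1\slashed\omega^0{}_0-w_0\slashed\omega^1{}_1,\qquad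 L=\tfrac12(\slashed\omega^3{}_3-\slashed\omega^2{}_2),\qquad f=\tfrac12(\slashed\omega^2{}_2+\slashed\omega^3{}_3).$$ These transform by $K\to K+a\,da^{-1}$, $L\to L+z\,dz^{-1}$, $f\to f+\Omega\,d\Omega^{-1}$. (c) Let $\rho,\tau,\epsilon,\beta$ and their primes be the Geroch–Held–Penrose (GHP) spin coefficients, taken for the metric of $[g]$ in which the tetrad is normalized, and let $\omega_a=-\epsilon n_a+\epsilon'\ell_a-\beta'm_a+\beta\bar m_a$ be the GHP connection form. Then $$f_a=\rho n_a+\rho'\ell_a-\tau\bar m_a-\tau'm_a,\qquad \tfrac12(K_a+L_a)=\omega_a+B_a,\qquad \tfrac12(K_a-L_a)=\bar\omega_a+C_a,$$ $$B_a=w_1(\rho n_a-\tau\bar m_a)-w_0(\rho'\ell_a-\tau'm_a),\qquad C_a=w_1(\rho n_a-\tau'm_a)-w_0(\rho'\ell_a-\tau\bar m_a),$$ and $f_a$ is the Weyl 1-form of $\slashed\nabla$ for the metric in which the tetrad is normalized. (d) For $b,s\in\mathbb Z$, $w\in\mathbb R$, let $\mathbb E_{\{p,q\}}[w]$, $p=b+s$,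 $q=b-s$, be the complex line bundle associated to $B$ and $\Pi(a,z,\Omega)=a^bz^s\Omega^w$. For arbitrary $p,q\in\mathbb Z$, let it be the line bundle associated to $\widetilde B$ and $\lambda^p\bar\lambda^q\Omega^w$. In both cases components change by these factors under a change of frame. The induced Lie algebra representation is $\pi(x,y,v)=p\frac{x+y}2+q\frac{x-y}2+wv$. There is exactly one covariant derivative $\slashed\Theta$ on $\mathbb E_{\{p,q\}}[w]$ given in every smooth local frame by $\slashed\Theta_a\eta=\partial_a\eta+\pi(\psi_a)\eta$. Explicitly, $$\slashed\Theta_a\eta=\partial_a\eta+wf_a\eta+p(\omega_a+B_a)\eta+q(\bar\omega_a+C_a)\eta.$$ If $w_0=0$, $w_1=-1$ and $w=q=0$, then $\slashed\Theta_a=D_a$, the Teukolsky connection $D_a\eta=\Theta_a\eta+p(-\rho n_a+\tau\bar m_a)\eta$, where $\Theta_a\eta=\partial_a\eta+p\,\omega_a\eta$ is the GHP derivative on type $\{p,0\}$. -/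

import Mathlib

open scoped Manifold ContDiff Bundle

namespace ConformalGHP

noncomputable section

/-! ### Complexified tangent vectors -/

section Tangent

variable {M : Type*} [TopologicalSpace M] [ChartedSpace (EuclideanSpace ℝ (Fin 4)) M]
  [IsManifold (𝓡 4) ∞ M]

/-- The tangent space of the 4-manifold `M` at `x`. -/
abbrev TM (x : M) : Type := TangentSpace (𝓡 4) x

/-- The complexified tangent space at `x`: the pair `(u, v)` is the complex vector `u + i v`. -/
abbrev CTM (x : M) : Type := TangentSpace (𝓡 4) x × TangentSpace (𝓡 4) x

/-- The model fibre of the complexified tangent bundle. -/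
abbrev CModel : Type := EuclideanSpace ℝ (Fin 4) × EuclideanSpace ℝ (Fin 4)

/-- A real tangent vector as a complex one. -/
def ofReal {x : M} (u : TM x) : CTM x := (u, 0)

/-- Complex conjugation of complex tangent vectors. -/
def conj {x : M} (v : CTM x) : CTM x := (v.1, -v.2)

/-- Multiplication of a complex tangent vector by a complex number. -/
def csmul {x : M} (c : ℂ) (v : CTM x) : CTM x :=
  (c.re • v.1 - c.im • v.2, c.re • v.2 + c.im • v.1)

/-- Multiplication by `i` on complex tangent vectors. -/
def mulI (x : M) : CTM x →ₗ[ℝ] CTM x where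
  toFun v := (-v.2, v.1)
  map_add' v w := by ext1 <;> simp [add_comm]
  map_smul' c v := by ext1 <;> simp

/-- Smoothness on `U` of a real vector field. -/
def SmoothVF (X : ∀ x : M, TM x) (U : Set M) : Prop :=
  ContMDiffOn (𝓡 4) (𝓡 4).tangent ∞ (fun x => (⟨x, X x⟩ : TangentBundle (𝓡 4) M)) U

/-- Differentiability at `x` of a real vector field. -/
def DiffVFAt (X : ∀ x : M, TM x) (x : M) : Prop :=
  MDifferentiableAt (𝓡 4) (𝓡 4).tangent (fun y => (⟨y, X y⟩ : TangentBundle (𝓡 4) M)) x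

/-- The differential of a real function. -/
def dR (φ : M → ℝ) (x : M) : TM x →L[ℝ] ℝ := mvfderiv (𝓡 4) φ x

/-- The differential of a complex function. -/
def dC (φ : M → ℂ) (x : M) : TM x →L[ℝ] ℂ := mvfderiv (𝓡 4) φ x

variable (M) in
/-- Fields of real bilinear forms on the tangent spaces. -/
abbrev FormField : Type _ := ∀ x : M, TM x →L[ℝ] TM x →L[ℝ] ℝ

/-- The complex bilinear extension of a real bilinear form. -/
def complexForm {x : M} (h : TM x →L[ℝ] TM x →L[ℝ] ℝ) (v w : CTM x) : ℂ :=
  ⟨h v.1 w.1 - h v.2 w.2, h v.1 w.2 + h v.2 w.1⟩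

/-- The Levi-Civita connection `∇` of `h` through the Koszul formula: this is `h(∇_X Y, Z)`. -/
def leviCivita (h : FormField M) (X Y Z : ∀ x : M, TM x) (x : M) : ℝ :=
  (1 / 2) * (dR (fun y => h y (Y y) (Z y)) x (X x) + dR (fun y => h y (Z y) (X y)) x (Y x)
    - dR (fun y => h y (X y) (Y y)) x (Z x)
    + h x (VectorField.mlieBracket (𝓡 4) X Y x) (Z x)
    - h x (VectorField.mlieBracket (𝓡 4) X Z x) (Y x)
    - h x (VectorField.mlieBracket (𝓡 4) Y Z x) (X x))

/-- `h(∇_X Y, Z)` for complex vector fields, by complex trilinear extension. -/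
def leviCivitaC (h : FormField M) (X Y Z : ∀ x : M, CTM x) (x : M) : ℂ :=
  let k := fun A B C : ∀ x : M, TM x => leviCivita h A B C x
  let X₁ := fun y => (X y).1
  let X₂ := fun y => (X y).2
  let Y₁ := fun y => (Y y).1
  let Y₂ := fun y => (Y y).2
  let Z₁ := fun y => (Z y).1
  let Z₂ := fun y => (Z y).2
  ⟨k X₁ Y₁ Z₁ - k X₁ Y₂ Z₂ - k X₂ Y₁ Z₂ - k X₂ Y₂ Z₁,
    k X₁ Y₁ Z₂ + k X₁ Y₂ Z₁ + k X₂ Y₁ Z₁ - k X₂ Y₂ Z₂⟩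

end Tangent

/-! ### Spacetimes, spinors and null directions -/

section Spacetime

variable (M : Type*) [TopologicalSpace M] [ChartedSpace (EuclideanSpace ℝ (Fin 4)) M]
  [IsManifold (𝓡 4) ∞ M]

/-- A smooth Lorentzian metric of signature `(+ - - -)`. -/
structure LorentzMetric where
  form : FormField M
  symm : ∀ (x : M) (u v : TM x), form x u v = form x v u
  signature : ∀ x : M, ∃ b : Module.Basis (Fin 4) ℝ (TM x), ∀ i j,
    form x (b i) (b j) = if i = j then (if i = 0 then 1 else -1) else 0
  smooth : ContMDiff (𝓡 4) ((𝓡 4).prod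
      𝓘(ℝ, EuclideanSpace ℝ (Fin 4) →L[ℝ] EuclideanSpace ℝ (Fin 4) →L[ℝ] ℝ)) ∞
    (fun x => Bundle.TotalSpace.mk'
      (EuclideanSpace ℝ (Fin 4) →L[ℝ] EuclideanSpace ℝ (Fin 4) →L[ℝ] ℝ) x (form x))

variable {M}

/-- The model fibre `ℂ²` of the spinor bundle. -/
abbrev SpinModel : Type := EuclideanSpace ℂ (Fin 2)

variable (S : M → Type*) [∀ x, AddCommGroup (S x)] [∀ x, Module ℂ (S x)]
  [∀ x, TopologicalSpace (S x)] [TopologicalSpace (Bundle.TotalSpace SpinModel S)]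
  [FiberBundle SpinModel S]

variable {S} in
/-- Smoothness on `U` of a spinor field. -/
def SmoothSpinor (s : ∀ x, S x) (U : Set M) : Prop :=
  ContMDiffOn (𝓡 4) ((𝓡 4).prod 𝓘(ℝ, SpinModel)) ∞
    (fun x => (⟨x, s x⟩ : Bundle.TotalSpace SpinModel S)) U

/-- A spinor structure on `(M, g)` with spinor bundle `S`: a smooth spinor metric `ε` and the
soldering `κ^A \bar μ^{A'} = solder κ μ`, sesquilinear and Hermitian, under which
`g_{ab} = ε_{AB} \bar ε_{A'B'}`. -/
structure SpinorStructure (g : LorentzMetric M) where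
  ε : ∀ x, S x →ₗ[ℂ] S x →ₗ[ℂ] ℂ
  ε_alt : ∀ x (κ : S x), ε x κ κ = 0
  solder : ∀ x, S x → S x → CTM x
  solder_add : ∀ x (κ κ' μ : S x), solder x (κ + κ') μ = solder x κ μ + solder x κ' μ
  solder_smul : ∀ x (c : ℂ) (κ μ : S x), solder x (c • κ) μ = csmul c (solder x κ μ)
  solder_conj : ∀ x (κ μ : S x), solder x μ κ = conj (solder x κ μ)
  isometry : ∀ x (κ μ κ' μ' : S x), complexForm (g.form x) (solder x κ μ) (solder x κ' μ')
    = ε x κ κ' * (starRingEnd ℂ) (ε x μ μ')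
  ε_nondegenerate : ∀ x (κ : S x), κ ≠ 0 → ∃ μ, ε x κ μ ≠ 0
  smooth_I : ∀ (U : Set M) (s : ∀ x, S x), IsOpen U → SmoothSpinor s U →
    SmoothSpinor (fun x => Complex.I • s x) U
  smooth_ε : ∀ (U : Set M) (s t : ∀ x, S x), IsOpen U → SmoothSpinor s U → SmoothSpinor t U →
    ContMDiffOn (𝓡 4) 𝓘(ℝ, ℂ) ∞ (fun x => ε x (s x) (t x)) U
  smooth_solder : ∀ (U : Set M) (s t : ∀ x, S x), IsOpen U → SmoothSpinor s U →
    SmoothSpinor t U → SmoothVF (fun x => (solder x (s x) (t x)).1) U ∧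
      SmoothVF (fun x => (solder x (s x) (t x)).2) U

variable {S} {g : LorentzMetric M}

/-- A pair of null directions, given by two complementary smooth line subbundles of the
spinor bundle: locally they are spanned by a smooth spin dyad `{o, ι}` with `o_A ι^A = 1`. -/
structure NullDirections (σ : SpinorStructure S g) where
  L₀ : ∀ x, Submodule ℂ (S x)
  L₁ : ∀ x, Submodule ℂ (S x)
  exists_dyad : ∀ x, ∃ (U : Set M) (o ι : ∀ y, S y), IsOpen U ∧ x ∈ U ∧
    SmoothSpinor o U ∧ SmoothSpinor ι U ∧
    ∀ y ∈ U, L₀ y = Submodule.span ℂ {o y} ∧ L₁ y = Submodule.span ℂ {ι y} ∧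
      σ.ε y (o y) (ι y) = 1

end Spacetime

/-! ### Null tetrads, the almost-complex structure, spin coefficients -/

section Frames

variable {M : Type*} [TopologicalSpace M] [ChartedSpace (EuclideanSpace ℝ (Fin 4)) M]
  [IsManifold (𝓡 4) ∞ M]

/-- A tetrad `{l, n, m, \bar m}` at `x` with `l`, `n` real. -/
@[ext] structure Tetrad (x : M) where
  l : TM x
  n : TM x
  m : CTM x

/-- The Geroch-Held-Penrose prime operation on tetrads, `l ↔ n`, `m ↔ \bar m`. -/
def Tetrad.prime {x : M} (N : Tetrad x) : Tetrad x := ⟨N.n, N.l, conj N.m⟩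

/-- Membership in the conformal null frame bundle: `g(N_a, N_b) = α² ν_{ab}` for some `α > 0`, with
`ν_{01} = 1 = -ν_{23}` and all other components zero. -/
structure IsConformalNull {x : M} (h : TM x →L[ℝ] TM x →L[ℝ] ℝ) (N : Tetrad x) : Prop where
  ln : 0 < h N.l N.n
  mm : complexForm h N.m (conj N.m) = -(h N.l N.n : ℂ)
  ll : h N.l N.l = 0
  nn : h N.n N.n = 0
  lm : complexForm h (ofReal N.l) N.m = 0
  nm : complexForm h (ofReal N.n) N.m = 0
  m0 : complexForm h N.m N.m = 0

/-- The frame vectors `N_0 = l`, `N_1 = n`, `N_2 = m`, `N_3 = \bar m`. -/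
def Tetrad.leg {x : M} (N : Tetrad x) : Fin 4 → CTM x :=
  ![ofReal N.l, ofReal N.n, N.m, conj N.m]

/-- The metric of the conformal class in which the tetrad `N` is normalized, `l · n = 1`. -/
def frameMetric (g : FormField M) (N : ∀ x : M, Tetrad x) : FormField M :=
  fun x => (g x (N x).l (N x).n)⁻¹ • g x

/-- The value on the real vector `X` of the 1-form obtained by lowering the index of `v` with the
metric in which `N` is normalized. -/
def lower (g : FormField M) (N : ∀ x : M, Tetrad x) {x : M} (v : CTM x) (X : TM x) : ℂ :=
  complexForm (frameMetric g N x) v (ofReal X)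

/-- The dual frame of a null tetrad, `N^0 = n_a`, `N^1 = l_a`, `N^2 = -\bar m_a`, `N^3 = -m_a`. -/
def coleg (g : FormField M) (N : ∀ x : M, Tetrad x) (x : M) (i : Fin 4) (v : CTM x) : ℂ :=
  complexForm (frameMetric g N x)
    ((![ofReal (N x).n, ofReal (N x).l, -conj (N x).m, -(N x).m] : Fin 4 → CTM x) i) v

/-- The almost-complex structure
`J_a^b = i (l_a n^b - n_a l^b + \bar m_a m^b - m_a \bar m^b)` of a tetrad, as a map from real to
complex tangent vectors; indices are lowered with the metric in which the tetrad is normalized. -/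
def acs {x : M} (h : TM x →L[ℝ] TM x →L[ℝ] ℝ) (N : Tetrad x) : TM x →ₗ[ℝ] CTM x where
  toFun X := csmul (Complex.I * ((h N.l N.n)⁻¹ : ℝ))
    (csmul (h N.l X) (ofReal N.n) - csmul (h N.n X) (ofReal N.l)
      + csmul (complexForm h (conj N.m) (ofReal X)) N.m
      - csmul (complexForm h N.m (ofReal X)) (conj N.m))
  map_add' X Y := by
    ext1 <;> simp [csmul, complexForm, ofReal, conj] <;> module
  map_smul' c X := by
    ext1 <;> simp [csmul, complexForm, ofReal, conj] <;> module

/-- The complex linear extension of a map from real to complex tangent vectors. -/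
def complexify {x : M} (J : TM x →ₗ[ℝ] CTM x) : CTM x →ₗ[ℝ] CTM x :=
  J ∘ₗ LinearMap.fst ℝ _ _ + mulI x ∘ₗ J ∘ₗ LinearMap.snd ℝ _ _

/-- The complex trace of the complex linear extension of a map from real to complex tangent
vectors. -/
def ctrace {x : M} (F : TM x →ₗ[ℝ] CTM x) : ℂ :=
  ⟨LinearMap.trace ℝ (TM x) (LinearMap.fst ℝ _ _ ∘ₗ F),
    LinearMap.trace ℝ (TM x) (LinearMap.snd ℝ _ _ ∘ₗ F)⟩

/-- `h(∇_X Y, Z)` for fields `X, Y, Z` of complex vectors, `∇` being the Levi-Civita connection of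
the metric in which the tetrad field `N` is normalized. -/
def nabla (g : FormField M) (N : ∀ x : M, Tetrad x) (X Y Z : ∀ x : M, CTM x) (x : M) : ℂ :=
  leviCivitaC (frameMetric g N) X Y Z x

/-- `ρ = m^a δ' l_a`, where `δ' = \bar m^a ∇_a`. -/
def rho (g : FormField M) (N : ∀ x : M, Tetrad x) (x : M) : ℂ :=
  nabla g N (fun y => conj (N y).m) (fun y => ofReal (N y).l) (fun y => (N y).m) x

/-- `τ = m^a D' l_a`, where `D' = n^a ∇_a`. -/
def tau (g : FormField M) (N : ∀ x : M, Tetrad x) (x : M) : ℂ :=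
  nabla g N (fun y => ofReal (N y).n) (fun y => ofReal (N y).l) (fun y => (N y).m) x

/-- `ε = (n^a D l_a + m^a D \bar m_a) / 2`, where `D = l^a ∇_a`. -/
def eps (g : FormField M) (N : ∀ x : M, Tetrad x) (x : M) : ℂ :=
  (1 / 2) *
    (nabla g N (fun y => ofReal (N y).l) (fun y => ofReal (N y).l) (fun y => ofReal (N y).n) x
      + nabla g N (fun y => ofReal (N y).l) (fun y => conj (N y).m) (fun y => (N y).m) x)

/-- `β = (n^a δ l_a + m^a δ \bar m_a) / 2`, where `δ = m^a ∇_a`. -/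
def beta (g : FormField M) (N : ∀ x : M, Tetrad x) (x : M) : ℂ :=
  (1 / 2) *
    (nabla g N (fun y => (N y).m) (fun y => ofReal (N y).l) (fun y => ofReal (N y).n) x
      + nabla g N (fun y => (N y).m) (fun y => conj (N y).m) (fun y => (N y).m) x)

/-- `ρ'`. -/
def rho' (g : FormField M) (N : ∀ x : M, Tetrad x) : M → ℂ := rho g (fun y => (N y).prime)

/-- `τ'`. -/
def tau' (g : FormField M) (N : ∀ x : M, Tetrad x) : M → ℂ := tau g (fun y => (N y).prime)

/-- `ε'`. -/
def eps' (g : FormField M) (N : ∀ x : M, Tetrad x) : M → ℂ := eps g (fun y => (N y).prime)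

/-- `β'`. -/
def beta' (g : FormField M) (N : ∀ x : M, Tetrad x) : M → ℂ := beta g (fun y => (N y).prime)

/-- `l_a X^a`. -/
def lForm (g : FormField M) (N : ∀ x : M, Tetrad x) (x : M) (X : TM x) : ℂ :=
  lower g N (ofReal (N x).l) X

/-- `n_a X^a`. -/
def nForm (g : FormField M) (N : ∀ x : M, Tetrad x) (x : M) (X : TM x) : ℂ :=
  lower g N (ofReal (N x).n) X

/-- `m_a X^a`. -/
def mForm (g : FormField M) (N : ∀ x : M, Tetrad x) (x : M) (X : TM x) : ℂ :=
  lower g N (N x).m X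

/-- `\bar m_a X^a`. -/
def mbarForm (g : FormField M) (N : ∀ x : M, Tetrad x) (x : M) (X : TM x) : ℂ :=
  lower g N (conj (N x).m) X

/-- The GHP connection form `ω_a = -ε n_a + ε' l_a - β' m_a + β \bar m_a`. -/
def ghpForm (g : FormField M) (N : ∀ x : M, Tetrad x) (x : M) (X : TM x) : ℂ :=
  -eps g N x * nForm g N x X + eps' g N x * lForm g N x X
    - beta' g N x * mForm g N x X + beta g N x * mbarForm g N x X

/-- The conjugate GHP connection form `\bar ω_a`, on real vectors. -/
def ghpFormBar (g : FormField M) (N : ∀ x : M, Tetrad x) (x : M) (X : TM x) : ℂ :=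
  (starRingEnd ℂ) (ghpForm g N x X)

/-- `f_a = ρ n_a + ρ' l_a - τ \bar m_a - τ' m_a`. -/
def fForm (g : FormField M) (N : ∀ x : M, Tetrad x) (x : M) (X : TM x) : ℂ :=
  rho g N x * nForm g N x X + rho' g N x * lForm g N x X
    - tau g N x * mbarForm g N x X - tau' g N x * mForm g N x X

/-- `B_a = w₁ (ρ n_a - τ \bar m_a) - w₀ (ρ' l_a - τ' m_a)`. -/
def bForm (g : FormField M) (w₀ w₁ : ℝ) (N : ∀ x : M, Tetrad x) (x : M) (X : TM x) : ℂ :=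
  w₁ * (rho g N x * nForm g N x X - tau g N x * mbarForm g N x X)
    - w₀ * (rho' g N x * lForm g N x X - tau' g N x * mForm g N x X)

/-- `C_a = w₁ (ρ n_a - τ' m_a) - w₀ (ρ' l_a - τ \bar m_a)`. -/
def cForm (g : FormField M) (w₀ w₁ : ℝ) (N : ∀ x : M, Tetrad x) (x : M) (X : TM x) : ℂ :=
  w₁ * (rho g N x * nForm g N x X - tau' g N x * mForm g N x X)
    - w₀ * (rho' g N x * lForm g N x X - tau g N x * mbarForm g N x X)

/-- The GHP covariant derivative `Θ_a η = ∂_a η + p ω_a η + q \bar ω_a η` of a component function of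
type `{p, q}`. -/
def ghpDeriv (g : FormField M) (p q : ℤ) (N : ∀ x : M, Tetrad x) (η : M → ℂ) (x : M) (X : TM x) :
    ℂ :=
  dC η x X + p * ghpForm g N x X * η x + q * ghpFormBar g N x X * η x

/-- The Teukolsky connection `D_a η = Θ_a η + p B_a η`, `B_a = -ρ n_a + τ \bar m_a`, on quantities of
type `{p, 0}`. -/
def teukolsky (g : FormField M) (p : ℤ) (N : ∀ x : M, Tetrad x) (η : M → ℂ) (x : M) (X : TM x) :
    ℂ :=
  ghpDeriv g p 0 N η x X
    + p * (-rho g N x * nForm g N x X + tau g N x * mbarForm g N x X) * η x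

/-- `∂_a η + w f_a η + p (ω_a + B_a) η + q (\bar ω_a + C_a) η`. -/
def slashedTheta (g : FormField M) (w₀ w₁ w : ℝ) (p q : ℤ) (N : ∀ x : M, Tetrad x) (η : M → ℂ)
    (x : M) (X : TM x) : ℂ :=
  dC η x X + w * fForm g N x X * η x + p * (ghpForm g N x X + bForm g w₀ w₁ N x X) * η x
    + q * (ghpFormBar g N x X + cForm g w₀ w₁ N x X) * η x

end Frames

/-! ### Weyl connections -/

section Weyl

variable {M : Type*} [TopologicalSpace M] [ChartedSpace (EuclideanSpace ℝ (Fin 4)) M]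
  [IsManifold (𝓡 4) ∞ M]

variable (M) in
/-- Connections on the complexified tangent bundle; `D Y x X` is `D_X Y` at `x`. -/
abbrev CConnection : Type _ := CovariantDerivative (𝓡 4) CModel (fun x : M => CTM x)

/-- `D h = -2 f ⊗ h` on `U`. -/
def IsWeylForm (h : FormField M) (D : CConnection M) (f : ∀ x : M, TM x → ℂ) (U : Set M) : Prop :=
  ∀ x ∈ U, ∀ Y Z : ∀ y : M, TM y, DiffVFAt Y x → DiffVFAt Z x → ∀ X : TM x,
    (dR (fun y => h y (Y y) (Z y)) x X : ℂ)
      - complexForm (h x) (D (fun y => ofReal (Y y)) x X) (ofReal (Z x))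
      - complexForm (h x) (ofReal (Y x)) (D (fun y => ofReal (Z y)) x X)
    = -2 * f x X * h x (Y x) (Z x)

/-- `D` is a (complex) Weyl connection for the conformal class of `g`, compatible with `J`: a complex
linear torsion-free connection with `D g = -2 f ⊗ g` for a complex 1-form `f`, and `D_b J_a^b = 0`.
The last condition says that `Z ↦ (D_Z J) Y = D_Z (J Y) - J (D_Z Y)` is trace-free for all `Y`. -/
structure IsCompatibleWeyl (g : FormField M) (J : ∀ x : M, TM x →ₗ[ℝ] CTM x)
    (D : CConnection M) : Prop where
  complex_linear : ∀ (x : M) (Y Z : ∀ y : M, TM y), DiffVFAt Y x → DiffVFAt Z x → ∀ X : TM x,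
    D (fun y => (-Z y, Y y)) x X = mulI x (D (fun y => (Y y, Z y)) x X)
  torsion_free : ∀ (x : M) (Y Z : ∀ y : M, TM y), DiffVFAt Y x → DiffVFAt Z x →
    D (fun y => ofReal (Z y)) x (Y x) - D (fun y => ofReal (Y y)) x (Z x)
      = ofReal (VectorField.mlieBracket (𝓡 4) Y Z x)
  weyl : ∃ f : ∀ x : M, TM x →L[ℝ] ℂ, IsWeylForm g D (fun x X => f x X) Set.univ
  compatible : ∀ (x : M) (Y : ∀ y : M, TM y), DiffVFAt Y x →
    ctrace ((D (fun y => J y (Y y)) x : TM x →ₗ[ℝ] CTM x)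
      - complexify (J x) ∘ₗ (D (fun y => ofReal (Y y)) x : TM x →ₗ[ℝ] CTM x)) = 0

/-- The connection form `ω_a^i_j = N^i_b D_a N_j^b` of `D` in the frame field `N`. -/
def connForm (g : FormField M) (D : CConnection M) (N : ∀ x : M, Tetrad x) (i j : Fin 4) (x : M)
    (X : TM x) : ℂ :=
  coleg g N x i (D (fun y => (N y).leg j) x X)

/-- The reduced connection form `ψ = (K, L, f)`: `K = w₁ ω^0_0 - w₀ ω^1_1`,
`L = (ω^3_3 - ω^2_2) / 2`, `f = (ω^2_2 + ω^3_3) / 2`. -/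
def psi (g : FormField M) (D : CConnection M) (w₀ w₁ : ℝ) (N : ∀ x : M, Tetrad x) (x : M)
    (X : TM x) : ℂ × ℂ × ℂ :=
  (w₁ * connForm g D N 0 0 x X - w₀ * connForm g D N 1 1 x X,
    (1 / 2) * (connForm g D N 3 3 x X - connForm g D N 2 2 x X),
    (1 / 2) * (connForm g D N 2 2 x X + connForm g D N 3 3 x X))

end Weyl

/-! ### The reduced bundles and the associated line bundles -/

section Bundles

/-- The multiplicative group of positive reals. -/
abbrev PosReal : Type := {Ω : ℝ // 0 < Ω}

/-- The GHP-conformal group `ℝ^× × U(1) × ℝ^+`. -/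
abbrev GHPGroup : Type := ℝˣ × Circle × PosReal

/-- The group `ℂ^× × ℝ^+` acting on spin dyads. -/
abbrev SpinGHPGroup : Type := ℂˣ × PosReal

/-- The factor by which `(a, z, Ω)` rescales the frame vectors:
`Ω^{2w₀} a`, `Ω^{2w₁} a⁻¹`, `Ω^{w₀+w₁} z`, `Ω^{w₀+w₁} \bar z`. -/
def legFactor (w₀ w₁ : ℝ) (i : Fin 4) (γ : GHPGroup) : ℂ :=
  (![((γ.2.2 : ℝ) ^ (2 * w₀) : ℝ) * ((γ.1 : ℝ) : ℂ),
    ((γ.2.2 : ℝ) ^ (2 * w₁) : ℝ) * ((γ.1 : ℝ) : ℂ)⁻¹,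
    ((γ.2.2 : ℝ) ^ (w₀ + w₁) : ℝ) * (γ.2.1 : ℂ),
    ((γ.2.2 : ℝ) ^ (w₀ + w₁) : ℝ) * (starRingEnd ℂ) (γ.2.1 : ℂ)] : Fin 4 → ℂ) i

/-- The representation `Π_{b,s,w}(a, z, Ω) = a^b z^s Ω^w`. -/
def tetradRep (b s : ℤ) (w : ℝ) (γ : GHPGroup) : ℂ :=
  ((γ.1 : ℝ) : ℂ) ^ b * (γ.2.1 : ℂ) ^ s * (((γ.2.2 : ℝ) ^ w : ℝ) : ℂ)

/-- The representation `(λ, Ω) ↦ λ^p \bar λ^q Ω^w`. -/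
def dyadRep (p q : ℤ) (w : ℝ) (γ : SpinGHPGroup) : ℂ :=
  (γ.1 : ℂ) ^ p * (starRingEnd ℂ) (γ.1 : ℂ) ^ q * (((γ.2 : ℝ) ^ w : ℝ) : ℂ)

/-- The one-parameter subgroups `e^t`, `e^{it}`, `e^t` of the three factors of the GHP-conformal
group. -/
def ghpOneParam (t : ℝ) : Fin 3 → GHPGroup :=
  ![(Units.mk0 (Real.exp t) (Real.exp_ne_zero t), 1, 1), (1, Circle.exp t, 1),
    (1, 1, ⟨Real.exp t, Real.exp_pos t⟩)]

/-- Their lifts to spin dyads under `a = |λ|²`, `z = λ / \bar λ`: `e^{t/2}`, `e^{it/2}`, `e^t`. -/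
def spinOneParam (t : ℝ) : Fin 3 → SpinGHPGroup :=
  ![(Units.mk0 (Complex.exp (t / 2)) (Complex.exp_ne_zero _), 1),
    (Units.mk0 (Complex.exp (Complex.I * t / 2)) (Complex.exp_ne_zero _), 1),
    (1, ⟨Real.exp t, Real.exp_pos t⟩)]

variable {M : Type*} [TopologicalSpace M] [ChartedSpace (EuclideanSpace ℝ (Fin 4)) M]
  [IsManifold (𝓡 4) ∞ M]

variable (M) in
/-- The common shape of the two concrete principal bundles below (adapted tetrads and adapted
dyads): fibres, structure group with its right action, smooth local sections, the tetrad of a point,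
and the one-parameter subgroups that identify the complexified Lie algebra with `ℂ ⊕ ℂ ⊕ ℂ`. -/
structure FrameBundle (G : Type*) where
  Fib : M → Type*
  act : ∀ x, Fib x → G → Fib x
  tetrad : ∀ x, Fib x → Tetrad x
  SmoothOn : (∀ x, Fib x) → Set M → Prop
  oneParam : ℝ → Fin 3 → G

/-- `G` acts on the fibres from the right, freely and transitively. -/
structure FrameBundle.IsPrincipal {G : Type*} [Group G] (P : FrameBundle M G) : Prop where
  act_one : ∀ x (N : P.Fib x), P.act x N 1 = N
  act_mul : ∀ x (N : P.Fib x) (γ γ' : G), P.act x (P.act x N γ) γ' = P.act x N (γ * γ')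
  simply_transitive : ∀ x (N N' : P.Fib x), ∃! γ : G, N' = P.act x N γ
  local_section : ∀ x (N : P.Fib x), ∃ (U : Set M) (s : ∀ y, P.Fib y), IsOpen U ∧ x ∈ U ∧
    P.SmoothOn s U ∧ s x = N

/-- The tetrad field of a section. -/
def FrameBundle.field {G : Type*} (P : FrameBundle M G) (N : ∀ x, P.Fib x) :
    ∀ x : M, Tetrad x :=
  fun x => P.tetrad x (N x)

/-- The complexified Lie algebra representation `π` induced by a 1-dimensional representation `χ`,
that is, the complex linear extension of the derivative of `χ` at the identity, evaluated on
`(x, y, v)`; an element of `u(1) = iℝ` is `y = i θ`. -/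
def FrameBundle.lieRep {G : Type*} (P : FrameBundle M G) (χ : G → ℂ) (ξ : ℂ × ℂ × ℂ) : ℂ :=
  ξ.1 * deriv (fun t : ℝ => χ (P.oneParam t 0)) 0
    + (-Complex.I * ξ.2.1) * deriv (fun t : ℝ => χ (P.oneParam t 1)) 0
    + ξ.2.2 * deriv (fun t : ℝ => χ (P.oneParam t 2)) 0

/-- Smooth sections of the line bundle associated to `P` and `χ`: equivariant functions on `P`,
whose values are the components in the frame, so that they change to `χ(γ) η` when the frame `N`
changes to `N γ`. -/
structure WeightedSection {G : Type*} (P : FrameBundle M G) (χ : G → ℂ) where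
  toFun : ∀ x, P.Fib x → ℂ
  equivariant : ∀ x (N : P.Fib x) (γ : G), toFun x (P.act x N γ) = χ γ * toFun x N
  smooth : ∀ (U : Set M) (N : ∀ x, P.Fib x), IsOpen U → P.SmoothOn N U →
    ContMDiffOn (𝓡 4) 𝓘(ℝ, ℂ) ∞ (fun x => toFun x (N x)) U

/-- The component function of a weighted section in a frame field. -/
def WeightedSection.comp {G : Type*} {P : FrameBundle M G} {χ : G → ℂ} (η : WeightedSection P χ)
    (N : ∀ x, P.Fib x) : M → ℂ := fun x => η.toFun x (N x)

/-- `Θ` is the covariant derivative on the line bundle associated to `P` and `χ` that is induced by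
the connection form `ψ`: it takes smooth sections to smooth section-valued 1-forms, is additive,
satisfies the Leibniz rule, and in every smooth local frame field is `∂ η + π(ψ) η`. -/
structure IsInducedDeriv {G : Type*} (g : FormField M) (D : CConnection M) (w₀ w₁ : ℝ)
    (P : FrameBundle M G) (χ : G → ℂ)
    (Θ : WeightedSection P χ → ∀ x, P.Fib x → (TM x →L[ℝ] ℂ)) : Prop where
  equivariant : ∀ η x (N : P.Fib x) (γ : G), Θ η x (P.act x N γ) = χ γ • Θ η x N
  smooth : ∀ η (U : Set M) (N : ∀ x, P.Fib x) (X : ∀ x, TM x), IsOpen U → P.SmoothOn N U →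
    SmoothVF X U → ContMDiffOn (𝓡 4) 𝓘(ℝ, ℂ) ∞ (fun x => Θ η x (N x) (X x)) U
  add : ∀ η η' η'' : WeightedSection P χ,
    (∀ x N, η''.toFun x N = η.toFun x N + η'.toFun x N) → ∀ x N, Θ η'' x N = Θ η x N + Θ η' x N
  leibniz : ∀ (φ : M → ℂ) (η η' : WeightedSection P χ), ContMDiff (𝓡 4) 𝓘(ℝ, ℂ) ∞ φ →
    (∀ x N, η'.toFun x N = φ x * η.toFun x N) →
    ∀ x N, Θ η' x N = φ x • Θ η x N + η.toFun x N • dC φ x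
  local_formula : ∀ η (U : Set M) (N : ∀ x, P.Fib x), IsOpen U → P.SmoothOn N U → ∀ x ∈ U,
    ∀ X : TM x, Θ η x (N x) X
      = dC (η.comp N) x X + P.lieRep χ (psi g D w₀ w₁ (P.field N) x X) * η.comp N x

variable {S : M → Type*} [∀ x, AddCommGroup (S x)] [∀ x, Module ℂ (S x)]
  [∀ x, TopologicalSpace (S x)] [TopologicalSpace (Bundle.TotalSpace SpinModel S)]
  [FiberBundle SpinModel S] {g : LorentzMetric M} {σ : SpinorStructure S g}

/-- A conformal spin dyad `{o, ι}` at `x` along the two null directions: it is normalized,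
`\hat ε_{AB} o^A ι^B = 1`, for some `\hat ε = Ω ε`. -/
@[ext] structure AdaptedDyad (L : NullDirections σ) (x : M) where
  o : S x
  ι : S x
  o_mem : o ∈ L.L₀ x
  ι_mem : ι ∈ L.L₁ x
  normalized : ∃ r : ℝ, 0 < r ∧ σ.ε x o ι = r

/-- The null tetrad `l = o \bar o`, `n = ι \bar ι`, `m = o \bar ι` of a dyad. -/
def dyadTetrad (σ : SpinorStructure S g) {x : M} (o ι : S x) : Tetrad x :=
  ⟨(σ.solder x o o).1, (σ.solder x ι ι).1, σ.solder x o ι⟩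

/-- The fibre at `x` of the reduction of the conformal null frame bundle determined by the two null
directions: `l` and `n` lie along them, and `m` has the phase freedom of `o \bar ι`. -/
@[ext] structure AdaptedTetrad (L : NullDirections σ) (x : M) extends Tetrad x where
  conformalNull : IsConformalNull (g.form x) toTetrad
  adapted : ∃ o ∈ L.L₀ x, ∃ ι ∈ L.L₁ x, ∃ (r s : ℝ) (c : ℂ),
    l = r • (dyadTetrad σ o ι).l ∧ n = s • (dyadTetrad σ o ι).n ∧
      m = csmul c (dyadTetrad σ o ι).m

theorem act_conformalNull {x : M} {h : TM x →L[ℝ] TM x →L[ℝ] ℝ} {N : Tetrad x}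
    (hN : IsConformalNull h N) {r s : ℝ} {c : ℂ} (hrs : 0 < r * s)
    (hc : Complex.normSq c = r * s) : IsConformalNull h ⟨r • N.l, s • N.n, csmul c N.m⟩ := by
  have e : ∀ (d d' : ℂ) (v w : CTM x),
      complexForm h (csmul d v) (csmul d' w) = d * d' * complexForm h v w := by
    intro d d' v w
    apply Complex.ext <;> simp [complexForm, csmul] <;> ring
  have e₁ : ∀ (t : ℝ) (u : TM x), ofReal (t • u) = csmul (t : ℂ) (ofReal u) := by
    intro t u
    simp [ofReal, csmul]
  have e₂ : conj (csmul c N.m) = csmul ((starRingEnd ℂ) c) (conj N.m) := by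
    ext1 <;> simp [conj, csmul]
    abel
  refine ⟨?_, ?_, ?_, ?_, ?_, ?_, ?_⟩
  · have := mul_pos hrs hN.ln
    simp only [map_smul, smul_apply, smul_eq_mul]
    linarith
  · simp only [e₂, e, hN.mm, Complex.mul_conj, hc, map_smul, smul_apply,
      smul_eq_mul]
    push_cast
    ring
  · simp [hN.ll]
  · simp [hN.nn]
  · simp only [e₁, e, hN.lm, mul_zero]
  · simp only [e₁, e, hN.nm, mul_zero]
  · simp only [e, hN.m0, mul_zero]

theorem csmul_csmul {x : M} (c d : ℂ) (v : CTM x) : csmul c (csmul d v) = csmul (c * d) v := by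
  ext1 <;> simp [csmul] <;> module

/-- The action of the GHP-conformal group on adapted tetrads:
`l → Ω^{2w₀} a l`, `n → Ω^{2w₁} a⁻¹ n`, `m → Ω^{w₀+w₁} z m`. -/
def AdaptedTetrad.act (w₀ w₁ : ℝ) {L : NullDirections σ} {x : M} (N : AdaptedTetrad L x)
    (γ : GHPGroup) : AdaptedTetrad L x where
  l := ((γ.2.2 : ℝ) ^ (2 * w₀) * (γ.1 : ℝ)) • N.l
  n := ((γ.2.2 : ℝ) ^ (2 * w₁) * (γ.1 : ℝ)⁻¹) • N.n
  m := csmul (((γ.2.2 : ℝ) ^ (w₀ + w₁) : ℝ) * (γ.2.1 : ℂ)) N.m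
  conformalNull := by
    have hΩ : 0 < (γ.2.2 : ℝ) := γ.2.2.2
    have key : (γ.2.2 : ℝ) ^ (2 * w₀) * (γ.1 : ℝ) * ((γ.2.2 : ℝ) ^ (2 * w₁) * (γ.1 : ℝ)⁻¹)
        = (γ.2.2 : ℝ) ^ (w₀ + w₁) * (γ.2.2 : ℝ) ^ (w₀ + w₁) := by
      rw [← Real.rpow_add hΩ, mul_mul_mul_comm, ← Real.rpow_add hΩ,
        mul_inv_cancel₀ γ.1.ne_zero, mul_one]
      congr 1
      ring
    refine act_conformalNull N.conformalNull ?_ ?_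
    · rw [key]
      positivity
    · rw [key, Complex.normSq_mul, Complex.normSq_ofReal, Circle.normSq_coe, mul_one]
  adapted := by
    obtain ⟨o, ho, ι, hι, r, s, c, hl, hn, hm⟩ := N.adapted
    exact ⟨o, ho, ι, hι, _, _, _, by rw [hl, smul_smul], by rw [hn, smul_smul],
      by rw [hm, csmul_csmul]⟩

/-- The action of `ℂ^× × ℝ^+` on adapted dyads: `o → Ω^{w₀} λ o`, `ι → Ω^{w₁} λ⁻¹ ι`. -/
def AdaptedDyad.act (w₀ w₁ : ℝ) {L : NullDirections σ} {x : M} (d : AdaptedDyad L x)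
    (γ : SpinGHPGroup) : AdaptedDyad L x where
  o := (((γ.2 : ℝ) ^ w₀ : ℝ) * (γ.1 : ℂ)) • d.o
  ι := (((γ.2 : ℝ) ^ w₁ : ℝ) * (γ.1 : ℂ)⁻¹) • d.ι
  o_mem := (L.L₀ x).smul_mem _ d.o_mem
  ι_mem := (L.L₁ x).smul_mem _ d.ι_mem
  normalized := by
    obtain ⟨r, hr, he⟩ := d.normalized
    have hΩ : 0 < (γ.2 : ℝ) := γ.2.2
    refine ⟨(γ.2 : ℝ) ^ w₀ * (γ.2 : ℝ) ^ w₁ * r, by positivity, ?_⟩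
    have h1 : (γ.1 : ℂ) ≠ 0 := γ.1.ne_zero
    simp only [map_smul, LinearMap.smul_apply, smul_eq_mul, he]
    push_cast
    field_simp

/-- The reduction of the conformal null frame bundle to the GHP-conformal group. -/
def tetradBundle (L : NullDirections σ) (w₀ w₁ : ℝ) : FrameBundle M GHPGroup where
  Fib x := AdaptedTetrad L x
  act _ N γ := N.act w₀ w₁ γ
  tetrad _ N := N.toTetrad
  SmoothOn N U := SmoothVF (fun x => (N x).l) U ∧ SmoothVF (fun x => (N x).n) U ∧
    SmoothVF (fun x => (N x).m.1) U ∧ SmoothVF (fun x => (N x).m.2) U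
  oneParam := ghpOneParam

/-- The bundle of adapted conformal spin dyads. -/
def dyadBundle (L : NullDirections σ) (w₀ w₁ : ℝ) : FrameBundle M SpinGHPGroup where
  Fib x := AdaptedDyad L x
  act _ d γ := d.act w₀ w₁ γ
  tetrad _ d := dyadTetrad σ d.o d.ι
  SmoothOn d U := SmoothSpinor (fun x => (d x).o) U ∧ SmoothSpinor (fun x => (d x).ι) U
  oneParam := spinOneParam

theorem NullDirections.nonempty_dyad (L : NullDirections σ) (x : M) :
    Nonempty (AdaptedDyad L x) := by
  obtain ⟨U, o, ι, -, hx, -, -, h⟩ := L.exists_dyad x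
  obtain ⟨h₀, h₁, h₂⟩ := h x hx
  exact ⟨⟨o x, ι x, h₀ ▸ Submodule.mem_span_singleton_self _,
    h₁ ▸ Submodule.mem_span_singleton_self _, 1, one_pos, by simpa using h₂⟩⟩

/-- The almost-complex structure built from any spin dyad along the two null directions. -/
def NullDirections.J (L : NullDirections σ) (x : M) : TM x →ₗ[ℝ] CTM x :=
  let d : AdaptedDyad L x := Classical.choice (L.nonempty_dyad x)
  acs (g.form x) (dyadTetrad σ d.o d.ι)

/-- Smoothness on `U` of a function with values in the GHP-conformal group. -/
def SmoothGauge (γ : M → GHPGroup) (U : Set M) : Prop :=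
  ContMDiffOn (𝓡 4) 𝓘(ℝ, ℝ) ∞ (fun x => ((γ x).1 : ℝ)) U ∧
    ContMDiffOn (𝓡 4) 𝓘(ℝ, ℂ) ∞ (fun x => ((γ x).2.1 : ℂ)) U ∧
    ContMDiffOn (𝓡 4) 𝓘(ℝ, ℝ) ∞ (fun x => ((γ x).2.2 : ℝ)) U

end Bundles

end

end ConformalGHP

open ConformalGHP

set_option linter.unusedSectionVars false

/-! In a null tetrad `J` is diagonal: the covectors l and m have eigenvalue i, while n and \bar m
have eigenvalue -i. The metric pairs only covectors of opposite eigenvalue, so `J` squares to -1 and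
is orthogonal. Its formula involves only the products l n and m \bar m divided by l·n, so rescalings
of the tetrad and of the metric drop out (`acs_scale`, `acs_smul_form`).

A torsion-free complex connection with D h = -2 f ⊗ h is determined by f through the Koszul formula
`IsWeylAt.leviCivitaC_eq`, so the only question is which f makes `J` divergence-free.
Differentiating the eigenvector equations of `J`, `IsWeylAt.ctrace_deriv_acs` writes D_b J_a^b as 2i
times a combination of n, l, \bar m, m with coefficients, up to sign, ρ - f(l), ρ' - f(n), τ - f(m),
τ' - f(\bar m). Compatibility therefore means f = `fForm` for the metric in which the tetrad is
normalized (`IsCompatibleWeyl.isWeylAt`). Uniqueness follows from the Koszul formula, and existence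
by adding the difference tensor of this f to the Levi-Civita connection (`weylDeriv`).

Since l·n and m·\bar m are constant, ω^0_0 + ω^1_1 = ω^2_2 + ω^3_3 = 2f. Hence the diagonal of the
connection form has three independent entries, and (K, L, f) parametrizes them. Comparing with the
Koszul values of ε, β and their primes gives `psi_add` and `psi_sub`. As f is complex, `D` need not
commute with conjugation, so the conjugate spin coefficients are computed by conjugating the real
Levi-Civita connection first.

Under a change of frame the Leibniz rule adds the logarithmic differentials of the leg factors to
the diagonal entries. With w₀ + w₁ = -1 the entries K, L, f then see only a, z, Ω respectively
(`DiffGaugeAt.psi_act`). Thus ∂η + π(ψ)η has the same meaning in all smooth frames, and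
`FrameBundle.IsConnectionForm.existsUnique` glues it. Two regularity facts enter: gauge functions
between smooth frames are differentiable because they are quotients of products of frame vectors,
and π(ψ) is smooth because it is an expression in spin coefficients. -/

namespace ConformalGHP

/-! ### Complex linear algebra of null tetrads and of `J`. -/

section Algebra

variable {M : Type*} [TopologicalSpace M] [ChartedSpace (EuclideanSpace ℝ (Fin 4)) M]
  [IsManifold (𝓡 4) ∞ M] {x : M}

theorem csmul_add (c : ℂ) (v w : CTM x) : csmul c (v + w) = csmul c v + csmul c w := by
  ext1 <;> simp [csmul] <;> module

theorem csmul_sub (c : ℂ) (v w : CTM x) : csmul c (v - w) = csmul c v - csmul c w := by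
  ext1 <;> simp [csmul] <;> module

theorem add_csmul (c d : ℂ) (v : CTM x) : csmul (c + d) v = csmul c v + csmul d v := by
  ext1 <;> simp [csmul] <;> module

theorem csmul_zero (c : ℂ) : csmul c (0 : CTM x) = 0 := by
  ext1 <;> simp [csmul]

theorem one_csmul (v : CTM x) : csmul 1 v = v := by
  ext1 <;> simp [csmul]

theorem csmul_ofReal (r : ℝ) (v : CTM x) : csmul (r : ℂ) v = r • v := by
  ext1 <;> simp [csmul]

theorem csmul_real_smul (r : ℝ) (c : ℂ) (v : CTM x) : csmul c (r • v) = r • csmul c v := by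
  ext1 <;> simp [csmul] <;> module

theorem mulI_eq (v : CTM x) : mulI x v = csmul Complex.I v := by
  ext1 <;> simp [csmul, mulI]

theorem ofReal_add (u v : TM x) : ofReal (u + v) = ofReal u + ofReal v := by
  ext1 <;> simp [ofReal]

theorem ofReal_sub (u v : TM x) : ofReal (u - v) = ofReal u - ofReal v := by
  ext1 <;> simp [ofReal]

theorem ofReal_smul (r : ℝ) (u : TM x) : ofReal (r • u) = csmul (r : ℂ) (ofReal u) := by
  ext1 <;> simp [ofReal, csmul]

theorem conj_conj (v : CTM x) : conj (conj v) = v := by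
  ext1 <;> simp [conj]

theorem conj_ofReal (u : TM x) : conj (ofReal u) = ofReal u := by
  ext1 <;> simp [conj, ofReal]

theorem conj_csmul (c : ℂ) (v : CTM x) : conj (csmul c v) = csmul ((starRingEnd ℂ) c) (conj v) := by
  ext1 <;> simp [conj, csmul]
  abel

theorem eq_ofReal_add (v : CTM x) : v = ofReal v.1 + csmul Complex.I (ofReal v.2) := by
  ext1 <;> simp [csmul, ofReal]

variable (h : TM x →L[ℝ] TM x →L[ℝ] ℝ)

theorem complexForm_add_left (u v w : CTM x) :
    complexForm h (u + v) w = complexForm h u w + complexForm h v w := by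
  apply Complex.ext <;> simp [complexForm] <;> ring

theorem complexForm_add_right (u v w : CTM x) :
    complexForm h u (v + w) = complexForm h u v + complexForm h u w := by
  apply Complex.ext <;> simp [complexForm] <;> ring

theorem complexForm_sub_left (u v w : CTM x) :
    complexForm h (u - v) w = complexForm h u w - complexForm h v w := by
  apply Complex.ext <;> simp [complexForm] <;> ring

theorem complexForm_sub_right (u v w : CTM x) :
    complexForm h u (v - w) = complexForm h u v - complexForm h u w := by
  apply Complex.ext <;> simp [complexForm] <;> ring

theorem complexForm_neg_left (v w : CTM x) : complexForm h (-v) w = -complexForm h v w := by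
  apply Complex.ext <;> simp [complexForm] <;> ring

theorem complexForm_neg_right (v w : CTM x) : complexForm h v (-w) = -complexForm h v w := by
  apply Complex.ext <;> simp [complexForm] <;> ring

theorem complexForm_csmul_left (c : ℂ) (v w : CTM x) :
    complexForm h (csmul c v) w = c * complexForm h v w := by
  apply Complex.ext <;> simp [complexForm, csmul] <;> ring

theorem complexForm_csmul_right (c : ℂ) (v w : CTM x) :
    complexForm h v (csmul c w) = c * complexForm h v w := by
  apply Complex.ext <;> simp [complexForm, csmul] <;> ring

theorem complexForm_ofReal (u v : TM x) : complexForm h (ofReal u) (ofReal v) = h u v := by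
  apply Complex.ext <;> simp [complexForm, ofReal]

theorem complexForm_conj (v w : CTM x) :
    complexForm h (conj v) (conj w) = (starRingEnd ℂ) (complexForm h v w) := by
  apply Complex.ext <;> simp [complexForm, conj]
  ring

theorem complexForm_smul_form (r : ℝ) (v w : CTM x) :
    complexForm (r • h) v w = r * complexForm h v w := by
  apply Complex.ext <;> simp [complexForm] <;> ring

theorem complexForm_comm (hs : ∀ u v, h u v = h v u) (v w : CTM x) :
    complexForm h v w = complexForm h w v := by
  apply Complex.ext <;> simp [complexForm, hs w.1, hs w.2]
  ring

/-- A null tetrad normalized with respect to the symmetric form `h`. -/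
structure IsNullTetrad (N : Tetrad x) : Prop where
  symm : ∀ u v, h u v = h v u
  ln : complexForm h (ofReal N.l) (ofReal N.n) = 1
  ll : complexForm h (ofReal N.l) (ofReal N.l) = 0
  nn : complexForm h (ofReal N.n) (ofReal N.n) = 0
  lm : complexForm h (ofReal N.l) N.m = 0
  nm : complexForm h (ofReal N.n) N.m = 0
  mm : complexForm h N.m N.m = 0
  mmb : complexForm h N.m (conj N.m) = -1

variable {h}

/-- Dividing by l·n makes all products constant, which is what later derivatives exploit. -/
theorem IsConformalNull.isNullTetrad (hs : ∀ u v, h u v = h v u) {N : Tetrad x}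
    (hN : IsConformalNull h N) : IsNullTetrad ((h N.l N.n)⁻¹ • h) N := by
  have h0 := hN.ln.ne'
  have h1 : ((h N.l N.n : ℝ) : ℂ) ≠ 0 := by exact_mod_cast h0
  refine ⟨fun u v => by simp [hs u v], ?_, ?_, ?_, ?_, ?_, ?_, ?_⟩ <;>
    rw [complexForm_smul_form] <;>
    simp [complexForm_ofReal, hN.ll, hN.nn, hN.lm, hN.nm, hN.m0, hN.mm, h1]

namespace IsNullTetrad

variable {N : Tetrad x} (hN : IsNullTetrad h N)
include hN

theorem comm (v w : CTM x) : complexForm h v w = complexForm h w v := complexForm_comm h hN.symm v w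

theorem nl : complexForm h (ofReal N.n) (ofReal N.l) = 1 := by rw [hN.comm, hN.ln]
theorem ml : complexForm h N.m (ofReal N.l) = 0 := by rw [hN.comm, hN.lm]
theorem mn : complexForm h N.m (ofReal N.n) = 0 := by rw [hN.comm, hN.nm]
theorem mbm : complexForm h (conj N.m) N.m = -1 := by rw [hN.comm, hN.mmb]
theorem mbmb : complexForm h (conj N.m) (conj N.m) = 0 := by simp [complexForm_conj, hN.mm]
theorem lmb : complexForm h (ofReal N.l) (conj N.m) = 0 := by
  rw [← conj_ofReal N.l, complexForm_conj, hN.lm, map_zero]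
theorem nmb : complexForm h (ofReal N.n) (conj N.m) = 0 := by
  rw [← conj_ofReal N.n, complexForm_conj, hN.nm, map_zero]
theorem mbl : complexForm h (conj N.m) (ofReal N.l) = 0 := by rw [hN.comm, hN.lmb]
theorem mbn : complexForm h (conj N.m) (ofReal N.n) = 0 := by rw [hN.comm, hN.nmb]

/-- From m·m = 0 and m·\bar m = -1, the vectors Re m and Im m are orthogonal of square -1/2. This is
the origin of the factors 2 below. -/
theorem real_products : h N.l N.l = 0 ∧ h N.n N.n = 0 ∧ h N.l N.n = 1 ∧ h N.l N.m.1 = 0 ∧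
    h N.l N.m.2 = 0 ∧ h N.n N.m.1 = 0 ∧ h N.n N.m.2 = 0 ∧ h N.m.1 N.m.1 = -(1 / 2) ∧
    h N.m.2 N.m.2 = -(1 / 2) ∧ h N.m.1 N.m.2 = 0 := by
  have a := hN.ll; have b := hN.nn; have c := hN.ln
  rw [complexForm_ofReal] at a b c
  have d1 := congrArg Complex.re hN.lm; have d2 := congrArg Complex.im hN.lm
  have e1 := congrArg Complex.re hN.nm; have e2 := congrArg Complex.im hN.nm
  have f1 := congrArg Complex.re hN.mm; have f2 := congrArg Complex.im hN.mm
  have g1 := congrArg Complex.re hN.mmb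
  have s := hN.symm N.m.1 N.m.2
  simp [complexForm, ofReal, conj] at d1 d2 e1 e2 f1 f2 g1
  refine ⟨by exact_mod_cast a, by exact_mod_cast b, by exact_mod_cast c, d1, d2, e1, e2, ?_, ?_, ?_⟩
    <;> linarith

/-- The real basis `l, n, Re m, Im m` of the tangent space. -/
theorem exists_basis : ∃ b : Module.Basis (Fin 4) ℝ (TM x),
    (b : Fin 4 → TM x) = ![N.l, N.n, N.m.1, N.m.2] := by
  obtain ⟨ll, nn, ln, l1, l2, n1, n2, m11, m22, m12⟩ := hN.real_products
  have nl : h N.n N.l = 1 := by rw [hN.symm, ln]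
  have m21 : h N.m.2 N.m.1 = 0 := by rw [hN.symm, m12]
  have k1 : h N.m.1 N.l = 0 := by rw [hN.symm, l1]
  have k2 : h N.m.2 N.l = 0 := by rw [hN.symm, l2]
  have k3 : h N.m.1 N.n = 0 := by rw [hN.symm, n1]
  have k4 : h N.m.2 N.n = 0 := by rw [hN.symm, n2]
  have li : LinearIndependent ℝ ![N.l, N.n, N.m.1, N.m.2] := by
    rw [Fintype.linearIndependent_iff]
    intro c hc
    simp only [Fin.sum_univ_four, Matrix.cons_val] at hc
    have t1 := congrArg (h N.l) hc
    have t2 := congrArg (h N.n) hc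
    have t3 := congrArg (h N.m.1) hc
    have t4 := congrArg (h N.m.2) hc
    simp [ll, nn, ln, l1, l2, n1, n2, m11, m22, m12, nl, m21, k1, k2, k3, k4] at t1 t2 t3 t4
    intro i
    fin_cases i <;> simp [t1, t2, t3, t4]
  have hf : Fintype.card (Fin 4) = Module.finrank ℝ (TM x) := by
    change _ = Module.finrank ℝ (EuclideanSpace ℝ (Fin 4))
    simp
  exact ⟨basisOfLinearIndependentOfCardEqFinrank li hf, by simp⟩

/-- The basis l, n, Re m, Im m has dual basis n, l, -2 Re m, -2 Im m with respect to `h`. Both sides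
are linear in `v`, so the basis vectors suffice. -/
theorem expand (v : TM x) : v = h N.n v • N.l + h N.l v • N.n - (2 * h N.m.1 v) • N.m.1
    - (2 * h N.m.2 v) • N.m.2 := by
  obtain ⟨ll, nn, ln, l1, l2, n1, n2, m11, m22, m12⟩ := hN.real_products
  obtain ⟨b, hb⟩ := hN.exists_basis
  have nl : h N.n N.l = 1 := by rw [hN.symm, ln]
  have m21 : h N.m.2 N.m.1 = 0 := by rw [hN.symm, m12]
  have k1 : h N.m.1 N.l = 0 := by rw [hN.symm, l1]
  have k2 : h N.m.2 N.l = 0 := by rw [hN.symm, l2]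
  have k3 : h N.m.1 N.n = 0 := by rw [hN.symm, n1]
  have k4 : h N.m.2 N.n = 0 := by rw [hN.symm, n2]
  let F : TM x →ₗ[ℝ] TM x := (h N.n : TM x →ₗ[ℝ] ℝ).smulRight N.l
    + (h N.l : TM x →ₗ[ℝ] ℝ).smulRight N.n - (2 : ℝ) • (h N.m.1 : TM x →ₗ[ℝ] ℝ).smulRight N.m.1
    - (2 : ℝ) • (h N.m.2 : TM x →ₗ[ℝ] ℝ).smulRight N.m.2
  have : LinearMap.id = F := by
    refine b.ext fun i => ?_
    rw [hb]
    fin_cases i <;>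
      simp [F, ll, nn, ln, l1, l2, n1, n2, m11, m22, m12, nl, m21, k1, k2, k3, k4, smul_smul]
  have e := LinearMap.congr_fun this v
  simpa [F, smul_smul] using e

theorem ext_real {v w : TM x} (hl : h N.l v = h N.l w) (hn : h N.n v = h N.n w)
    (h1 : h N.m.1 v = h N.m.1 w) (h2 : h N.m.2 v = h N.m.2 w) : v = w := by
  rw [hN.expand v, hN.expand w, hl, hn, h1, h2]

theorem trace_eq (T : TM x →ₗ[ℝ] TM x) : LinearMap.trace ℝ (TM x) T = h N.n (T N.l)
    + h N.l (T N.n) - 2 * h N.m.1 (T N.m.1) - 2 * h N.m.2 (T N.m.2) := by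
  obtain ⟨b, hb⟩ := hN.exists_basis
  have hr : ∀ v, (b.repr v : Fin 4 → ℝ) = ![h N.n v, h N.l v, -(2 * h N.m.1 v), -(2 * h N.m.2 v)] := by
    intro v
    have : v = ∑ i, (![h N.n v, h N.l v, -(2 * h N.m.1 v), -(2 * h N.m.2 v)] : Fin 4 → ℝ) i • b i := by
      conv_lhs => rw [hN.expand v]
      simp [Fin.sum_univ_four, hb, sub_eq_add_neg]
    conv_lhs => rw [this]
    rw [b.repr_sum_self]
  rw [LinearMap.trace_eq_matrix_trace ℝ b, Matrix.trace]
  simp [Fin.sum_univ_four, LinearMap.toMatrix_apply, hr, hb]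
  ring

/-- The trace in the dual bases of `expand`, with the contributions of Re m and Im m recombined into
m and \bar m. -/
theorem ctrace_eq (F : TM x →ₗ[ℝ] CTM x) : ctrace F = complexForm h (ofReal N.n) (F N.l)
    + complexForm h (ofReal N.l) (F N.n) - complexForm h (conj N.m) (complexify F N.m)
    - complexForm h N.m (complexify F (conj N.m)) := by
  apply Complex.ext <;>
    simp [ctrace, hN.trace_eq, complexForm, ofReal, conj, complexify, mulI] <;> ring

/-- Complex vectors are determined by their products with a null tetrad. -/
theorem ext {v w : CTM x} (hl : complexForm h (ofReal N.l) v = complexForm h (ofReal N.l) w)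
    (hn : complexForm h (ofReal N.n) v = complexForm h (ofReal N.n) w)
    (hm : complexForm h N.m v = complexForm h N.m w)
    (hmb : complexForm h (conj N.m) v = complexForm h (conj N.m) w) : v = w := by
  have l1 := congrArg Complex.re hl; have l2 := congrArg Complex.im hl
  have n1 := congrArg Complex.re hn; have n2 := congrArg Complex.im hn
  have m1 := congrArg Complex.re hm; have m2 := congrArg Complex.im hm
  have p1 := congrArg Complex.re hmb; have p2 := congrArg Complex.im hmb
  simp [complexForm, ofReal, conj] at l1 l2 n1 n2 m1 m2 p1 p2
  ext1
  · exact hN.ext_real l1 n1 (by linarith) (by linarith)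
  · exact hN.ext_real l2 n2 (by linarith) (by linarith)

/-- The completeness relation g = l n + n l - m \bar m - \bar m m. It splits products into
eigencomponents of `J`. -/
theorem complexForm_expand (v w : CTM x) : complexForm h v w =
    complexForm h (ofReal N.l) v * complexForm h (ofReal N.n) w
    + complexForm h (ofReal N.n) v * complexForm h (ofReal N.l) w
    - complexForm h N.m v * complexForm h (conj N.m) w
    - complexForm h (conj N.m) v * complexForm h N.m w := by
  have : v = csmul (complexForm h (ofReal N.l) v) (ofReal N.n)
      + csmul (complexForm h (ofReal N.n) v) (ofReal N.l)
      - csmul (complexForm h N.m v) (conj N.m) - csmul (complexForm h (conj N.m) v) N.m := by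
    apply hN.ext <;> simp [complexForm_add_right, complexForm_sub_right, complexForm_csmul_right,
      hN.ln, hN.ll, hN.nn, hN.lm, hN.nm, hN.mm, hN.mmb, hN.nl, hN.ml, hN.mn, hN.mbm, hN.mbmb,
      hN.lmb, hN.nmb, hN.mbl, hN.mbn]
  conv_lhs => rw [this]
  simp [complexForm_add_left, complexForm_sub_left, complexForm_csmul_left]

end IsNullTetrad

/-- Conformal invariance: the prefactor (l·n)⁻¹ compensates the scaling of the lowered index. -/
theorem acs_smul_form (h : TM x →L[ℝ] TM x →L[ℝ] ℝ) {r : ℝ} (hr : r ≠ 0) (N : Tetrad x) :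
    acs (r • h) N = acs h N := by
  have hr' : (r : ℂ) ≠ 0 := by exact_mod_cast hr
  ext1 X
  simp only [acs, LinearMap.coe_mk, AddHom.coe_mk, complexForm_smul_form]
  have e : ∀ a : ℂ, Complex.I * ((r : ℂ)⁻¹ * ((h N.l N.n : ℝ) : ℂ)⁻¹) * (r * a)
      = Complex.I * ((h N.l N.n : ℝ) : ℂ)⁻¹ * a := fun a => by field_simp
  simp only [csmul_add, csmul_sub, csmul_csmul, smul_apply, smul_eq_mul, mul_inv, Complex.ofReal_mul,
    Complex.ofReal_inv, e]

/-- The almost-complex structure does not see rescalings of the tetrad. -/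
theorem acs_scale (h : TM x →L[ℝ] TM x →L[ℝ] ℝ) {r s : ℝ} {c : ℂ} (N : Tetrad x)
    (hrs : r * s ≠ 0) (hc : c * (starRingEnd ℂ) c = r * s) :
    acs h ⟨r • N.l, s • N.n, csmul c N.m⟩ = acs h N := by
  have hr : (r : ℂ) ≠ 0 := by exact_mod_cast left_ne_zero_of_mul hrs
  have hs : (s : ℂ) ≠ 0 := by exact_mod_cast right_ne_zero_of_mul hrs
  ext1 X
  simp only [acs, LinearMap.coe_mk, AddHom.coe_mk, conj_csmul, complexForm_csmul_left, ofReal_smul,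
    csmul_add, csmul_sub, csmul_csmul, map_smul, smul_apply, smul_eq_mul, mul_inv,
    Complex.ofReal_mul, Complex.ofReal_inv]
  generalize ((h N.l N.n : ℝ) : ℂ)⁻¹ = a
  have e₁ : ∀ k : ℂ, Complex.I * ((r : ℂ)⁻¹ * (s : ℂ)⁻¹ * a) * (r * k * s) = Complex.I * a * k :=
    fun k => by field_simp
  have e₂ : ∀ k : ℂ, Complex.I * ((r : ℂ)⁻¹ * (s : ℂ)⁻¹ * a) * (s * k * r) = Complex.I * a * k :=
    fun k => by field_simp
  have e₃ : ∀ k : ℂ, Complex.I * ((r : ℂ)⁻¹ * (s : ℂ)⁻¹ * a) * ((starRingEnd ℂ) c * k * c)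
      = Complex.I * a * k := fun k => by
    field_simp
    linear_combination k * a * hc
  have e₄ : ∀ k : ℂ, Complex.I * ((r : ℂ)⁻¹ * (s : ℂ)⁻¹ * a) * (c * k * (starRingEnd ℂ) c)
      = Complex.I * a * k := fun k => by
    field_simp
    linear_combination k * a * hc
  simp only [← mul_assoc (s : ℂ)⁻¹ (r : ℂ)⁻¹, mul_comm (s : ℂ)⁻¹ (r : ℂ)⁻¹]
  rw [e₁, e₂, e₃, e₄]

theorem complexify_acs (N : Tetrad x) (hN : complexForm h (ofReal N.l) (ofReal N.n) = 1)
    (v : CTM x) : complexify (acs h N) v = csmul Complex.I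
      (csmul (complexForm h (ofReal N.l) v) (ofReal N.n)
        - csmul (complexForm h (ofReal N.n) v) (ofReal N.l)
        + csmul (complexForm h (conj N.m) v) N.m - csmul (complexForm h N.m v) (conj N.m)) := by
  have e : h N.l N.n = 1 := by
    rw [complexForm_ofReal] at hN
    exact_mod_cast hN
  ext1 <;> simp [complexify, acs, csmul, complexForm, ofReal, conj, mulI, e] <;> module

theorem complexify_ofReal (J : TM x →ₗ[ℝ] CTM x) (X : TM x) : complexify J (ofReal X) = J X := by
  simp [complexify, ofReal]

namespace IsNullTetrad

variable {N : Tetrad x} (hN : IsNullTetrad h N)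
include hN

/-- This lemma and the next three diagonalize `J` on covectors: i on l and m, -i on n and \bar m. -/
theorem l_acs (v : CTM x) : complexForm h (ofReal N.l) (complexify (acs h N) v)
    = Complex.I * complexForm h (ofReal N.l) v := by
  simp [complexify_acs N hN.ln, complexForm_add_right, complexForm_sub_right,
    complexForm_csmul_right, hN.ln, hN.ll, hN.lm, hN.lmb]

theorem n_acs (v : CTM x) : complexForm h (ofReal N.n) (complexify (acs h N) v)
    = -Complex.I * complexForm h (ofReal N.n) v := by
  simp [complexify_acs N hN.ln, complexForm_add_right, complexForm_sub_right,
    complexForm_csmul_right, hN.nl, hN.nn, hN.nm, hN.nmb]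

theorem m_acs (v : CTM x) : complexForm h N.m (complexify (acs h N) v)
    = Complex.I * complexForm h N.m v := by
  simp [complexify_acs N hN.ln, complexForm_add_right, complexForm_sub_right,
    complexForm_csmul_right, hN.ml, hN.mn, hN.mm, hN.mmb]

theorem mb_acs (v : CTM x) : complexForm h (conj N.m) (complexify (acs h N) v)
    = -Complex.I * complexForm h (conj N.m) v := by
  simp [complexify_acs N hN.ln, complexForm_add_right, complexForm_sub_right,
    complexForm_csmul_right, hN.mbl, hN.mbn, hN.mbm, hN.mbmb]

theorem acs_acs (X : TM x) : complexify (acs h N) (acs h N X) = -ofReal X := by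
  have I2 := Complex.I_mul_I
  rw [← complexify_ofReal (acs h N) X]
  apply hN.ext <;> simp only [hN.l_acs, hN.n_acs, hN.m_acs, hN.mb_acs, complexForm_neg_right] <;>
    linear_combination (complexForm h _ (ofReal X)) * I2

/-- Each term of the completeness relation pairs eigenvalue i with eigenvalue -i, and i · (-i) = 1.
-/
theorem acs_isometry (X Y : TM x) : complexForm h (acs h N X) (acs h N Y) = h X Y := by
  have I2 := Complex.I_mul_I
  rw [← complexForm_ofReal, ← complexify_ofReal (acs h N) X, ← complexify_ofReal (acs h N) Y,
    hN.complexForm_expand, hN.complexForm_expand (ofReal X)]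
  simp only [hN.l_acs, hN.n_acs, hN.m_acs, hN.mb_acs]
  linear_combination (-(complexForm h (ofReal N.n) (ofReal X) * complexForm h (ofReal N.l) (ofReal Y))
    - complexForm h (ofReal N.l) (ofReal X) * complexForm h (ofReal N.n) (ofReal Y)
    + complexForm h N.m (ofReal X) * complexForm h (conj N.m) (ofReal Y)
    + complexForm h (conj N.m) (ofReal X) * complexForm h N.m (ofReal Y)) * I2

end IsNullTetrad

end Algebra

/-! ### Real calculus: differentials, and the Koszul expression as a connection. -/

section Calculus

variable {M : Type*} [TopologicalSpace M] [ChartedSpace (EuclideanSpace ℝ (Fin 4)) M]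
  [IsManifold (𝓡 4) ∞ M] {x : M}

/-- Differentiability of a real function at a point. -/
abbrev DiffRAt (φ : M → ℝ) (x : M) : Prop := MDifferentiableAt (𝓡 4) 𝓘(ℝ, ℝ) φ x

/-- Differentiability of a complex function at a point. -/
abbrev DiffCAt (φ : M → ℂ) (x : M) : Prop := MDifferentiableAt (𝓡 4) 𝓘(ℝ, ℂ) φ x

theorem DiffVFAt.add {X Y : ∀ y : M, TM y} (hX : DiffVFAt X x) (hY : DiffVFAt Y x) :
    DiffVFAt (fun y => X y + Y y) x := mdifferentiableAt_add_section hX hY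

theorem DiffVFAt.neg {X : ∀ y : M, TM y} (hX : DiffVFAt X x) : DiffVFAt (fun y => -X y) x :=
  mdifferentiableAt_neg_section hX

theorem DiffVFAt.sub {X Y : ∀ y : M, TM y} (hX : DiffVFAt X x) (hY : DiffVFAt Y x) :
    DiffVFAt (fun y => X y - Y y) x := mdifferentiableAt_sub_section hX hY

theorem DiffVFAt.smul {φ : M → ℝ} {X : ∀ y : M, TM y} (hφ : DiffRAt φ x) (hX : DiffVFAt X x) :
    DiffVFAt (fun y => φ y • X y) x := hφ.smul_section hX

theorem diffVFAt_zero : DiffVFAt (fun y : M => (0 : TM y)) x :=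
  Bundle.mdifferentiableAt_zeroSection ℝ (fun y : M => TM y)

theorem dR_add {φ ψ : M → ℝ} (hφ : DiffRAt φ x) (hψ : DiffRAt ψ x) :
    dR (fun y => φ y + ψ y) x = dR φ x + dR ψ x := mvfderiv_fun_add hφ hψ

theorem dR_sub {φ ψ : M → ℝ} (hφ : DiffRAt φ x) (hψ : DiffRAt ψ x) :
    dR (fun y => φ y - ψ y) x = dR φ x - dR ψ x := mvfderiv_fun_sub hφ hψ

theorem dR_mul {φ ψ : M → ℝ} (hφ : DiffRAt φ x) (hψ : DiffRAt ψ x) :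
    dR (fun y => φ y * ψ y) x = φ x • dR ψ x + ψ x • dR φ x := mvfderiv_fun_mul hφ hψ

theorem dR_const (c : ℝ) : dR (fun _ : M => c) x = 0 := mvfderiv_const c

theorem dC_add {φ ψ : M → ℂ} (hφ : DiffCAt φ x) (hψ : DiffCAt ψ x) :
    dC (fun y => φ y + ψ y) x = dC φ x + dC ψ x := mvfderiv_fun_add hφ hψ

theorem dC_const (c : ℂ) : dC (fun _ : M => c) x = 0 := mvfderiv_const c

theorem mvfderiv_clm_comp {F F' : Type*} [NormedAddCommGroup F] [NormedSpace ℝ F]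
    [NormedAddCommGroup F'] [NormedSpace ℝ F'] {φ : M → F}
    (hφ : MDifferentiableAt (𝓡 4) 𝓘(ℝ, F) φ x) (T : F →L[ℝ] F') (X : TM x) :
    mvfderiv (𝓡 4) (fun y => T (φ y)) x X = T (mvfderiv (𝓡 4) φ x X) := by
  have h := (T.hasMFDerivAt (x := φ x)).comp x hφ.hasMFDerivAt
  have h' := h.mfderiv
  unfold mvfderiv
  change NormedSpace.fromTangentSpace _ (mfderiv (𝓡 4) 𝓘(ℝ, F') (T ∘ φ) x X) = _
  rw [h']
  rfl

/-- The differential of a complex function by its real and imaginary parts. -/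
theorem dC_apply {φ : M → ℂ} (hφ : DiffCAt φ x) (X : TM x) :
    dC φ x X = ⟨dR (fun y => (φ y).re) x X, dR (fun y => (φ y).im) x X⟩ :=
  Complex.ext (mvfderiv_clm_comp hφ Complex.reCLM X).symm
    (mvfderiv_clm_comp hφ Complex.imCLM X).symm

theorem dC_ofReal {φ : M → ℝ} (hφ : DiffRAt φ x) (X : TM x) :
    dC (fun y => (φ y : ℂ)) x X = (dR φ x X : ℂ) :=
  mvfderiv_clm_comp hφ Complex.ofRealCLM X

/-- The form field `h` takes differentiable vector fields to differentiable functions. -/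
structure FormDiffAt (h : FormField M) (x : M) : Prop where
  symm : ∀ y u v, h y u v = h y v u
  diff : ∀ Y Z : ∀ y : M, TM y, DiffVFAt Y x → DiffVFAt Z x → DiffRAt (fun y => h y (Y y) (Z y)) x

theorem LorentzMetric.formDiffAt (g : LorentzMetric M) (x : M) : FormDiffAt g.form x where
  symm := g.symm
  diff Y Z hY hZ := by
    have h := g.smooth.mdifferentiable (by simp) x
    have := MDifferentiableAt.clm_bundle_apply₂ (F₁ := EuclideanSpace ℝ (Fin 4))
      (F₂ := EuclideanSpace ℝ (Fin 4)) (F₃ := ℝ) (E₁ := fun y : M => TM y)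
      (E₂ := fun y : M => TM y) (E₃ := Bundle.Trivial M ℝ) (b := fun y => y) h hY hZ
    rw [mdifferentiableAt_section] at this
    exact this

theorem LorentzMetric.contMDiffOn (g : LorentzMetric M) {U : Set M} {Y Z : ∀ y : M, TM y}
    (hY : SmoothVF Y U) (hZ : SmoothVF Z U) :
    ContMDiffOn (𝓡 4) 𝓘(ℝ, ℝ) ∞ (fun y => g.form y (Y y) (Z y)) U := by
  intro x hx
  have := ContMDiffWithinAt.clm_bundle_apply₂ (F₁ := EuclideanSpace ℝ (Fin 4))
      (F₂ := EuclideanSpace ℝ (Fin 4)) (F₃ := ℝ) (E₁ := fun y : M => TM y)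
      (E₂ := fun y : M => TM y) (E₃ := Bundle.Trivial M ℝ) (b := fun y => y)
      (g.smooth.contMDiffOn x hx) (hY x hx) (hZ x hx)
  rw [Bundle.contMDiffWithinAt_section] at this
  exact this

theorem FormDiffAt.smul {h : FormField M} (hh : FormDiffAt h x) {φ : M → ℝ} (hφ : DiffRAt φ x) :
    FormDiffAt (fun y => φ y • h y) x where
  symm y u v := by simp [hh.symm y u v]
  diff Y Z hY hZ := hφ.mul (hh.diff Y Z hY hZ)

local notation "⟦" X ", " Y "⟧" => VectorField.mlieBracket (𝓡 4) X Y

variable {h : FormField M} (hh : FormDiffAt h x)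
include hh

/-- The derivatives of φ from the metric terms cancel against those from the brackets. Tensoriality
in this slot and in the third makes the Koszul expression a bilinear form at the point. -/
theorem leviCivita_tensorial_fst {Y Z : ∀ y : M, TM y} (hY : DiffVFAt Y x) (hZ : DiffVFAt Z x) :
    TensorialAt (𝓡 4) (EuclideanSpace ℝ (Fin 4)) (fun X => leviCivita h X Y Z x) x where
  smul {φ X} hφ hX := by
    have e1 := dR_mul hφ (hh.diff Z X hZ hX)
    have e2 := dR_mul hφ (hh.diff X Y hX hY)
    have b1 : ⟦φ • X, Y⟧ x = -dR φ x (Y x) • X x + φ x • ⟦X, Y⟧ x :=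
      VectorField.mlieBracket_smul_left hφ hX
    have b2 : ⟦φ • X, Z⟧ x = -dR φ x (Z x) • X x + φ x • ⟦X, Z⟧ x :=
      VectorField.mlieBracket_smul_left hφ hX
    simp only [leviCivita, b1, b2, Pi.smul_apply', map_smul, map_add, add_apply,
      smul_apply, smul_eq_mul, e1, e2, neg_smul, map_neg, neg_apply, hh.symm x (Z x)]
    ring
  add {X X'} hX hX' := by
    have e1 := dR_add (hh.diff Z X hZ hX) (hh.diff Z X' hZ hX')
    have e2 := dR_add (hh.diff X Y hX hY) (hh.diff X' Y hX' hY)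
    have b1 := VectorField.mlieBracket_add_left (W := Y) hX hX'
    have b2 := VectorField.mlieBracket_add_left (W := Z) hX hX'
    simp only [leviCivita, b1, b2, Pi.add_apply, map_add, add_apply, e1, e2]
    ring

theorem leviCivita_tensorial_thd {X Y : ∀ y : M, TM y} (hX : DiffVFAt X x) (hY : DiffVFAt Y x) :
    TensorialAt (𝓡 4) (EuclideanSpace ℝ (Fin 4)) (fun Z => leviCivita h X Y Z x) x where
  smul {φ Z} hφ hZ := by
    have e1 := dR_mul hφ (hh.diff Y Z hY hZ)
    have e2 := dR_mul hφ (hh.diff Z X hZ hX)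
    have b1 : ⟦Y, φ • Z⟧ x = dR φ x (Y x) • Z x + φ x • ⟦Y, Z⟧ x :=
      VectorField.mlieBracket_smul_right hφ hZ
    have b2 : ⟦X, φ • Z⟧ x = dR φ x (X x) • Z x + φ x • ⟦X, Z⟧ x :=
      VectorField.mlieBracket_smul_right hφ hZ
    simp only [leviCivita, b1, b2, Pi.smul_apply', map_smul, map_add, add_apply,
      smul_apply, smul_eq_mul, e1, e2, hh.symm x (Z x)]
    ring
  add {Z Z'} hZ hZ' := by
    have e1 := dR_add (hh.diff Y Z hY hZ) (hh.diff Y Z' hY hZ')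
    have e2 := dR_add (hh.diff Z X hZ hX) (hh.diff Z' X hZ' hX)
    have b1 := VectorField.mlieBracket_add_right (V := Y) hZ hZ'
    have b2 := VectorField.mlieBracket_add_right (V := X) hZ hZ'
    simp only [leviCivita, b1, b2, Pi.add_apply, map_add, add_apply, e1, e2]
    ring

theorem leviCivita_add_snd {X Y Y' Z : ∀ y : M, TM y} (hX : DiffVFAt X x) (hY : DiffVFAt Y x)
    (hY' : DiffVFAt Y' x) (hZ : DiffVFAt Z x) :
    leviCivita h X (Y + Y') Z x = leviCivita h X Y Z x + leviCivita h X Y' Z x := by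
  have e1 := dR_add (hh.diff Y Z hY hZ) (hh.diff Y' Z hY' hZ)
  have e2 := dR_add (hh.diff X Y hX hY) (hh.diff X Y' hX hY')
  have b1 := VectorField.mlieBracket_add_left (W := Z) hY hY'
  have b2 := VectorField.mlieBracket_add_right (V := X) hY hY'
  simp only [leviCivita, b1, b2, Pi.add_apply, map_add, add_apply, e1, e2]
  ring

/-- The derivative of φ along X enters twice with factor 1/2, once from the metric term and once
from the bracket. Those along Z cancel. -/
theorem leviCivita_smul_snd {φ : M → ℝ} {X Y Z : ∀ y : M, TM y} (hφ : DiffRAt φ x)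
    (hX : DiffVFAt X x) (hY : DiffVFAt Y x) (hZ : DiffVFAt Z x) :
    leviCivita h X (φ • Y) Z x = φ x * leviCivita h X Y Z x + dR φ x (X x) * h x (Y x) (Z x) := by
  have e1 := dR_mul hφ (hh.diff Y Z hY hZ)
  have e2 := dR_mul hφ (hh.diff X Y hX hY)
  have b1 : ⟦φ • Y, Z⟧ x = -dR φ x (Z x) • Y x + φ x • ⟦Y, Z⟧ x :=
    VectorField.mlieBracket_smul_left hφ hY
  have b2 : ⟦X, φ • Y⟧ x = dR φ x (X x) • Y x + φ x • ⟦X, Y⟧ x :=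
    VectorField.mlieBracket_smul_right hφ hY
  simp only [leviCivita, b1, b2, Pi.smul_apply', map_smul, map_add, add_apply,
      smul_apply, smul_eq_mul, e1, e2, neg_smul, map_neg, neg_apply, hh.symm x (Y x)]
  ring

theorem leviCivita_metric (X Y Z : ∀ y : M, TM y) :
    leviCivita h X Y Z x + leviCivita h X Z Y x = dR (fun y => h y (Y y) (Z y)) x (X x) := by
  have s : ∀ A B : ∀ y : M, TM y, (fun y => h y (A y) (B y)) = fun y => h y (B y) (A y) :=
    fun A B => funext fun y => hh.symm y _ _
  have b : ⟦Z, Y⟧ x = -⟦Y, Z⟧ x := VectorField.mlieBracket_swap_apply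
  simp only [leviCivita, s Z Y, s Z X, s Y X, b, map_neg, neg_apply]
  ring

theorem leviCivita_torsion (X Y Z : ∀ y : M, TM y) :
    leviCivita h X Y Z x - leviCivita h Y X Z x = h x (⟦X, Y⟧ x) (Z x) := by
  have s : ∀ A B : ∀ y : M, TM y, (fun y => h y (A y) (B y)) = fun y => h y (B y) (A y) :=
    fun A B => funext fun y => hh.symm y _ _
  have b : ⟦Y, X⟧ x = -⟦X, Y⟧ x := VectorField.mlieBracket_swap_apply
  simp only [leviCivita, s Y X, s Z Y, s Z X, b, map_neg, neg_apply]
  ring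

end Calculus

/-! ### Complex vector fields and pointwise Weyl connections. -/

section ComplexCalculus

variable {M : Type*} [TopologicalSpace M] [ChartedSpace (EuclideanSpace ℝ (Fin 4)) M]
  [IsManifold (𝓡 4) ∞ M] {x : M}

/-- Differentiability at `x` of a complex vector field. -/
def DiffCVFAt (V : ∀ y : M, CTM y) (x : M) : Prop :=
  DiffVFAt (fun y => (V y).1) x ∧ DiffVFAt (fun y => (V y).2) x

/-- Converts between differentiability of both real components and the total-space notion in the
axioms of `CovariantDerivative`. -/
theorem diffCVFAt_iff {V : ∀ y : M, CTM y} : DiffCVFAt V x ↔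
    MDifferentiableAt (𝓡 4) ((𝓡 4).prod 𝓘(ℝ, CModel))
      (fun y => (⟨y, V y⟩ : Bundle.TotalSpace CModel (fun y : M => CTM y))) x := by
  unfold DiffCVFAt DiffVFAt
  have e1 := mdifferentiableAt_section (IB := 𝓡 4) (F := EuclideanSpace ℝ (Fin 4))
    (E := fun y : M => TM y) (fun y => (V y).1) (b₀ := x)
  have e2 := mdifferentiableAt_section (IB := 𝓡 4) (F := EuclideanSpace ℝ (Fin 4))
    (E := fun y : M => TM y) (fun y => (V y).2) (b₀ := x)
  have e3 := mdifferentiableAt_section (IB := 𝓡 4) (F := CModel)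
    (E := fun y : M => CTM y) V (b₀ := x)
  refine (and_congr e1 e2).trans (Iff.trans ?_ e3.symm)
  constructor
  · rintro ⟨h1, h2⟩
    exact h1.prodMk_space h2
  · intro h
    have := h
    exact ⟨(ContinuousLinearMap.fst ℝ (EuclideanSpace ℝ (Fin 4)) (EuclideanSpace ℝ (Fin 4))
      |>.mdifferentiableAt).comp x h,
      (ContinuousLinearMap.snd ℝ (EuclideanSpace ℝ (Fin 4)) (EuclideanSpace ℝ (Fin 4))
      |>.mdifferentiableAt).comp x h⟩

theorem DiffVFAt.ofReal {X : ∀ y : M, TM y} (hX : DiffVFAt X x) :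
    DiffCVFAt (fun y => ofReal (X y)) x := ⟨hX, diffVFAt_zero⟩

theorem DiffCVFAt.conj {V : ∀ y : M, CTM y} (hV : DiffCVFAt V x) :
    DiffCVFAt (fun y => conj (V y)) x := ⟨hV.1, hV.2.neg⟩

theorem DiffCVFAt.add {V W : ∀ y : M, CTM y} (hV : DiffCVFAt V x) (hW : DiffCVFAt W x) :
    DiffCVFAt (fun y => V y + W y) x := ⟨hV.1.add hW.1, hV.2.add hW.2⟩

theorem DiffCVFAt.sub {V W : ∀ y : M, CTM y} (hV : DiffCVFAt V x) (hW : DiffCVFAt W x) :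
    DiffCVFAt (fun y => V y - W y) x := ⟨hV.1.sub hW.1, hV.2.sub hW.2⟩

theorem diffCAt_iff {φ : M → ℂ} :
    DiffCAt φ x ↔ DiffRAt (fun y => (φ y).re) x ∧ DiffRAt (fun y => (φ y).im) x := by
  constructor
  · intro h
    exact ⟨Complex.reCLM.mdifferentiableAt.comp x h, Complex.imCLM.mdifferentiableAt.comp x h⟩
  · rintro ⟨h1, h2⟩
    have := Complex.equivRealProdCLM.symm.toContinuousLinearMap.mdifferentiableAt.comp x
      (h1.prodMk_space h2)
    exact this

theorem DiffCVFAt.csmul {φ : M → ℂ} {V : ∀ y : M, CTM y} (hφ : DiffCAt φ x)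
    (hV : DiffCVFAt V x) : DiffCVFAt (fun y => csmul (φ y) (V y)) x := by
  obtain ⟨h1, h2⟩ := diffCAt_iff.1 hφ
  exact ⟨(hV.1.smul h1).sub (hV.2.smul h2), (hV.2.smul h1).add (hV.1.smul h2)⟩

theorem DiffCVFAt.const_csmul (c : ℂ) {V : ∀ y : M, CTM y}
    (hV : DiffCVFAt V x) : DiffCVFAt (fun y => ConformalGHP.csmul c (V y)) x :=
  DiffCVFAt.csmul mdifferentiableAt_const hV

theorem FormDiffAt.diffC {h : FormField M} (hh : FormDiffAt h x) {V W : ∀ y : M, CTM y}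
    (hV : DiffCVFAt V x) (hW : DiffCVFAt W x) : DiffCAt (fun y => complexForm (h y) (V y) (W y)) x :=
  diffCAt_iff.2 ⟨(hh.diff _ _ hV.1 hW.1).sub (hh.diff _ _ hV.2 hW.2),
    (hh.diff _ _ hV.1 hW.2).add (hh.diff _ _ hV.2 hW.1)⟩

variable (D : CConnection M)

/-- The derivative of a complex vector field along a complex vector. -/
noncomputable def cderiv (V : ∀ y : M, CTM y) (x : M) (v : CTM x) : CTM x :=
  D V x v.1 + csmul Complex.I (D V x v.2)

theorem cderiv_ofReal (V : ∀ y : M, CTM y) (X : TM x) : cderiv D V x (ofReal X) = D V x X := by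
  simp [cderiv, ofReal, csmul_zero]

theorem cderiv_csmul (V : ∀ y : M, CTM y) (c : ℂ) (v : CTM x) :
    cderiv D V x (csmul c v) = csmul c (cderiv D V x v) := by
  simp only [cderiv]
  ext1 <;> simp [csmul] <;> module

theorem cderiv_add (V : ∀ y : M, CTM y) (v w : CTM x) :
    cderiv D V x (v + w) = cderiv D V x v + cderiv D V x w := by
  simp only [cderiv]
  ext1 <;> simp [csmul] <;> module

/-- `D` is, at `x`, complex linear and torsion-free and satisfies `D h = -2 f ⊗ h`. -/
structure IsWeylAt (h : FormField M) (D : CConnection M) (x : M) (f : TM x → ℂ) : Prop where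
  complex_linear : ∀ (Y Z : ∀ y : M, TM y), DiffVFAt Y x → DiffVFAt Z x → ∀ X : TM x,
    D (fun y => (-Z y, Y y)) x X = mulI x (D (fun y => (Y y, Z y)) x X)
  torsion_free : ∀ (Y Z : ∀ y : M, TM y), DiffVFAt Y x → DiffVFAt Z x →
    D (fun y => ofReal (Z y)) x (Y x) - D (fun y => ofReal (Y y)) x (Z x)
      = ofReal (VectorField.mlieBracket (𝓡 4) Y Z x)
  weyl : ∀ Y Z : ∀ y : M, TM y, DiffVFAt Y x → DiffVFAt Z x → ∀ X : TM x,
    (dR (fun y => h y (Y y) (Z y)) x X : ℂ)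
      - complexForm (h x) (D (fun y => ofReal (Y y)) x X) (ofReal (Z x))
      - complexForm (h x) (ofReal (Y x)) (D (fun y => ofReal (Z y)) x X)
    = -2 * f X * h x (Y x) (Z x)

/-- Complex linear extension of a real linear form. -/
def cform {x : M} (f : TM x → ℂ) (v : CTM x) : ℂ := f v.1 + Complex.I * f v.2

namespace IsWeylAt

variable {D} {h : FormField M} {f : TM x → ℂ} (hD : IsWeylAt h D x f) (hh : FormDiffAt h x)

include hD in
-- An imaginary field is i times a real one, so additivity and complex linearity reduce `D` to real
-- fields.
theorem deriv_eq {V : ∀ y : M, CTM y} (hV : DiffCVFAt V x) (X : TM x) :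
    D V x X = D (fun y => ofReal (V y).1) x X
      + csmul Complex.I (D (fun y => ofReal (V y).2) x X) := by
  have h1 := hV.1.ofReal
  have h2 : DiffCVFAt (fun y => ((0 : TM y), (V y).2)) x := ⟨diffVFAt_zero, hV.2⟩
  have e := D.isCovariantDerivativeOnUniv.add (diffCVFAt_iff.1 h1) (diffCVFAt_iff.1 h2)
  have e' := hD.complex_linear _ _ hV.2 diffVFAt_zero X
  have e'' : V = (fun y => ofReal (V y).1) + fun y => ((0 : TM y), (V y).2) := by
    funext y
    ext1 <;> simp [ofReal]
  conv_lhs => rw [e'', e]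
  rw [add_apply]
  congr 1
  simpa [mulI_eq, ofReal] using e'

include hD in
theorem deriv_csmul_I {V : ∀ y : M, CTM y} (hV : DiffCVFAt V x) (X : TM x) :
    D (fun y => csmul Complex.I (V y)) x X = csmul Complex.I (D V x X) := by
  have := hD.complex_linear _ _ hV.1 hV.2 X
  rw [mulI_eq] at this
  rw [← this]
  congr 2
  funext y
  ext1 <;> simp [csmul]

include hD in
/-- Leibniz rule for complex functions. -/
theorem deriv_csmul {φ : M → ℂ} {V : ∀ y : M, CTM y} (hφ : DiffCAt φ x) (hV : DiffCVFAt V x)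
    (X : TM x) : D (fun y => csmul (φ y) (V y)) x X
      = csmul (φ x) (D V x X) + csmul (dC φ x X) (V x) := by
  obtain ⟨h1, h2⟩ := diffCAt_iff.1 hφ
  -- Write φ V = (Re φ) V + (Im φ) (i V) and apply the real Leibniz rule to both terms.
  have hI := DiffCVFAt.const_csmul Complex.I hV
  have l1 := D.isCovariantDerivativeOnUniv.leibniz (diffCVFAt_iff.1 hV) h1
  have l2 := D.isCovariantDerivativeOnUniv.leibniz (diffCVFAt_iff.1 hI) h2
  have a1 : DiffCVFAt ((fun y => (φ y).re) • V) x := ⟨hV.1.smul h1, hV.2.smul h1⟩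
  have a2 : DiffCVFAt ((fun y => (φ y).im) • fun y => csmul Complex.I (V y)) x :=
    ⟨hI.1.smul h2, hI.2.smul h2⟩
  have e := D.isCovariantDerivativeOnUniv.add (diffCVFAt_iff.1 a1) (diffCVFAt_iff.1 a2)
  have e' : (fun y => csmul (φ y) (V y)) = (fun y => (φ y).re) • V
      + (fun y => (φ y).im) • fun y => csmul Complex.I (V y) := by
    funext y
    ext1 <;> simp [csmul]
    abel
  rw [e', e, l1, l2, dC_apply hφ]
  simp only [add_apply, smul_apply, ContinuousLinearMap.smulRight_apply,
    hD.deriv_csmul_I hV]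
  change _ + dR _ x X • _ + (_ + dR _ x X • _) = _
  ext1 <;> simp [csmul] <;> module

include hD hh in
/-- The Weyl condition on complex vector fields. -/
theorem weylC {V W : ∀ y : M, CTM y} (hV : DiffCVFAt V x) (hW : DiffCVFAt W x) (X : TM x) :
    dC (fun y => complexForm (h y) (V y) (W y)) x X
      = complexForm (h x) (D V x X) (W x) + complexForm (h x) (V x) (D W x X)
        - 2 * f X * complexForm (h x) (V x) (W x) := by
  have w11 := hD.weyl _ _ hV.1 hW.1 X
  have w12 := hD.weyl _ _ hV.1 hW.2 X
  have w21 := hD.weyl _ _ hV.2 hW.1 X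
  have w22 := hD.weyl _ _ hV.2 hW.2 X
  have d11 := hh.diff _ _ hV.1 hW.1
  have d12 := hh.diff _ _ hV.1 hW.2
  have d21 := hh.diff _ _ hV.2 hW.1
  have d22 := hh.diff _ _ hV.2 hW.2
  have I2 := Complex.I_mul_I
  rw [dC_apply (hh.diffC hV hW)]
  simp only [complexForm]
  rw [dR_sub d11 d22, dR_add d12 d21, Complex.mk_eq_add_mul_I]
  change _ = complexForm (h x) _ _ + complexForm (h x) _ _ - 2 * f X * complexForm (h x) _ _
  rw [hD.deriv_eq hV, hD.deriv_eq hW]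
  conv_rhs => rw [eq_ofReal_add (V x), eq_ofReal_add (W x)]
  simp only [complexForm_add_left, complexForm_add_right, complexForm_csmul_left,
    complexForm_csmul_right, complexForm_ofReal, sub_apply, add_apply] at w11 w12 w21 w22 ⊢
  push_cast
  -- Bilinear expansion in real and imaginary parts. The correction with i² = -1 belongs to the
  -- imaginary-imaginary terms.
  linear_combination w11 - w22 + Complex.I * w12 + Complex.I * w21 +
    (complexForm (h x) (D (fun y => ofReal (V y).2) x X) (ofReal (W x).2)
    + complexForm (h x) (ofReal (V x).2) (D (fun y => ofReal (W y).2) x X)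
    - 2 * f X * (h x (V x).2 (W x).2)) * (-I2)

include hD hh in
/-- Koszul formula on real vector fields. -/
theorem leviCivita_eq {X Y Z : ∀ y : M, TM y} (hX : DiffVFAt X x) (hY : DiffVFAt Y x)
    (hZ : DiffVFAt Z x) : (leviCivita h X Y Z x : ℂ)
      = complexForm (h x) (D (fun y => ofReal (Y y)) x (X x)) (ofReal (Z x))
        - f (X x) * h x (Y x) (Z x) - f (Y x) * h x (X x) (Z x) + f (Z x) * h x (X x) (Y x) := by
  have c : ∀ v w, complexForm (h x) v w = complexForm (h x) w v := complexForm_comm _ (hh.symm x)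
  have w1 := hD.weyl _ _ hY hZ (X x)
  have w2 := hD.weyl _ _ hZ hX (Y x)
  have w3 := hD.weyl _ _ hX hY (Z x)
  have t1 := congrArg (fun v => complexForm (h x) v (ofReal (Z x))) (hD.torsion_free _ _ hX hY)
  have t2 := congrArg (fun v => complexForm (h x) v (ofReal (Y x))) (hD.torsion_free _ _ hX hZ)
  have t3 := congrArg (fun v => complexForm (h x) v (ofReal (X x))) (hD.torsion_free _ _ hY hZ)
  simp only [complexForm_sub_left, complexForm_ofReal] at t1 t2 t3
  rw [c (ofReal _) (D _ _ _)] at w1 w2 w3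
  rw [hh.symm x (Z x) (X x)] at w2
  simp only [leviCivita]
  push_cast
  -- The classical Koszul combination: the cyclic metric derivatives, corrected by the three torsion
  -- identities.
  linear_combination (1 / 2) * (w1 + w2 - w3 - t1 + t2 + t3)

include hD hh in
/-- Koszul formula on complex vector fields. -/
theorem leviCivitaC_eq {X Y Z : ∀ y : M, CTM y} (hX : DiffCVFAt X x) (hY : DiffCVFAt Y x)
    (hZ : DiffCVFAt Z x) : leviCivitaC h X Y Z x
      = complexForm (h x) (cderiv D Y x (X x)) (Z x)
        - cform f (X x) * complexForm (h x) (Y x) (Z x)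
        - cform f (Y x) * complexForm (h x) (X x) (Z x)
        + cform f (Z x) * complexForm (h x) (X x) (Y x) := by
  have I2 := Complex.I_mul_I
  simp only [leviCivitaC, Complex.mk_eq_add_mul_I]
  push_cast
  rw [hD.leviCivita_eq hh hX.1 hY.1 hZ.1, hD.leviCivita_eq hh hX.1 hY.1 hZ.2,
    hD.leviCivita_eq hh hX.1 hY.2 hZ.1, hD.leviCivita_eq hh hX.1 hY.2 hZ.2,
    hD.leviCivita_eq hh hX.2 hY.1 hZ.1, hD.leviCivita_eq hh hX.2 hY.1 hZ.2,
    hD.leviCivita_eq hh hX.2 hY.2 hZ.1, hD.leviCivita_eq hh hX.2 hY.2 hZ.2, cderiv,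
    hD.deriv_eq hY, hD.deriv_eq hY]
  conv_rhs => rw [eq_ofReal_add (Z x), eq_ofReal_add (Y x), eq_ofReal_add (X x)]
  simp only [complexForm_add_left, complexForm_add_right, complexForm_csmul_left,
    complexForm_csmul_right, complexForm_ofReal, csmul_add, csmul_csmul]
  have i3 : Complex.I ^ 3 = -Complex.I := by rw [pow_succ, Complex.I_sq]; ring
  have e : ∀ U : ∀ y : M, CTM y, ofReal (U x).1 + csmul Complex.I (ofReal (U x).2) = U x :=
    fun U => (eq_ofReal_add _).symm
  simp only [e, cform]
  ring_nf
  simp only [Complex.I_sq, i3]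
  ring

/-- The Weyl form under a conformal change of the metric. -/
theorem conformal (hD : IsWeylAt h D x f) (hh : FormDiffAt h x) {φ : M → ℝ} (hφ : DiffRAt φ x)
    (h0 : φ x ≠ 0) : IsWeylAt (fun y => φ y • h y) D x
      (fun X => f X - ((2 * φ x)⁻¹ * dR φ x X : ℝ)) where
  complex_linear := hD.complex_linear
  torsion_free := hD.torsion_free
  weyl Y Z hY hZ X := by
    have w := hD.weyl Y Z hY hZ X
    have h0' : (φ x : ℂ) ≠ 0 := by exact_mod_cast h0
    simp only [complexForm_smul_form, smul_apply, smul_eq_mul]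
    -- The product rule produces an extra term dφ ⊗ h. Divided by -2φ, it is the shift of the Weyl
    -- form.
    rw [dR_mul hφ (hh.diff _ _ hY hZ)]
    simp only [add_apply, smul_apply, smul_eq_mul]
    push_cast
    field_simp
    linear_combination φ x * w

end IsWeylAt

end ComplexCalculus

/-! ### Spin coefficients in terms of a Weyl connection, and the divergence of `J`. -/

section SpinCoefficients

variable {M : Type*} [TopologicalSpace M] [ChartedSpace (EuclideanSpace ℝ (Fin 4)) M]
  [IsManifold (𝓡 4) ∞ M] {x : M}

/-- A conformal null tetrad field that is differentiable at `x`. -/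
structure TetradFieldAt (g : FormField M) (N : ∀ y : M, Tetrad y) (x : M) : Prop where
  metric : FormDiffAt g x
  null : ∀ y, IsConformalNull (g y) (N y)
  l : DiffVFAt (fun y => (N y).l) x
  n : DiffVFAt (fun y => (N y).n) x
  m : DiffCVFAt (fun y => (N y).m) x

namespace TetradFieldAt

variable {g : FormField M} {N : ∀ y : M, Tetrad y}

theorem isNullTetrad (hN : TetradFieldAt g N x) (y : M) :
    IsNullTetrad (frameMetric g N y) (N y) :=
  (hN.null y).isNullTetrad (hN.metric.symm y)

theorem diff_inv (hN : TetradFieldAt g N x) : DiffRAt (fun y => (g y (N y).l (N y).n)⁻¹) x := by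
  have h := hN.metric.diff _ _ hN.l hN.n
  have : DifferentiableAt ℝ (fun t : ℝ => t⁻¹) (g x (N x).l (N x).n) :=
    differentiableAt_inv (hN.null x).ln.ne'
  exact this.mdifferentiableAt.comp x h

theorem frameMetric_diff (hN : TetradFieldAt g N x) : FormDiffAt (frameMetric g N) x :=
  hN.metric.smul hN.diff_inv

/-- The prime symmetry halves the work: formulas for ρ', τ', ε', β' follow by applying the unprimed
ones to the swapped tetrad. -/
theorem prime (hN : TetradFieldAt g N x) : TetradFieldAt g (fun y => (N y).prime) x where
  metric := hN.metric
  null y := by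
    have h := hN.null y
    have c := complexForm_comm (g y) (hN.metric.symm y)
    have e : g y (N y).n (N y).l = g y (N y).l (N y).n := hN.metric.symm y _ _
    have a : ∀ u : TM y, complexForm (g y) (ofReal u) (conj (N y).m)
        = (starRingEnd ℂ) (complexForm (g y) (ofReal u) (N y).m) := fun u => by
      rw [← complexForm_conj, conj_ofReal]
    refine ⟨?_, ?_, h.nn, h.ll, ?_, ?_, ?_⟩
    · simpa [Tetrad.prime, e] using h.ln
    · simpa [Tetrad.prime, e, conj_conj, c (conj _)] using h.mm
    · simp [Tetrad.prime, a, h.nm]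
    · simp [Tetrad.prime, a, h.lm]
    · simp [Tetrad.prime, complexForm_conj, h.m0]
  l := hN.n
  n := hN.l
  m := hN.m.conj

theorem frameMetric_prime (hN : TetradFieldAt g N x) :
    frameMetric g (fun y => (N y).prime) = frameMetric g N := by
  funext y
  simp [frameMetric, Tetrad.prime, hN.metric.symm y (N y).n]

/-- A complex linear function of a real vector in terms of its values on the tetrad. -/
theorem eq_of_linear (hN : TetradFieldAt g N x) {T : CTM x → ℂ}
    (hadd : ∀ v w, T (v + w) = T v + T w) (hsmul : ∀ c v, T (csmul c v) = c * T v) (X : TM x) :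
    T (ofReal X) = nForm g N x X * T (ofReal (N x).l) + lForm g N x X * T (ofReal (N x).n)
      - mbarForm g N x X * T (N x).m - mForm g N x X * T (conj (N x).m) := by
  have h := hN.isNullTetrad x
  have e : ofReal X = csmul (nForm g N x X) (ofReal (N x).l) + csmul (lForm g N x X) (ofReal (N x).n)
      + csmul (-mbarForm g N x X) (N x).m + csmul (-mForm g N x X) (conj (N x).m) := by
    apply h.ext <;> simp [complexForm_add_right, complexForm_csmul_right, nForm, lForm, mForm,
      mbarForm, lower, h.ln, h.ll, h.nn, h.lm, h.nm, h.mm, h.mmb, h.nl, h.ml, h.mn, h.mbm, h.mbmb,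
      h.lmb, h.nmb, h.mbl, h.mbn]
  conv_lhs => rw [e]
  simp only [hadd, hsmul]
  ring

end TetradFieldAt

theorem leviCivita_neg {h : FormField M} (hh : FormDiffAt h x) {X Y Z : ∀ y : M, TM y}
    (hX : DiffVFAt X x) (hY : DiffVFAt Y x) (hZ : DiffVFAt Z x) :
    leviCivita h (fun y => -X y) Y Z x = -leviCivita h X Y Z x ∧
    leviCivita h X (fun y => -Y y) Z x = -leviCivita h X Y Z x ∧
    leviCivita h X Y (fun y => -Z y) x = -leviCivita h X Y Z x := by
  have c : DiffRAt (fun _ : M => (-1 : ℝ)) x := mdifferentiableAt_const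
  have e : ∀ V : ∀ y : M, TM y, (fun y => -V y) = (fun _ : M => (-1 : ℝ)) • V := by
    intro V
    funext y
    simp
  refine ⟨?_, ?_, ?_⟩
  · rw [e X]
    exact ((leviCivita_tensorial_fst hh hY hZ).smul c hX).trans (by simp)
  · rw [e Y, leviCivita_smul_snd hh c hX hY hZ, dR_const]
    simp
  · rw [e Z]
    exact ((leviCivita_tensorial_thd hh hX hY).smul c hZ).trans (by simp)

/-- The Levi-Civita connection is real. A Weyl connection with complex Weyl form has no such
property, so conjugate spin coefficients are obtained from here. -/
theorem leviCivitaC_conj {h : FormField M} (hh : FormDiffAt h x) {X Y Z : ∀ y : M, CTM y}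
    (hX : DiffCVFAt X x) (hY : DiffCVFAt Y x) (hZ : DiffCVFAt Z x) :
    (starRingEnd ℂ) (leviCivitaC h X Y Z x)
      = leviCivitaC h (fun y => conj (X y)) (fun y => conj (Y y)) (fun y => conj (Z y)) x := by
  have a := fun {A B C : ∀ y : M, TM y} (hA : DiffVFAt A x) (hB : DiffVFAt B x)
    (hC : DiffVFAt C x) => (leviCivita_neg hh hA hB hC)
  simp only [leviCivitaC, conj]
  rw [(a hX.1 hY.1 hZ.2).2.2, (a hX.1 hY.2 hZ.1).2.1, (a hX.2 hY.1 hZ.1).1,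
    (a hX.1 hY.2 hZ.2.neg).2.1, (a hX.1 hY.2 hZ.2).2.2,
    (a hX.2 hY.1 hZ.2.neg).1, (a hX.2 hY.1 hZ.2).2.2,
    (a hX.2 hY.2.neg hZ.1).1, (a hX.2 hY.2 hZ.1).2.1,
    (a hX.2 hY.2.neg hZ.2.neg).1, (a hX.2 hY.2 hZ.2.neg).2.1, (a hX.2 hY.2 hZ.2).2.2]
  apply Complex.ext <;> simp <;> ring

theorem dC_const_mul {φ : M → ℂ} (hφ : DiffCAt φ x) (c : ℂ) (X : TM x) :
    dC (fun y => c * φ y) x X = c * dC φ x X :=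
  mvfderiv_clm_comp hφ (ContinuousLinearMap.mul ℝ ℂ c) X

theorem TetradFieldAt.acs_diff {g : FormField M} {N : ∀ y : M, Tetrad y}
    (hN : TetradFieldAt g N x) {Y : ∀ y : M, TM y} (hY : DiffVFAt Y x) :
    DiffCVFAt (fun y => acs (frameMetric g N y) (N y) (Y y)) x := by
  have hh := hN.frameMetric_diff
  have e : (fun y => acs (frameMetric g N y) (N y) (Y y)) = fun y => csmul Complex.I
      (csmul (complexForm (frameMetric g N y) (ofReal (N y).l) (ofReal (Y y))) (ofReal (N y).n)
        - csmul (complexForm (frameMetric g N y) (ofReal (N y).n) (ofReal (Y y))) (ofReal (N y).l)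
        + csmul (complexForm (frameMetric g N y) (conj (N y).m) (ofReal (Y y))) (N y).m
        - csmul (complexForm (frameMetric g N y) (N y).m (ofReal (Y y))) (conj (N y).m)) := by
    funext y
    rw [← complexify_acs (N y) (hN.isNullTetrad y).ln, complexify_ofReal]
  rw [e]
  exact DiffCVFAt.const_csmul _ ((((hN.n.ofReal.csmul (hh.diffC hN.l.ofReal hY.ofReal)).sub
    (hN.l.ofReal.csmul (hh.diffC hN.n.ofReal hY.ofReal))).add
    (hN.m.csmul (hh.diffC hN.m.conj hY.ofReal))).sub
    (hN.m.conj.csmul (hh.diffC hN.m hY.ofReal)))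

namespace IsWeylAt

variable {D : CConnection M} {g : FormField M} {N : ∀ y : M, Tetrad y} {f : TM x → ℂ}

section Constants

variable {h : FormField M} (hD : IsWeylAt h D x f) (hh : FormDiffAt h x)
include hD hh

/-- Metric compatibility for fields with constant product. -/
theorem deriv_product {V W : ∀ y : M, CTM y} (hV : DiffCVFAt V x) (hW : DiffCVFAt W x) {c : ℂ}
    (hc : ∀ y, complexForm (h y) (V y) (W y) = c) (v : CTM x) :
    complexForm (h x) (cderiv D V x v) (W x) + complexForm (h x) (V x) (cderiv D W x v)
      = 2 * cform f v * c := by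
  have w : ∀ X, complexForm (h x) (D V x X) (W x) + complexForm (h x) (V x) (D W x X)
      = 2 * f X * c := fun X => by
    have := hD.weylC hh hV hW X
    simp only [hc, dC_const] at this
    rw [zero_apply] at this
    linear_combination -this
  simp only [cderiv, complexForm_add_left, complexForm_add_right, complexForm_csmul_left,
    complexForm_csmul_right, cform]
  linear_combination w v.1 + Complex.I * w v.2

end Constants

variable (hN : TetradFieldAt g N x) (hD : IsWeylAt (frameMetric g N) D x f)
include hN hD

/-- Differentiate the eigenvector equation W·(JY) = s W·Y. The terms -2f on the two sides agree and
cancel, and the derivative of `J` is moved onto the covector `W`. -/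
theorem deriv_acs_product {Y : ∀ y : M, TM y} (hY : DiffVFAt Y x) {W : ∀ y : M, CTM y}
    (hW : DiffCVFAt W x) {s : ℂ} (hs : ∀ y v, complexForm (frameMetric g N y) (W y)
      (complexify (acs (frameMetric g N y) (N y)) v) = s * complexForm (frameMetric g N y) (W y) v)
    (v : CTM x) : complexForm (frameMetric g N x) (W x)
      (complexify ((D (fun y => acs (frameMetric g N y) (N y) (Y y)) x : TM x →ₗ[ℝ] CTM x)
      - complexify (acs (frameMetric g N x) (N x)) ∘ₗ
        (D (fun y => ofReal (Y y)) x : TM x →ₗ[ℝ] CTM x)) v)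
    = -complexForm (frameMetric g N x) (cderiv D W x v)
        (complexify (acs (frameMetric g N x) (N x)) (ofReal (Y x)))
      + s * complexForm (frameMetric g N x) (cderiv D W x v) (ofReal (Y x)) := by
  have hh := hN.frameMetric_diff
  have key : ∀ X, complexForm (frameMetric g N x) (W x)
      (D (fun y => acs (frameMetric g N y) (N y) (Y y)) x X)
      - s * complexForm (frameMetric g N x) (W x) (D (fun y => ofReal (Y y)) x X)
      = -complexForm (frameMetric g N x) (D W x X) (acs (frameMetric g N x) (N x) (Y x))
      + s * complexForm (frameMetric g N x) (D W x X) (ofReal (Y x)) := by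
    intro X
    have w1 := hD.weylC hh hW (hN.acs_diff hY) X
    have w2 := hD.weylC hh hW hY.ofReal X
    have e : ∀ y, complexForm (frameMetric g N y) (W y) (acs (frameMetric g N y) (N y) (Y y))
        = s * complexForm (frameMetric g N y) (W y) (ofReal (Y y)) := fun y => by
      rw [← hs, complexify_ofReal]
    simp only [e] at w1
    rw [dC_const_mul (hh.diffC hW hY.ofReal)] at w1
    linear_combination s * w2 - w1
  have e : ∀ F : TM x →ₗ[ℝ] CTM x, complexify F v = F v.1 + csmul Complex.I (F v.2) := by
    intro F
    simp [complexify, mulI_eq]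
  rw [e]
  simp only [LinearMap.sub_apply, LinearMap.comp_apply, cderiv, complexForm_add_left,
    complexForm_add_right, complexForm_csmul_left, complexForm_csmul_right, complexForm_sub_right,
    hs, complexify_ofReal]
  have k1 := key v.1
  have k2 := key v.2
  simp only [ContinuousLinearMap.coe_coe]
  linear_combination k1 + Complex.I * k2

/-- Of the three correction terms in the Koszul formula only the one with \bar m·m = -1 survives. -/
theorem rho_eq : rho g N x = complexForm (frameMetric g N x)
    (cderiv D (fun y => ofReal (N y).l) x (conj (N x).m)) (N x).m + cform f (ofReal (N x).l) := by
  have h := hN.isNullTetrad x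
  simp only [rho, nabla]
  rw [hD.leviCivitaC_eq hN.frameMetric_diff hN.m.conj hN.l.ofReal hN.m]
  simp only [h.lm, h.mbm, h.mbl]
  ring

theorem tau_eq : tau g N x = complexForm (frameMetric g N x)
    (cderiv D (fun y => ofReal (N y).l) x (ofReal (N x).n)) (N x).m + cform f (N x).m := by
  have h := hN.isNullTetrad x
  simp only [tau, nabla]
  rw [hD.leviCivitaC_eq hN.frameMetric_diff hN.n.ofReal hN.l.ofReal hN.m]
  simp only [h.lm, h.nm, h.nl]
  ring

theorem rho'_eq : rho' g N x = complexForm (frameMetric g N x)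
    (cderiv D (fun y => ofReal (N y).n) x (N x).m) (conj (N x).m) + cform f (ofReal (N x).n) := by
  have := rho_eq hN.prime (D := D) (f := f) (hN.frameMetric_prime ▸ hD)
  rw [hN.frameMetric_prime] at this
  simpa only [rho', tau', Tetrad.prime, conj_conj] using this

theorem tau'_eq : tau' g N x = complexForm (frameMetric g N x)
    (cderiv D (fun y => ofReal (N y).n) x (ofReal (N x).l)) (conj (N x).m)
      + cform f (conj (N x).m) := by
  have := tau_eq hN.prime (D := D) (f := f) (hN.frameMetric_prime ▸ hD)
  rw [hN.frameMetric_prime] at this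
  simpa only [rho', tau', Tetrad.prime, conj_conj] using this

/-- `D_b J_a^b` in terms of the spin coefficients and the Weyl form. -/
theorem ctrace_deriv_acs {Y : ∀ y : M, TM y} (hY : DiffVFAt Y x) :
    ctrace ((D (fun y => acs (frameMetric g N y) (N y) (Y y)) x : TM x →ₗ[ℝ] CTM x)
      - complexify (acs (frameMetric g N x) (N x)) ∘ₗ
        (D (fun y => ofReal (Y y)) x : TM x →ₗ[ℝ] CTM x))
    = 2 * Complex.I * ((tau' g N x - cform f (conj (N x).m)) * mForm g N x (Y x)
      - (tau g N x - cform f (N x).m) * mbarForm g N x (Y x)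
      - (rho' g N x - cform f (ofReal (N x).n)) * lForm g N x (Y x)
      + (rho g N x - cform f (ofReal (N x).l)) * nForm g N x (Y x)) := by
  have h := hN.isNullTetrad x
  have hh := hN.frameMetric_diff
  have hl := hN.l.ofReal
  have hn := hN.n.ofReal
  have hm := hN.m
  have hb := hN.m.conj
  have H := fun y => hN.isNullTetrad y
  have pl := deriv_acs_product hN hD hY hl (fun y v => (H y).l_acs v) (ofReal (N x).n)
  have pn := deriv_acs_product hN hD hY hn (fun y v => (H y).n_acs v) (ofReal (N x).l)
  have pm := deriv_acs_product hN hD hY hm (fun y v => (H y).m_acs v) (conj (N x).m)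
  have pb := deriv_acs_product hN hD hY hb (fun y v => (H y).mb_acs v) (N x).m
  -- The null products remove the terms in which a leg is paired with its own derivative. Constancy
  -- of l·m and n·\bar m trades derivatives of m and \bar m for derivatives of l and n.
  have cn := hD.deriv_product hh hn hn (fun y => (H y).nn) (ofReal (N x).l)
  have cl := hD.deriv_product hh hl hl (fun y => (H y).ll) (ofReal (N x).n)
  have cm := hD.deriv_product hh hm hm (fun y => (H y).mm) (conj (N x).m)
  have cb := hD.deriv_product hh hb hb (fun y => (H y).mbmb) (N x).m
  have c1 := hD.deriv_product hh hl hm (fun y => (H y).lm) (conj (N x).m)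
  have c2 := hD.deriv_product hh hn hb (fun y => (H y).nmb) (N x).m
  rw [h.ctrace_eq, ← complexify_ofReal _ (N x).l, ← complexify_ofReal _ (N x).n, pl, pn, pm, pb,
    rho_eq hN hD, tau_eq hN hD, rho'_eq hN hD, tau'_eq hN hD]
  -- After expansion, the terms whose covector on `Y` has the same eigenvalue as the differentiated
  -- leg cancel. Those of opposite eigenvalue are doubled, which is the factor 2i.
  simp only [h.complexForm_expand (cderiv D _ _ _), h.l_acs, h.n_acs, h.m_acs, h.mb_acs, nForm,
    lForm, mForm, mbarForm, lower, h.lm, h.nm, h.mm, h.mmb, h.lmb, h.nmb, h.mbm, h.mbmb]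
  simp only [h.comm (cderiv D _ _ _)] at cn cl cm cb c1 c2 ⊢
  linear_combination
    -Complex.I * complexForm (frameMetric g N x) (ofReal (N x).l) (ofReal (Y x)) * (cn - 2 * c2)
    + Complex.I * complexForm (frameMetric g N x) (ofReal (N x).n) (ofReal (Y x)) * (cl - 2 * c1)
    - Complex.I * complexForm (frameMetric g N x) (N x).m (ofReal (Y x)) * cb
    + Complex.I * complexForm (frameMetric g N x) (conj (N x).m) (ofReal (Y x)) * cm

end IsWeylAt
end SpinCoefficients

/-! ### The compatible Weyl form and the reduced connection form. -/

section ReducedConnection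

variable {M : Type*} [TopologicalSpace M] [ChartedSpace (EuclideanSpace ℝ (Fin 4)) M]
  [IsManifold (𝓡 4) ∞ M] {x : M} {D : CConnection M} {g : FormField M} {N : ∀ y : M, Tetrad y}

theorem cform_fForm (g : FormField M) (N : ∀ y : M, Tetrad y) (v : CTM x) :
    cform (fForm g N x) v = rho g N x * complexForm (frameMetric g N x) (ofReal (N x).n) v
      + rho' g N x * complexForm (frameMetric g N x) (ofReal (N x).l) v
      - tau g N x * complexForm (frameMetric g N x) (conj (N x).m) v
      - tau' g N x * complexForm (frameMetric g N x) (N x).m v := by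
  conv_rhs => rw [eq_ofReal_add v]
  simp only [cform, fForm, nForm, lForm, mForm, mbarForm, lower, complexForm_add_right,
    complexForm_csmul_right]
  ring

theorem fForm_zero (g : FormField M) (N : ∀ y : M, Tetrad y) : fForm g N x 0 = 0 := by
  have h : ∀ v : CTM x, lower g N v (0 : TM x) = 0 := fun v => by
    apply Complex.ext <;> simp [lower, complexForm, ofReal]
  simp [fForm, nForm, lForm, mForm, mbarForm, h]

theorem cform_ofReal {f : TM x → ℂ} (h0 : f 0 = 0) (X : TM x) : cform f (ofReal X) = f X := by
  simp [cform, ofReal, h0]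

/-- The Weyl form of a compatible Weyl connection, for the metric in which an adapted tetrad is
normalized. -/
theorem IsCompatibleWeyl.isWeylAt {J : ∀ y : M, TM y →ₗ[ℝ] CTM y} (hD : IsCompatibleWeyl g J D)
    (hN : TetradFieldAt g N x) (hJ : ∀ y, J y = acs (g y) (N y)) :
    IsWeylAt (frameMetric g N) D x (fForm g N x) := by
  obtain ⟨f₀, hf₀⟩ := hD.weyl
  have w₀ : IsWeylAt g D x (fun X => f₀ x X) :=
    ⟨hD.complex_linear x, hD.torsion_free x, hf₀ x (Set.mem_univ x)⟩
  -- The Weyl form `f₀` refers to `g`. Passing to the metric with l·n = 1 shifts it by the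
  -- logarithmic differential of the conformal factor.
  have w₁ := w₀.conformal hN.metric hN.diff_inv (inv_ne_zero (hN.null x).ln.ne')
  set c : ℝ := (2 * (g x (N x).l (N x).n)⁻¹)⁻¹
  set θ := dR (fun y => (g y (N y).l (N y).n)⁻¹) x
  set f : TM x → ℂ := fun X => f₀ x X - ((c * θ X : ℝ) : ℂ) with hf
  change IsWeylAt (frameMetric g N) D x f at w₁
  have h := hN.isNullTetrad x
  have hJ' : J = fun y => acs (frameMetric g N y) (N y) := by
    funext y
    rw [hJ y, frameMetric, acs_smul_form _ (inv_ne_zero (hN.null y).ln.ne')]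
  have tr : ∀ Y : ∀ y : M, TM y, DiffVFAt Y x → _ = (0 : ℂ) := fun Y hY =>
    (w₁.ctrace_deriv_acs hN hY).symm.trans (by simpa only [hJ'] using hD.compatible x Y hY)
  have I0 := Complex.I_ne_zero
  have e : ∀ v : TM x, ∀ w : CTM x, lower g N w v = complexForm (frameMetric g N x) w (ofReal v) :=
    fun _ _ => rfl
  -- Evaluating the vanishing divergence on l, n, Re m, Im m isolates the four coefficients, hence
  -- the values of f on the tetrad. The divergence condition speaks of real fields, so m and \bar m
  -- are recovered from the last two.
  have tl := tr _ hN.l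
  have tn := tr _ hN.n
  have t1 := tr _ hN.m.1
  have t2 := tr _ hN.m.2
  have m1 : ofReal (N x).m.1 = csmul (1 / 2) ((N x).m + conj (N x).m) := by
    ext1 <;> simp [ofReal, conj, csmul] <;> module
  have m2 : ofReal (N x).m.2 = csmul (-Complex.I / 2) ((N x).m - conj (N x).m) := by
    ext1 <;> simp [ofReal, conj, csmul] <;> module
  simp only [nForm, lForm, mForm, mbarForm, e, m1, m2, complexForm_csmul_right,
    complexForm_add_right, complexForm_sub_right, h.ln, h.ll, h.nn, h.lm, h.nm, h.mm, h.mmb, h.nl,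
    h.ml, h.mn, h.mbm, h.mbmb, h.lmb, h.nmb, h.mbl, h.mbn] at tl tn t1 t2
  have r1 : rho g N x = cform f (ofReal (N x).l) := by
    have : 2 * Complex.I * (rho g N x - cform f (ofReal (N x).l)) = 0 := by linear_combination tl
    simpa [sub_eq_zero] using this
  have r2 : rho' g N x = cform f (ofReal (N x).n) := by
    have : 2 * Complex.I * (rho' g N x - cform f (ofReal (N x).n)) = 0 := by linear_combination -tn
    simpa [sub_eq_zero] using this
  have I2 := Complex.I_mul_I
  have r3 : tau g N x = cform f (N x).m := by
    have : 2 * Complex.I * (tau g N x - cform f (N x).m) = 0 := by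
      linear_combination t1 + Complex.I * t2 + Complex.I *
        ((tau g N x - cform f (N x).m) + (tau' g N x - cform f (conj (N x).m))) * I2
    simpa [sub_eq_zero] using this
  have r4 : tau' g N x = cform f (conj (N x).m) := by
    have : 2 * Complex.I * (tau' g N x - cform f (conj (N x).m)) = 0 := by
      linear_combination -t1 + Complex.I * t2 + Complex.I *
        ((tau g N x - cform f (N x).m) + (tau' g N x - cform f (conj (N x).m))) * I2
    simpa [sub_eq_zero] using this
  have : f = fForm g N x := by
    funext X
    have ha : ∀ v w : CTM x, cform f (v + w) = cform f v + cform f w := by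
      intro v w
      simp only [cform, hf, Prod.fst_add, Prod.snd_add, map_add]
      push_cast
      ring
    have hs : ∀ (z : ℂ) (v : CTM x), cform f (csmul z v) = z * cform f v := by
      intro z v
      have I2 := Complex.I_mul_I
      simp only [cform, hf, csmul, map_add, map_sub, map_smul, smul_eq_mul, Complex.real_smul]
      push_cast
      conv_rhs => rw [← Complex.re_add_im z]
      linear_combination ((z.im : ℂ) * (f₀ x v.2 - c * θ v.2)) * (-I2)
    rw [← cform_ofReal (f := f) (by simp [hf]) X, hN.eq_of_linear ha hs X, ← r1, ← r2, ← r3, ← r4,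
      fForm]
    ring
  rwa [← this]

namespace IsWeylAt

section Coefficients

variable {f : TM x → ℂ} (hN : TetradFieldAt g N x) (hD : IsWeylAt (frameMetric g N) D x f)
include hN hD

theorem eps_eq : eps g N x = (1 / 2) * (complexForm (frameMetric g N x)
    (cderiv D (fun y => ofReal (N y).l) x (ofReal (N x).l)) (ofReal (N x).n)
    + complexForm (frameMetric g N x)
    (cderiv D (fun y => conj (N y).m) x (ofReal (N x).l)) (N x).m - cform f (ofReal (N x).l)) := by
  have h := hN.isNullTetrad x
  simp only [eps, nabla]
  rw [hD.leviCivitaC_eq hN.frameMetric_diff hN.l.ofReal hN.l.ofReal hN.n.ofReal,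
    hD.leviCivitaC_eq hN.frameMetric_diff hN.l.ofReal hN.m.conj hN.m]
  simp only [h.ln, h.ll, h.lm, h.mbm, h.lmb]
  ring

/-- Conjugation is carried out before `D` is introduced, so f itself, and not its conjugate, appears
on the right. -/
theorem conj_eps_eq : (starRingEnd ℂ) (eps g N x) = (1 / 2) * (complexForm (frameMetric g N x)
    (cderiv D (fun y => ofReal (N y).l) x (ofReal (N x).l)) (ofReal (N x).n)
    + complexForm (frameMetric g N x)
    (cderiv D (fun y => (N y).m) x (ofReal (N x).l)) (conj (N x).m) - cform f (ofReal (N x).l)) := by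
  have h := hN.isNullTetrad x
  have hh := hN.frameMetric_diff
  simp only [eps, nabla, map_mul, map_add]
  rw [leviCivitaC_conj hh hN.l.ofReal hN.l.ofReal hN.n.ofReal,
    leviCivitaC_conj hh hN.l.ofReal hN.m.conj hN.m]
  simp only [conj_ofReal, conj_conj]
  rw [hD.leviCivitaC_eq hh hN.l.ofReal hN.l.ofReal hN.n.ofReal,
    hD.leviCivitaC_eq hh hN.l.ofReal hN.m hN.m.conj]
  simp only [h.ln, h.ll, h.lm, h.mmb, h.lmb, map_div₀, map_one, map_ofNat]
  ring

theorem beta_eq : beta g N x = (1 / 2) * (complexForm (frameMetric g N x)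
    (cderiv D (fun y => ofReal (N y).l) x (N x).m) (ofReal (N x).n)
    + complexForm (frameMetric g N x)
    (cderiv D (fun y => conj (N y).m) x (N x).m) (N x).m - cform f (N x).m) := by
  have h := hN.isNullTetrad x
  simp only [beta, nabla]
  rw [hD.leviCivitaC_eq hN.frameMetric_diff hN.m hN.l.ofReal hN.n.ofReal,
    hD.leviCivitaC_eq hN.frameMetric_diff hN.m hN.m.conj hN.m]
  simp only [h.ln, h.ml, h.mn, h.mm, h.mbm, h.mmb]
  ring

theorem conj_beta_eq : (starRingEnd ℂ) (beta g N x) = (1 / 2) * (complexForm (frameMetric g N x)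
    (cderiv D (fun y => ofReal (N y).l) x (conj (N x).m)) (ofReal (N x).n)
    + complexForm (frameMetric g N x)
    (cderiv D (fun y => (N y).m) x (conj (N x).m)) (conj (N x).m) - cform f (conj (N x).m)) := by
  have h := hN.isNullTetrad x
  have hh := hN.frameMetric_diff
  simp only [beta, nabla, map_mul, map_add]
  rw [leviCivitaC_conj hh hN.m hN.l.ofReal hN.n.ofReal,
    leviCivitaC_conj hh hN.m hN.m.conj hN.m]
  simp only [conj_ofReal, conj_conj]
  rw [hD.leviCivitaC_eq hh hN.m.conj hN.l.ofReal hN.n.ofReal,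
    hD.leviCivitaC_eq hh hN.m.conj hN.m hN.m.conj]
  simp only [h.ln, h.mbl, h.mbn, h.mbm, h.mmb, h.mbmb, map_div₀, map_one, map_ofNat]
  ring

theorem eps'_eq : eps' g N x = (1 / 2) * (complexForm (frameMetric g N x)
    (cderiv D (fun y => ofReal (N y).n) x (ofReal (N x).n)) (ofReal (N x).l)
    + complexForm (frameMetric g N x)
    (cderiv D (fun y => (N y).m) x (ofReal (N x).n)) (conj (N x).m) - cform f (ofReal (N x).n)) := by
  have := eps_eq hN.prime (D := D) (f := f) (hN.frameMetric_prime ▸ hD)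
  rw [hN.frameMetric_prime] at this
  simpa only [eps', Tetrad.prime, conj_conj] using this

theorem conj_eps'_eq : (starRingEnd ℂ) (eps' g N x) = (1 / 2) * (complexForm (frameMetric g N x)
    (cderiv D (fun y => ofReal (N y).n) x (ofReal (N x).n)) (ofReal (N x).l)
    + complexForm (frameMetric g N x)
    (cderiv D (fun y => conj (N y).m) x (ofReal (N x).n)) (N x).m - cform f (ofReal (N x).n)) := by
  have := conj_eps_eq hN.prime (D := D) (f := f) (hN.frameMetric_prime ▸ hD)
  rw [hN.frameMetric_prime] at this
  simpa only [eps', Tetrad.prime, conj_conj] using this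

theorem beta'_eq : beta' g N x = (1 / 2) * (complexForm (frameMetric g N x)
    (cderiv D (fun y => ofReal (N y).n) x (conj (N x).m)) (ofReal (N x).l)
    + complexForm (frameMetric g N x)
    (cderiv D (fun y => (N y).m) x (conj (N x).m)) (conj (N x).m) - cform f (conj (N x).m)) := by
  have := beta_eq hN.prime (D := D) (f := f) (hN.frameMetric_prime ▸ hD)
  rw [hN.frameMetric_prime] at this
  simpa only [beta', Tetrad.prime, conj_conj] using this

theorem conj_beta'_eq : (starRingEnd ℂ) (beta' g N x) = (1 / 2) * (complexForm (frameMetric g N x)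
    (cderiv D (fun y => ofReal (N y).n) x (N x).m) (ofReal (N x).l)
    + complexForm (frameMetric g N x)
    (cderiv D (fun y => conj (N y).m) x (N x).m) (N x).m - cform f (N x).m) := by
  have := conj_beta_eq hN.prime (D := D) (f := f) (hN.frameMetric_prime ▸ hD)
  rw [hN.frameMetric_prime] at this
  simpa only [beta', Tetrad.prime, conj_conj] using this

/-- The diagonal connection forms add up to the Weyl form in pairs. -/
theorem connForm_add (X : TM x) :
    connForm g D N 0 0 x X + connForm g D N 1 1 x X = 2 * cform f (ofReal X) ∧
    connForm g D N 2 2 x X + connForm g D N 3 3 x X = 2 * cform f (ofReal X) := by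
  have h := hN.isNullTetrad x
  have hh := hN.frameMetric_diff
  have e1 := hD.deriv_product hh hN.l.ofReal hN.n.ofReal (fun y => (hN.isNullTetrad y).ln) (ofReal X)
  have e2 := hD.deriv_product hh hN.m hN.m.conj (fun y => (hN.isNullTetrad y).mmb) (ofReal X)
  simp only [cderiv_ofReal] at e1 e2
  simp only [connForm, coleg, Tetrad.leg, Matrix.cons_val, complexForm_neg_left]
  rw [h.comm (D _ _ _)] at e1 e2
  exact ⟨by linear_combination e1, by linear_combination -e2⟩

end Coefficients

section Reduced

variable (hN : TetradFieldAt g N x) (hD : IsWeylAt (frameMetric g N) D x (fForm g N x))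
include hN hD

theorem psi_weyl (w₀ w₁ : ℝ) (X : TM x) :
    (psi g D w₀ w₁ N x X).2.2 = fForm g N x X := by
  have e := (hD.connForm_add hN X).2
  rw [cform_fForm] at e
  simp only [psi, fForm, nForm, lForm, mForm, mbarForm, lower]
  linear_combination (1 / 2) * e

theorem connForm_expand (i j : Fin 4) (X : TM x) : connForm g D N i j x X =
    nForm g N x X * coleg g N x i (cderiv D (fun y => (N y).leg j) x (ofReal (N x).l))
    + lForm g N x X * coleg g N x i (cderiv D (fun y => (N y).leg j) x (ofReal (N x).n))
    - mbarForm g N x X * coleg g N x i (cderiv D (fun y => (N y).leg j) x (N x).m)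
    - mForm g N x X * coleg g N x i (cderiv D (fun y => (N y).leg j) x (conj (N x).m)) := by
  rw [connForm, ← cderiv_ofReal]
  refine hN.eq_of_linear (T := fun v => coleg g N x i (cderiv D (fun y => (N y).leg j) x v)) ?_ ?_ X
  · intro v w
    simp only [cderiv_add, coleg, complexForm_add_right]
  · intro c v
    simp only [cderiv_csmul, coleg, complexForm_csmul_right]

/-- With w₁ = -1 - w₀ and both pair sums equal to 2f, one has K = -ω^0_0 - 2w₀ f and L = ω^3_3 - f.
It remains to compare (ω^3_3 - ω^0_0)/2 with the spin coefficients in each tetrad direction. -/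
theorem psi_add {w₀ w₁ : ℝ} (hw : w₀ + w₁ + 1 = 0) (X : TM x) :
    (1 / 2) * ((psi g D w₀ w₁ N x X).1 + (psi g D w₀ w₁ N x X).2.1)
      = ghpForm g N x X + bForm g w₀ w₁ N x X := by
  obtain rfl : w₁ = -1 - w₀ := by linarith
  have h := hN.isNullTetrad x
  have hh := hN.frameMetric_diff
  have s := hD.connForm_add hN X
  rw [cform_ofReal (fForm_zero g N)] at s
  have r1 := hD.deriv_product hh hN.l.ofReal hN.n.ofReal (fun y => (hN.isNullTetrad y).ln)
  have r2 := hD.deriv_product hh hN.m hN.m.conj (fun y => (hN.isNullTetrad y).mmb)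
  -- The primed coefficients contain derivatives of n and m, while ω^0_0 and ω^3_3 contain those of
  -- l and \bar m. Constancy of l·n and m·\bar m converts one into the other along n and \bar m.
  have a1 := r1 (ofReal (N x).n)
  have a2 := r2 (ofReal (N x).n)
  have b1 := r1 (conj (N x).m)
  have b2 := r2 (conj (N x).m)
  have e0 := hD.connForm_expand hN 0 0 X
  have e3 := hD.connForm_expand hN 3 3 X
  simp only [psi, ghpForm, bForm, eps_eq hN hD, eps'_eq hN hD, beta_eq hN hD, beta'_eq hN hD]
  simp only [coleg, Tetrad.leg, Matrix.cons_val, complexForm_neg_left] at e0 e3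
  simp only [h.comm (cderiv D _ _ _), cform_fForm, h.ln, h.ll, h.nn, h.lm, h.nm, h.mm, h.mmb, h.nl,
    h.ml, h.mn, h.mbm, h.mbmb, h.lmb, h.nmb, h.mbl, h.mbn] at a1 a2 b1 b2 e0 e3 ⊢
  simp only [fForm] at s
  push_cast
  linear_combination (-(1 / 2) : ℂ) * e0 + (1 / 2 : ℂ) * e3 - (w₀ / 2 : ℂ) * s.1
    - (1 / 4 : ℂ) * s.2
    + (1 / 2) * mForm g N x X * (b1 + b2) - (1 / 2) * lForm g N x X * (a2 + a1)

/-- As for the sum, now with -(ω^0_0 + ω^3_3)/2 and the conjugate coefficients. These involve the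
unconjugated f, so C is not in general the conjugate of B. -/
theorem psi_sub {w₀ w₁ : ℝ} (hw : w₀ + w₁ + 1 = 0) (X : TM x) :
    (1 / 2) * ((psi g D w₀ w₁ N x X).1 - (psi g D w₀ w₁ N x X).2.1)
      = ghpFormBar g N x X + cForm g w₀ w₁ N x X := by
  obtain rfl : w₁ = -1 - w₀ := by linarith
  have h := hN.isNullTetrad x
  have hh := hN.frameMetric_diff
  have s := hD.connForm_add hN X
  rw [cform_ofReal (fForm_zero g N)] at s
  have r1 := hD.deriv_product hh hN.l.ofReal hN.n.ofReal (fun y => (hN.isNullTetrad y).ln)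
  have r2 := hD.deriv_product hh hN.m hN.m.conj (fun y => (hN.isNullTetrad y).mmb)
  have a1 := r1 (ofReal (N x).n)
  have a2 := r2 (ofReal (N x).l)
  have b1 := r1 (N x).m
  have b2 := r2 (conj (N x).m)
  have e0 := hD.connForm_expand hN 0 0 X
  have e3 := hD.connForm_expand hN 3 3 X
  have c : ∀ v : CTM x, (starRingEnd ℂ) (lower g N v X) = lower g N (conj v) X := fun v => by
    simp only [lower]
    rw [← complexForm_conj, conj_ofReal]
  simp only [psi, ghpFormBar, ghpForm, cForm, nForm, lForm, mForm, mbarForm, map_sub, map_add,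
    map_mul, map_neg, conj_eps_eq hN hD, conj_eps'_eq hN hD, conj_beta_eq hN hD,
    conj_beta'_eq hN hD, c, conj_ofReal, conj_conj]
  simp only [coleg, Tetrad.leg, Matrix.cons_val, complexForm_neg_left] at e0 e3
  simp only [h.comm (cderiv D _ _ _), cform_fForm, h.ln, h.ll, h.nn, h.lm, h.nm, h.mm, h.mmb, h.nl,
    h.ml, h.mn, h.mbm, h.mbmb, h.lmb, h.nmb, h.mbl, h.mbn] at a1 a2 b1 b2 e0 e3 ⊢
  simp only [fForm, nForm, lForm, mForm, mbarForm] at s e0 e3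
  push_cast
  linear_combination (-(1 / 2) : ℂ) * e0 - (1 / 2 : ℂ) * e3 - (w₀ / 2 : ℂ) * s.1
    + (1 / 4 : ℂ) * s.2
    - (1 / 2) * lower g N (ofReal (N x).l) X * a1 + (1 / 2) * lower g N (ofReal (N x).n) X * a2
    + (1 / 2) * lower g N (conj (N x).m) X * b1 - (1 / 2) * lower g N (N x).m X * b2

end Reduced

end IsWeylAt
end ReducedConnection

/-! ### Existence and uniqueness of the compatible Weyl connection. -/

section Existence

variable {M : Type*} [TopologicalSpace M] [ChartedSpace (EuclideanSpace ℝ (Fin 4)) M]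
  [IsManifold (𝓡 4) ∞ M] {x : M} {g : FormField M} {N : ∀ y : M, Tetrad y}

theorem exists_diffVFAt (u : TM x) : ∃ X : ∀ y : M, TM y, DiffVFAt X x ∧ X x = u :=
  ⟨FiberBundle.extend (EuclideanSpace ℝ (Fin 4)) u, FiberBundle.mdifferentiableAt_extend .., by simp⟩

instance finiteDimensional_TM : FiniteDimensional ℝ (TM x) :=
  inferInstanceAs (FiniteDimensional ℝ (EuclideanSpace ℝ (Fin 4)))

instance t2Space_TM : T2Space (TM x) := inferInstanceAs (T2Space (EuclideanSpace ℝ (Fin 4)))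

namespace TetradFieldAt

/-- Tensoriality turns the Koszul expression into a bilinear form in X and Z. Raising the index of Z
with the tetrad yields ∇Y as an endomorphism. -/
theorem exists_leviCivita (hN : TetradFieldAt g N x) {Y : ∀ y : M, TM y} (hY : DiffVFAt Y x) :
    ∃ B : TM x →L[ℝ] TM x, ∀ X Z : ∀ y : M, TM y, DiffVFAt X x → DiffVFAt Z x →
      frameMetric g N x (B (X x)) (Z x) = leviCivita (frameMetric g N) X Y Z x := by
  have hh := hN.frameMetric_diff
  have h := hN.isNullTetrad x
  let Φ := TensorialAt.mkHom₂ (I := 𝓡 4) (F := EuclideanSpace ℝ (Fin 4))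
    (F' := EuclideanSpace ℝ (Fin 4)) (fun X Z => leviCivita (frameMetric g N) X Y Z x) x
    (fun Z hZ => leviCivita_tensorial_fst hh hY hZ) (fun X hX => leviCivita_tensorial_thd hh hX hY)
  have hΦ : ∀ X Z : ∀ y : M, TM y, DiffVFAt X x → DiffVFAt Z x →
      Φ (X x) (Z x) = leviCivita (frameMetric g N) X Y Z x := fun X Z hX hZ =>
    TensorialAt.mkHom₂_apply _ _ hX hZ
  let B : TM x →ₗ[ℝ] TM x :=
    { toFun u := Φ u (N x).n • (N x).l + Φ u (N x).l • (N x).n - (2 * Φ u (N x).m.1) • (N x).m.1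
        - (2 * Φ u (N x).m.2) • (N x).m.2
      map_add' u v := by
        simp only [map_add, add_apply]
        module
      map_smul' r u := by
        simp only [map_smul, smul_apply, smul_eq_mul, RingHom.id_apply]
        module }
  refine ⟨LinearMap.toContinuousLinearMap B, fun X Z hX hZ => ?_⟩
  rw [← hΦ X Z hX hZ]
  conv_rhs => rw [h.expand (Z x)]
  simp [B]
  ring

/-- The Levi-Civita derivative at `x` of a differentiable vector field. -/
noncomputable def lc (hN : TetradFieldAt g N x) (Y : ∀ y : M, TM y) : TM x →L[ℝ] TM x :=
  open scoped Classical in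
  -- The value 0 is a mere default: the axioms of a covariant derivative only test differentiable
  -- fields.
  if hY : DiffVFAt Y x then (hN.exists_leviCivita hY).choose else 0

variable (hN : TetradFieldAt g N x)

theorem lc_spec {X Y Z : ∀ y : M, TM y} (hX : DiffVFAt X x) (hY : DiffVFAt Y x)
    (hZ : DiffVFAt Z x) :
    frameMetric g N x (hN.lc Y (X x)) (Z x) = leviCivita (frameMetric g N) X Y Z x := by
  rw [lc, dif_pos hY]
  exact (hN.exists_leviCivita hY).choose_spec X Z hX hZ

include hN in
theorem eq_of_products {u v : TM x} (h : ∀ Z : ∀ y : M, TM y, DiffVFAt Z x →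
    frameMetric g N x u (Z x) = frameMetric g N x v (Z x)) : u = v := by
  have H := hN.isNullTetrad x
  apply H.ext_real <;> rw [H.symm _ u, H.symm _ v]
  · exact h _ hN.l
  · exact h _ hN.n
  · exact h _ hN.m.1
  · exact h _ hN.m.2

theorem lc_add {Y Y' : ∀ y : M, TM y} (hY : DiffVFAt Y x) (hY' : DiffVFAt Y' x) (u : TM x) :
    hN.lc (fun y => Y y + Y' y) u = hN.lc Y u + hN.lc Y' u := by
  obtain ⟨X, hX, rfl⟩ := exists_diffVFAt u
  refine hN.eq_of_products fun Z hZ => ?_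
  rw [map_add, add_apply, hN.lc_spec hX hY hZ, hN.lc_spec hX hY' hZ,
    hN.lc_spec hX (hY.add hY') hZ]
  exact leviCivita_add_snd hN.frameMetric_diff hX hY hY' hZ

theorem lc_smul {φ : M → ℝ} {Y : ∀ y : M, TM y} (hφ : DiffRAt φ x) (hY : DiffVFAt Y x) (u : TM x) :
    hN.lc (fun y => φ y • Y y) u = φ x • hN.lc Y u + dR φ x u • Y x := by
  obtain ⟨X, hX, rfl⟩ := exists_diffVFAt u
  refine hN.eq_of_products fun Z hZ => ?_
  simp only [map_add, add_apply, map_smul, smul_apply, smul_eq_mul]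
  rw [hN.lc_spec hX hY hZ, hN.lc_spec hX (hY.smul hφ) hZ]
  exact leviCivita_smul_snd hN.frameMetric_diff hφ hX hY hZ

theorem lc_neg {Y : ∀ y : M, TM y} (hY : DiffVFAt Y x) (u : TM x) :
    hN.lc (fun y => -Y y) u = -hN.lc Y u := by
  have := hN.lc_smul (φ := fun _ => -1) mdifferentiableAt_const hY u
  simpa [dR_const] using this

theorem lc_zero (u : TM x) : hN.lc (fun _ => 0) u = 0 := by
  have := hN.lc_smul (φ := fun _ => 0) mdifferentiableAt_const (diffVFAt_zero (x := x)) u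
  simpa [dR_const] using this

theorem lc_torsion {Y Z : ∀ y : M, TM y} (hY : DiffVFAt Y x) (hZ : DiffVFAt Z x) :
    hN.lc Z (Y x) - hN.lc Y (Z x) = VectorField.mlieBracket (𝓡 4) Y Z x := by
  refine hN.eq_of_products fun W hW => ?_
  rw [map_sub, sub_apply, hN.lc_spec hY hZ hW, hN.lc_spec hZ hY hW]
  exact leviCivita_torsion hN.frameMetric_diff Y Z W

theorem lc_metric {Y Z : ∀ y : M, TM y} (hY : DiffVFAt Y x) (hZ : DiffVFAt Z x) (u : TM x) :
    dR (fun y => frameMetric g N y (Y y) (Z y)) x u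
      = frameMetric g N x (hN.lc Y u) (Z x) + frameMetric g N x (Y x) (hN.lc Z u) := by
  obtain ⟨X, hX, rfl⟩ := exists_diffVFAt u
  rw [(hN.isNullTetrad x).symm (Y x), hN.lc_spec hX hY hZ, hN.lc_spec hX hZ hY]
  exact (leviCivita_metric hN.frameMetric_diff X Y Z).symm

end TetradFieldAt

/-- The vector dual to the form `fForm`. -/
noncomputable def fVector (g : FormField M) (N : ∀ y : M, Tetrad y) (x : M) : CTM x :=
  csmul (rho g N x) (ofReal (N x).n) + csmul (rho' g N x) (ofReal (N x).l)
    - csmul (tau g N x) (conj (N x).m) - csmul (tau' g N x) (N x).m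

theorem complexForm_fVector (g : FormField M) (N : ∀ y : M, Tetrad y) (v : CTM x) :
    complexForm (frameMetric g N x) (fVector g N x) v = cform (fForm g N x) v := by
  simp only [cform_fForm, fVector, complexForm_add_left, complexForm_sub_left,
    complexForm_csmul_left]

theorem fForm_eq_fVector (g : FormField M) (N : ∀ y : M, Tetrad y) (X : TM x) :
    fForm g N x X = complexForm (frameMetric g N x) (fVector g N x) (ofReal X) := by
  rw [complexForm_fVector, cform_ofReal (fForm_zero g N)]

theorem fForm_add (g : FormField M) (N : ∀ y : M, Tetrad y) (X Y : TM x) :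
    fForm g N x (X + Y) = fForm g N x X + fForm g N x Y := by
  simp only [fForm_eq_fVector, ofReal_add, complexForm_add_right]

theorem fForm_smul (g : FormField M) (N : ∀ y : M, Tetrad y) (r : ℝ) (X : TM x) :
    fForm g N x (r • X) = r * fForm g N x X := by
  simp only [fForm_eq_fVector, ofReal_smul, complexForm_csmul_right]

/-- The difference tensor between a Weyl connection and the Levi-Civita connection. -/
noncomputable def weylTensor (g : FormField M) (N : ∀ y : M, Tetrad y) (x : M) (V : CTM x) :
    TM x →L[ℝ] CTM x :=
  LinearMap.toContinuousLinearMap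
    { toFun X := csmul (fForm g N x X) V + csmul (cform (fForm g N x) V) (ofReal X)
        - csmul (complexForm (frameMetric g N x) V (ofReal X)) (fVector g N x)
      map_add' X Y := by
        simp only [fForm_add, ofReal_add, complexForm_add_right, add_csmul, csmul_add]
        abel
      map_smul' r X := by
        simp only [fForm_smul, ofReal_smul, complexForm_csmul_right, ← csmul_csmul]
        simp only [csmul_ofReal, csmul_real_smul, RingHom.id_apply]
        module }

/-- Swapping V and X exchanges the first two terms and fixes the third, so no torsion arises.
Against the metric the last two terms cancel and 2f remains. -/
theorem weylTensor_apply (V : CTM x) (X : TM x) : weylTensor g N x V X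
    = csmul (fForm g N x X) V + csmul (cform (fForm g N x) V) (ofReal X)
        - csmul (complexForm (frameMetric g N x) V (ofReal X)) (fVector g N x) := rfl

theorem cform_fForm_add (g : FormField M) (N : ∀ y : M, Tetrad y) (V W : CTM x) :
    cform (fForm g N x) (V + W) = cform (fForm g N x) V + cform (fForm g N x) W := by
  simp only [← complexForm_fVector, complexForm_add_right]

theorem cform_fForm_csmul (g : FormField M) (N : ∀ y : M, Tetrad y) (c : ℂ) (V : CTM x) :
    cform (fForm g N x) (csmul c V) = c * cform (fForm g N x) V := by
  simp only [← complexForm_fVector, complexForm_csmul_right]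

theorem weylTensor_add (V W : CTM x) (X : TM x) :
    weylTensor g N x (V + W) X = weylTensor g N x V X + weylTensor g N x W X := by
  simp only [weylTensor_apply, cform_fForm_add, complexForm_add_left, csmul_add, add_csmul]
  abel

theorem weylTensor_csmul (c : ℂ) (V : CTM x) (X : TM x) :
    weylTensor g N x (csmul c V) X = csmul c (weylTensor g N x V X) := by
  simp only [weylTensor_apply, cform_fForm_csmul, complexForm_csmul_left, csmul_add, csmul_sub,
    csmul_csmul, mul_comm c]

theorem weylTensor_smul (r : ℝ) (V : CTM x) (X : TM x) :
    weylTensor g N x (r • V) X = r • weylTensor g N x V X := by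
  simp only [← csmul_ofReal, weylTensor_csmul]

/-- The Weyl derivative built at each point from a tetrad field near that point. -/
noncomputable def weylDeriv {T : M → ∀ y : M, Tetrad y} (hT : ∀ x, TetradFieldAt g (T x) x) :
    CConnection M where
  -- At x only the tetrad field `T x` is used. The required properties are all statements at a
  -- single point, so different choices never have to be compared.
  toFun V x := ((hT x).lc fun y => (V y).1).prod ((hT x).lc fun y => (V y).2)
    + weylTensor g (T x) x (V x)
  isCovariantDerivativeOnUniv :=
    { add := by
        intro V W x hV hW _
        have hV := diffCVFAt_iff.2 hV
        have hW := diffCVFAt_iff.2 hW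
        ext1 X
        have e1 := (hT x).lc_add hV.1 hW.1 X
        have e2 := (hT x).lc_add hV.2 hW.2 X
        simp only [add_apply, ContinuousLinearMap.prod_apply, Pi.add_apply, Prod.fst_add,
          Prod.snd_add, weylTensor_add]
        rw [e1, e2, ← Prod.mk_add_mk]
        abel
      leibniz := by
        intro V φ x hV hφ _
        have hV := diffCVFAt_iff.2 hV
        ext1 X
        have e1 := (hT x).lc_smul hφ hV.1 X
        have e2 := (hT x).lc_smul hφ hV.2 X
        simp only [add_apply, smul_apply, ContinuousLinearMap.prod_apply, Pi.smul_apply',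
          Prod.smul_fst, Prod.smul_snd, weylTensor_smul, ContinuousLinearMap.smulRight_apply]
        rw [e1, e2]
        change _ = φ x • _ + dR φ x X • V x
        ext1 <;> simp <;> abel }

theorem weylDeriv_apply {T : M → ∀ y : M, Tetrad y} (hT : ∀ x, TetradFieldAt g (T x) x)
    (V : ∀ y : M, CTM y) (X : TM x) : weylDeriv hT V x X =
    ((hT x).lc (fun y => (V y).1) X, (hT x).lc (fun y => (V y).2) X)
      + weylTensor g (T x) x (V x) X := rfl

theorem weylDeriv_ofReal {T : M → ∀ y : M, Tetrad y} (hT : ∀ x, TetradFieldAt g (T x) x)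
    (Y : ∀ y : M, TM y) (X : TM x) : weylDeriv hT (fun y => ofReal (Y y)) x X =
    ofReal ((hT x).lc Y X) + weylTensor g (T x) x (ofReal (Y x)) X := by
  rw [weylDeriv_apply]
  congr 1
  ext1
  · rfl
  · exact (hT x).lc_zero X

theorem weylDeriv_isWeylAt {T : M → ∀ y : M, Tetrad y} (hT : ∀ x, TetradFieldAt g (T x) x) (x : M) :
    IsWeylAt (frameMetric g (T x)) (weylDeriv hT) x (fForm g (T x) x) where
  complex_linear Y Z hY hZ X := by
    have e : ((-Z x, Y x) : CTM x) = csmul Complex.I (Y x, Z x) := by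
      ext1 <;> simp [csmul]
    rw [weylDeriv_apply, weylDeriv_apply, e, weylTensor_csmul, mulI_eq, csmul_add]
    congr 1
    rw [(hT x).lc_neg hZ]
    ext1 <;> simp [csmul]
  torsion_free Y Z hY hZ := by
    have h := ((hT x).isNullTetrad x).symm
    rw [weylDeriv_ofReal, weylDeriv_ofReal, ← (hT x).lc_torsion hY hZ, ofReal_sub]
    simp only [weylTensor_apply, complexForm_ofReal, cform_ofReal (fForm_zero g _), h (Z x)]
    abel
  weyl Y Z hY hZ X := by
    have h := (hT x).isNullTetrad x
    have m := (hT x).lc_metric hY hZ X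
    rw [weylDeriv_ofReal, weylDeriv_ofReal, m]
    simp only [weylTensor_apply, complexForm_add_left, complexForm_add_right, complexForm_sub_left,
      complexForm_sub_right, complexForm_csmul_left, complexForm_csmul_right, complexForm_ofReal,
      cform_ofReal (fForm_zero g _), h.comm _ (fVector g _ x), ← fForm_eq_fVector,
      h.symm (Z x) X]
    push_cast
    ring

/-- Existence of the compatible Weyl connection. -/
theorem weylDeriv_isCompatibleWeyl {T : M → ∀ y : M, Tetrad y}
    (hT : ∀ x, TetradFieldAt g (T x) x) {J : ∀ x : M, TM x →ₗ[ℝ] CTM x}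
    (hJ : ∀ x y, J y = acs (g y) (T x y)) : IsCompatibleWeyl g J (weylDeriv hT) where
  complex_linear x := (weylDeriv_isWeylAt hT x).complex_linear
  torsion_free x := (weylDeriv_isWeylAt hT x).torsion_free
  weyl := by
    -- The Weyl form for `g` itself: `g` is l·n times the normalized metric, which subtracts d(l·n)
    -- / (2 l·n).
    let c : M → ℝ := fun x => (2 * g x (T x x).l (T x x).n)⁻¹
    let F : ∀ x : M, TM x →L[ℝ] ℂ := fun x => LinearMap.toContinuousLinearMap
      { toFun X := fForm g (T x) x X
          - ((c x * dR (fun y => g y (T x y).l (T x y).n) x X : ℝ) : ℂ)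
        map_add' X Y := by
          simp only [fForm_add, map_add]
          push_cast
          ring
        map_smul' r X := by
          simp only [fForm_smul, map_smul, smul_eq_mul, RingHom.id_apply, Complex.real_smul]
          push_cast
          ring }
    refine ⟨F, fun x _ Y Z hY hZ X => ?_⟩
    have hx := hT x
    have w := (weylDeriv_isWeylAt hT x).conformal hx.frameMetric_diff
      (hx.metric.diff _ _ hx.l hx.n) (hx.null x).ln.ne'
    have e : (fun y => g y (T x y).l (T x y).n • frameMetric g (T x) y) = g := by
      funext y
      rw [frameMetric, smul_smul, mul_inv_cancel₀ (hx.null y).ln.ne', one_smul]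
    rw [e] at w
    exact w.weyl Y Z hY hZ X
  compatible x Y hY := by
    have hx := hT x
    have h := hx.isNullTetrad x
    have hJ' : J = fun y => acs (frameMetric g (T x) y) (T x y) := by
      funext y
      rw [hJ x y, frameMetric, acs_smul_form _ (inv_ne_zero (hx.null y).ln.ne')]
    -- Each coefficient vanishes, because `fForm` takes the values ρ, ρ', τ, τ' on l, n, m, \bar m.
    have := (weylDeriv_isWeylAt hT x).ctrace_deriv_acs hx hY
    simp only [cform_fForm, h.ln, h.ll, h.nn, h.lm, h.nm, h.mm, h.mmb, h.nl, h.ml, h.mn, h.mbm,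
      h.mbmb, h.lmb, h.nmb, h.mbl, h.mbn] at this
    simp only [hJ']
    rw [this]
    ring

/-- Uniqueness of the compatible Weyl connection. -/
theorem IsCompatibleWeyl.unique {J : ∀ x : M, TM x →ₗ[ℝ] CTM x} {D D' : CConnection M}
    (hD : IsCompatibleWeyl g J D) (hD' : IsCompatibleWeyl g J D') (hN : TetradFieldAt g N x)
    (hJ : ∀ y, J y = acs (g y) (N y)) {V : ∀ y : M, CTM y} (hV : DiffCVFAt V x) :
    D' V x = D V x := by
  have hh := hN.frameMetric_diff
  have h := hN.isNullTetrad x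
  have w := hD.isWeylAt hN hJ
  have w' := hD'.isWeylAt hN hJ
  ext1 u
  obtain ⟨X, hX, rfl⟩ := exists_diffVFAt u
  have key : ∀ Z : ∀ y : M, CTM y, DiffCVFAt Z x → complexForm (frameMetric g N x) (Z x) (D' V x (X x))
      = complexForm (frameMetric g N x) (Z x) (D V x (X x)) := by
    intro Z hZ
    -- Both connections have the same Weyl form for the same metric, so the Koszul formula gives
    -- them equal products with every field.
    have e := w.leviCivitaC_eq hh hX.ofReal hV hZ
    rw [w'.leviCivitaC_eq hh hX.ofReal hV hZ] at e
    rw [h.comm (Z x), h.comm (Z x), ← cderiv_ofReal, ← cderiv_ofReal]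
    linear_combination e
  exact h.ext (key _ hN.l.ofReal) (key _ hN.n.ofReal) (key _ hN.m) (key _ hN.m.conj)

end Existence

/-! ### Adapted tetrads and dyads, and the principal bundle structure. -/

section AdaptedFrames

variable {M : Type*} [TopologicalSpace M] [ChartedSpace (EuclideanSpace ℝ (Fin 4)) M]
  [IsManifold (𝓡 4) ∞ M]
  {S : M → Type*} [∀ x, AddCommGroup (S x)] [∀ x, Module ℂ (S x)]
  [∀ x, TopologicalSpace (S x)] [TopologicalSpace (Bundle.TotalSpace SpinModel S)]
  [FiberBundle SpinModel S] {g : LorentzMetric M} {σ : SpinorStructure S g} {x : M}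

/-! ### Rescaled tetrads -/

/-- The tetrad `r l, s n, c m`. -/
noncomputable def Tetrad.scale (N : Tetrad x) (r s : ℝ) (c : ℂ) : Tetrad x := ⟨r • N.l, s • N.n, csmul c N.m⟩

theorem Tetrad.scale_scale (N : Tetrad x) (r s r' s' : ℝ) (c c' : ℂ) :
    (N.scale r s c).scale r' s' c' = N.scale (r' * r) (s' * s) (c' * c) := by
  simp [Tetrad.scale, smul_smul, csmul_csmul]

theorem Tetrad.scale_one (N : Tetrad x) : N.scale 1 1 1 = N := by
  simp [Tetrad.scale, one_csmul]

/-- The products l·n and -m·\bar m are equal and positive both before and after the rescaling. -/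
theorem IsConformalNull.scale_factors {h : TM x →L[ℝ] TM x →L[ℝ] ℝ} {N : Tetrad x}
    (hN : IsConformalNull h N) {r s : ℝ} {c : ℂ} (hN' : IsConformalNull h (N.scale r s c)) :
    0 < r * s ∧ c * (starRingEnd ℂ) c = r * s := by
  have h1 := hN'.ln
  have h2 := hN'.mm
  simp only [Tetrad.scale, map_smul, smul_apply, smul_eq_mul, conj_csmul, complexForm_csmul_left,
    complexForm_csmul_right, hN.mm] at h1 h2
  have h0 : ((h N.l N.n : ℝ) : ℂ) ≠ 0 := by exact_mod_cast hN.ln.ne'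
  refine ⟨?_, ?_⟩
  · rw [← mul_assoc, mul_comm s r] at h1
    exact pos_of_mul_pos_left h1 hN.ln.le
  · apply mul_right_cancel₀ h0
    push_cast at h2
    linear_combination -h2

theorem IsConformalNull.scale_injective {h : TM x →L[ℝ] TM x →L[ℝ] ℝ} {N : Tetrad x}
    (hN : IsConformalNull h N) {r s r' s' : ℝ} {c c' : ℂ}
    (e : N.scale r s c = N.scale r' s' c') : r = r' ∧ s = s' ∧ c = c' := by
  have h0 := hN.ln.ne'
  have el := congrArg (fun T => h T.l N.n) e
  have en := congrArg (fun T => h N.l T.n) e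
  have em := congrArg (fun T => complexForm h T.m (conj N.m)) e
  have h1 : ((h N.l N.n : ℝ) : ℂ) ≠ 0 := by exact_mod_cast h0
  simp only [Tetrad.scale, map_smul, smul_apply, smul_eq_mul, complexForm_csmul_left, hN.mm,
    mul_eq_mul_right_iff, h0, h1, or_false, neg_eq_zero] at el en em
  exact ⟨el, en, em⟩

/-! ### The tetrad of a dyad -/

theorem eq_zero_of_eq_neg_real {V : Type*} [AddCommGroup V] [Module ℝ V] {v : V} (h : v = -v) :
    v = 0 := by
  have h2 : (2 : ℝ) • v = 0 := by rw [two_smul]; nth_rewrite 2 [h]; exact add_neg_cancel v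
  exact (smul_eq_zero.1 h2).resolve_left two_ne_zero

/-- Hermiticity makes κ \bar κ its own conjugate, so `dyadTetrad` loses nothing by keeping only
first components. -/
theorem SpinorStructure.ofReal_solder (σ : SpinorStructure S g) (κ : S x) :
    ofReal (σ.solder x κ κ).1 = σ.solder x κ κ := by
  have h := congrArg Prod.snd (σ.solder_conj x κ κ)
  ext1
  · rfl
  · simp only [conj] at h
    simp only [ofReal]
    exact (eq_zero_of_eq_neg_real h).symm

theorem SpinorStructure.ε_swap (σ : SpinorStructure S g) (κ μ : S x) :
    σ.ε x μ κ = -σ.ε x κ μ := by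
  have h := σ.ε_alt x (κ + μ)
  simp only [map_add, LinearMap.add_apply, σ.ε_alt] at h
  linear_combination h

theorem SpinorStructure.solder_smul_right (σ : SpinorStructure S g) (c : ℂ) (κ μ : S x) :
    σ.solder x κ (c • μ) = csmul ((starRingEnd ℂ) c) (σ.solder x κ μ) := by
  rw [σ.solder_conj x (c • μ) κ, σ.solder_smul, conj_csmul, ← σ.solder_conj]

theorem dyadTetrad_smul (a b : ℂ) (o ι : S x) : dyadTetrad σ (a • o) (b • ι)
    = (dyadTetrad σ o ι).scale (Complex.normSq a) (Complex.normSq b) (a * (starRingEnd ℂ) b) := by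
  simp only [dyadTetrad, Tetrad.scale, σ.solder_smul, σ.solder_smul_right, csmul_csmul,
    Complex.mul_conj, csmul_ofReal]
  rfl

/-- From g = ε \bar ε one gets l·n = |ε(o, ι)|² and m·\bar m = -|ε(o, ι)|². Every other product
contains ε(o, o) or ε(ι, ι). -/
theorem dyadTetrad_conformalNull {o ι : S x} (h : σ.ε x o ι ≠ 0) :
    IsConformalNull (g.form x) (dyadTetrad σ o ι) := by
  have ln : g.form x (dyadTetrad σ o ι).l (dyadTetrad σ o ι).n = Complex.normSq (σ.ε x o ι) := by
    have := σ.isometry x o o ι ι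
    rw [← σ.ofReal_solder o, ← σ.ofReal_solder ι, complexForm_ofReal, Complex.mul_conj] at this
    exact_mod_cast this
  have sq : ∀ κ : S x, g.form x (σ.solder x κ κ).1 (σ.solder x κ κ).1 = 0 := fun κ => by
    have := σ.isometry x κ κ κ κ
    rw [← σ.ofReal_solder, complexForm_ofReal, σ.ε_alt, zero_mul] at this
    exact_mod_cast this
  refine ⟨?_, ?_, sq o, sq ι, ?_, ?_, ?_⟩
  · rw [ln]
    exact Complex.normSq_pos.2 h
  · rw [ln]
    simp only [dyadTetrad]
    rw [← σ.solder_conj, σ.isometry, σ.ε_swap o ι, map_neg, mul_neg, Complex.mul_conj]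
  · simp only [dyadTetrad]
    rw [σ.ofReal_solder, σ.isometry, σ.ε_alt, zero_mul]
  · simp only [dyadTetrad]
    rw [σ.ofReal_solder, σ.isometry, σ.ε_alt, map_zero, mul_zero]
  · simp only [dyadTetrad]
    rw [σ.isometry, σ.ε_alt, zero_mul]

variable {L : NullDirections σ}

theorem AdaptedDyad.ε_ne_zero (d : AdaptedDyad L x) : σ.ε x d.o d.ι ≠ 0 := by
  obtain ⟨r, hr, e⟩ := d.normalized
  rw [e]
  exact_mod_cast hr.ne'

/-- The null tetrad of an adapted dyad. -/
def AdaptedDyad.toAdaptedTetrad (d : AdaptedDyad L x) : AdaptedTetrad L x where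
  toTetrad := dyadTetrad σ d.o d.ι
  conformalNull := dyadTetrad_conformalNull d.ε_ne_zero
  adapted := ⟨d.o, d.o_mem, d.ι, d.ι_mem, 1, 1, 1, by simp, by simp, by simp [one_csmul]⟩

theorem AdaptedDyad.o_ne_zero (d : AdaptedDyad L x) : d.o ≠ 0 := fun h =>
  d.ε_ne_zero (by simp [h])

theorem AdaptedDyad.ι_ne_zero (d : AdaptedDyad L x) : d.ι ≠ 0 := fun h =>
  d.ε_ne_zero (by simp [h])

theorem eq_smul_of_mem_span {V : Type*} [AddCommGroup V] [Module ℂ V] {u v w : V}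
    (hu : u ∈ Submodule.span ℂ {w}) (hv : v ∈ Submodule.span ℂ {w}) (h0 : u ≠ 0) :
    ∃ a : ℂ, v = a • u := by
  obtain ⟨a, rfl⟩ := Submodule.mem_span_singleton.1 hu
  obtain ⟨b, rfl⟩ := Submodule.mem_span_singleton.1 hv
  have ha : a ≠ 0 := fun h => h0 (by simp [h])
  exact ⟨b / a, by rw [smul_smul, div_mul_cancel₀ _ ha]⟩

/-- At each point the two null directions are complex lines, spanned by the nonzero members of `d`.
-/
theorem AdaptedDyad.exists_smul (d : AdaptedDyad L x) {o ι : S x} (ho : o ∈ L.L₀ x)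
    (hι : ι ∈ L.L₁ x) : ∃ a b : ℂ, o = a • d.o ∧ ι = b • d.ι := by
  obtain ⟨U, o₁, ι₁, -, hx, -, -, h⟩ := L.exists_dyad x
  obtain ⟨h₀, h₁, -⟩ := h x hx
  have o₂ := d.o_mem
  have ι₂ := d.ι_mem
  rw [h₀] at ho o₂
  rw [h₁] at hι ι₂
  obtain ⟨a, ha⟩ := eq_smul_of_mem_span o₂ ho d.o_ne_zero
  obtain ⟨b, hb⟩ := eq_smul_of_mem_span ι₂ hι d.ι_ne_zero
  exact ⟨a, b, ha, hb⟩

theorem AdaptedDyad.exists_scale (d : AdaptedDyad L x) (N : AdaptedTetrad L x) :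
    ∃ r s c, N.toTetrad = (dyadTetrad σ d.o d.ι).scale r s c := by
  obtain ⟨o, ho, ι, hι, r, s, c, hl, hn, hm⟩ := N.adapted
  obtain ⟨a, b, rfl, rfl⟩ := d.exists_smul ho hι
  rw [dyadTetrad_smul] at hl hn hm
  refine ⟨r * Complex.normSq a, s * Complex.normSq b, c * (a * (starRingEnd ℂ) b), ?_⟩
  rw [← Tetrad.scale_scale]
  exact Tetrad.ext hl hn hm

/-- Two adapted tetrads at a point differ by a rescaling. -/
theorem AdaptedTetrad.exists_scale (N N' : AdaptedTetrad L x) :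
    ∃ r s c, N'.toTetrad = N.toTetrad.scale r s c := by
  obtain ⟨d⟩ := L.nonempty_dyad x
  obtain ⟨r, s, c, h⟩ := d.exists_scale N
  obtain ⟨r', s', c', h'⟩ := d.exists_scale N'
  have hd : IsConformalNull (g.form x) (dyadTetrad σ d.o d.ι) :=
    d.toAdaptedTetrad.conformalNull
  obtain ⟨h1, h2⟩ := hd.scale_factors (h ▸ N.conformalNull)
  have hr := left_ne_zero_of_mul h1.ne'
  have hs := right_ne_zero_of_mul h1.ne'
  have hc : c ≠ 0 := by
    rintro rfl
    rw [zero_mul] at h2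
    exact h1.ne (by exact_mod_cast h2)
  refine ⟨r' / r, s' / s, c' / c, ?_⟩
  rw [h, h', Tetrad.scale_scale, div_mul_cancel₀ _ hr, div_mul_cancel₀ _ hs,
    div_mul_cancel₀ _ hc]

/-- The dyad chosen in the definition of `J` is immaterial: adapted tetrads differ by rescalings,
which `acs` does not see. -/
theorem NullDirections.J_eq (L : NullDirections σ) (N : AdaptedTetrad L x) :
    L.J x = acs (g.form x) N.toTetrad := by
  let d : AdaptedDyad L x := Classical.choice (L.nonempty_dyad x)
  obtain ⟨r, s, c, h⟩ := d.toAdaptedTetrad.exists_scale N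
  obtain ⟨h1, h2⟩ := d.toAdaptedTetrad.conformalNull.scale_factors (h ▸ N.conformalNull)
  rw [h, Tetrad.scale, acs_scale _ _ h1.ne' h2]
  rfl

/-! ### Smooth adapted frames -/

theorem SmoothVF.diffVFAt {X : ∀ y : M, TM y} {U : Set M} (hX : SmoothVF X U) (hU : IsOpen U)
    (hx : x ∈ U) : DiffVFAt X x :=
  (hX.contMDiffAt (hU.mem_nhds hx)).mdifferentiableAt (by simp)

theorem SmoothVF.const_smul {X : ∀ y : M, TM y} {U : Set M} (hX : SmoothVF X U) (c : ℝ) :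
    SmoothVF (fun y => c • X y) U := ContMDiffOn.smul_section contMDiffOn_const hX

theorem SmoothVF.add {X Y : ∀ y : M, TM y} {U : Set M} (hX : SmoothVF X U) (hY : SmoothVF Y U) :
    SmoothVF (fun y => X y + Y y) U := ContMDiffOn.add_section hX hY

theorem SmoothVF.sub {X Y : ∀ y : M, TM y} {U : Set M} (hX : SmoothVF X U) (hY : SmoothVF Y U) :
    SmoothVF (fun y => X y - Y y) U := ContMDiffOn.sub_section hX hY

theorem SmoothVF.neg {X : ∀ y : M, TM y} {U : Set M} (hX : SmoothVF X U) :
    SmoothVF (fun y => -X y) U := ContMDiffOn.neg_section hX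

theorem tetradFieldAt_of_smoothOn {w₀ w₁ : ℝ} {U : Set M} {N : ∀ y, AdaptedTetrad L y}
    (hU : IsOpen U) (hN : (tetradBundle L w₀ w₁).SmoothOn N U) (hx : x ∈ U) :
    TetradFieldAt g.form ((tetradBundle L w₀ w₁).field N) x where
  metric := g.formDiffAt x
  null y := (N y).conformalNull
  l := hN.1.diffVFAt hU hx
  n := hN.2.1.diffVFAt hU hx
  m := ⟨hN.2.2.1.diffVFAt hU hx, hN.2.2.2.diffVFAt hU hx⟩

theorem toAdaptedTetrad_smoothOn {w₀ w₁ : ℝ} {U : Set M} {d : ∀ y, AdaptedDyad L y}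
    (hU : IsOpen U) (hd : (dyadBundle L w₀ w₁).SmoothOn d U) :
    (tetradBundle L w₀ w₁).SmoothOn (fun y => (d y).toAdaptedTetrad) U :=
  ⟨(σ.smooth_solder U _ _ hU hd.1 hd.1).1, (σ.smooth_solder U _ _ hU hd.2 hd.2).1,
    σ.smooth_solder U _ _ hU hd.1 hd.2⟩

theorem exists_smoothOn_dyad (L : NullDirections σ) (w₀ w₁ : ℝ) (x : M) :
    ∃ (U : Set M) (d : ∀ y, AdaptedDyad L y), IsOpen U ∧ x ∈ U ∧
      (dyadBundle L w₀ w₁).SmoothOn d U := by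
  classical
  obtain ⟨U, o, ι, hU, hx, ho, hι, h⟩ := L.exists_dyad x
  -- Sections are total functions; off `U` an arbitrary adapted dyad fills in.
  let d : ∀ y, AdaptedDyad L y := fun y =>
    if hy : y ∈ U then
      ⟨o y, ι y, (h y hy).1 ▸ Submodule.mem_span_singleton_self _,
        (h y hy).2.1 ▸ Submodule.mem_span_singleton_self _, 1, one_pos, by simpa using (h y hy).2.2⟩
    else Classical.choice (L.nonempty_dyad y)
  refine ⟨U, d, hU, hx, ho.congr fun y hy => ?_, hι.congr fun y hy => ?_⟩ <;> simp [d, hy]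

theorem exists_tetradFieldAt (L : NullDirections σ) (x : M) : ∃ T : ∀ y : M, Tetrad y,
    TetradFieldAt g.form T x ∧ ∀ y, L.J y = acs (g.form y) (T y) := by
  -- Smoothness of a section does not involve the weights, so any values serve.
  obtain ⟨U, d, hU, hx, hd⟩ := exists_smoothOn_dyad L 0 0 x
  exact ⟨_, tetradFieldAt_of_smoothOn hU (toAdaptedTetrad_smoothOn hU hd) hx,
    fun y => L.J_eq (d y).toAdaptedTetrad⟩

/-! ### The reduced bundles are principal -/

theorem AdaptedTetrad.act_toTetrad (w₀ w₁ : ℝ) (N : AdaptedTetrad L x) (γ : GHPGroup) :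
    (N.act w₀ w₁ γ).toTetrad = N.toTetrad.scale ((γ.2.2 : ℝ) ^ (2 * w₀) * (γ.1 : ℝ))
      ((γ.2.2 : ℝ) ^ (2 * w₁) * (γ.1 : ℝ)⁻¹) (((γ.2.2 : ℝ) ^ (w₀ + w₁) : ℝ) * (γ.2.1 : ℂ)) := rfl

theorem AdaptedTetrad.ext_toTetrad {N N' : AdaptedTetrad L x} (h : N.toTetrad = N'.toTetrad) :
    N = N' := by
  cases N
  cases N'
  cases h
  rfl

theorem AdaptedTetrad.act_one (w₀ w₁ : ℝ) (N : AdaptedTetrad L x) : N.act w₀ w₁ 1 = N := by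
  apply AdaptedTetrad.ext_toTetrad
  rw [AdaptedTetrad.act_toTetrad]
  simp [Tetrad.scale_one]

theorem AdaptedTetrad.act_mul (w₀ w₁ : ℝ) (N : AdaptedTetrad L x) (γ γ' : GHPGroup) :
    (N.act w₀ w₁ γ).act w₀ w₁ γ' = N.act w₀ w₁ (γ * γ') := by
  apply AdaptedTetrad.ext_toTetrad
  have h := γ.2.2.2.le
  have h' := γ'.2.2.2.le
  simp only [AdaptedTetrad.act_toTetrad, Tetrad.scale_scale, Prod.snd_mul, Prod.fst_mul,
    Positive.val_mul, Real.mul_rpow h h', Units.val_mul, Circle.coe_mul, mul_inv,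
    Complex.ofReal_mul]
  congr 1 <;> ring

/-- The factors of l and n multiply to Ω^{2(w₀ + w₁)} = Ω^{-2}. This determines Ω, after which a and
z can be cancelled out. -/
theorem AdaptedTetrad.act_injective {w₀ w₁ : ℝ} (hw : w₀ + w₁ + 1 = 0) (N : AdaptedTetrad L x)
    {γ γ' : GHPGroup} (h : N.act w₀ w₁ γ = N.act w₀ w₁ γ') : γ = γ' := by
  have e := congrArg AdaptedTetrad.toTetrad h
  rw [AdaptedTetrad.act_toTetrad, AdaptedTetrad.act_toTetrad] at e
  obtain ⟨h1, h2, h3⟩ := N.conformalNull.scale_injective e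
  have key : ∀ γ : GHPGroup, (γ.2.2 : ℝ) ^ (2 * w₀) * (γ.1 : ℝ) *
      ((γ.2.2 : ℝ) ^ (2 * w₁) * (γ.1 : ℝ)⁻¹) = (γ.2.2 : ℝ) ^ (-2 : ℝ) := fun γ => by
    rw [mul_mul_mul_comm, mul_inv_cancel₀ γ.1.ne_zero, mul_one, ← Real.rpow_add γ.2.2.2]
    congr 1
    linarith
  have k : (γ.2.2 : ℝ) ^ (-2 : ℝ) = (γ'.2.2 : ℝ) ^ (-2 : ℝ) := by
    rw [← key, ← key, h1, h2]
  have eΩ : (γ.2.2 : ℝ) = γ'.2.2 :=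
    (Real.rpow_left_inj γ.2.2.2.le γ'.2.2.2.le (by norm_num)).1 k
  rw [eΩ] at h1 h3
  have p1 : (γ'.2.2 : ℝ) ^ (2 * w₀) ≠ 0 := (Real.rpow_pos_of_pos γ'.2.2.2 _).ne'
  have p2 : (((γ'.2.2 : ℝ) ^ (w₀ + w₁) : ℝ) : ℂ) ≠ 0 := by
    exact_mod_cast (Real.rpow_pos_of_pos γ'.2.2.2 _).ne'
  exact Prod.ext (Units.ext (mul_left_cancel₀ p1 h1))
    (Prod.ext (Subtype.ext (mul_left_cancel₀ p2 h3)) (Subtype.ext eΩ))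

theorem AdaptedTetrad.exists_act {w₀ w₁ : ℝ} (hw : w₀ + w₁ + 1 = 0) (N N' : AdaptedTetrad L x) :
    ∃ γ : GHPGroup, N' = N.act w₀ w₁ γ := by
  obtain ⟨r, s, c, h⟩ := N.exists_scale N'
  obtain ⟨h1, h2⟩ := N.conformalNull.scale_factors (h ▸ N'.conformalNull)
  have hr := left_ne_zero_of_mul h1.ne'
  -- The factors of l and n must multiply to Ω^{-2} = r s, which forces this Ω.
  have hΩ : 0 < (r * s) ^ (-(1 / 2) : ℝ) := Real.rpow_pos_of_pos h1 _
  set Ω : ℝ := (r * s) ^ (-(1 / 2) : ℝ) with hΩ'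
  have sq : Ω ^ 2 = (r * s)⁻¹ := by
    rw [hΩ', ← Real.rpow_natCast, ← Real.rpow_mul h1.le]
    norm_num [Real.rpow_neg_one]
  have p0 := Real.rpow_pos_of_pos hΩ (2 * w₀)
  -- The phase is c Ω, of modulus one since |c|² = r s = Ω^{-2}.
  have hz : c * Ω ∈ Submonoid.unitSphere ℂ := by
    refine mem_sphere_zero_iff_norm.2 ?_
    have : ‖c * Ω‖ ^ 2 = 1 := by
      rw [← Complex.normSq_eq_norm_sq, Complex.normSq_mul, Complex.normSq_ofReal, ← pow_two, sq]
      rw [Complex.mul_conj] at h2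
      have h2' : Complex.normSq c = r * s := by exact_mod_cast h2
      rw [h2', mul_inv_cancel₀ h1.ne']
    exact (pow_eq_one_iff_of_nonneg (norm_nonneg _) two_ne_zero).1 this
  refine ⟨(Units.mk0 (r * (Ω ^ (2 * w₀))⁻¹) (mul_ne_zero hr (inv_ne_zero p0.ne')),
    ⟨c * Ω, hz⟩, ⟨Ω, hΩ⟩), AdaptedTetrad.ext_toTetrad ?_⟩
  rw [h, AdaptedTetrad.act_toTetrad]
  congr 1
  · simp only [Units.val_mk0]
    field_simp
  · simp only [Units.val_mk0, mul_inv, inv_inv]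
    have : Ω ^ (2 * w₁) * Ω ^ (2 * w₀) = (Ω ^ 2)⁻¹ := by
      rw [← Real.rpow_add hΩ, ← Real.rpow_natCast, ← Real.rpow_neg hΩ.le]
      congr 1
      push_cast
      linarith
    rw [mul_left_comm, this, sq]
    field_simp
  · have : Ω ^ (w₀ + w₁) = Ω⁻¹ := by
      rw [← Real.rpow_neg_one]
      congr 1
      linarith
    have h0 : (Ω : ℂ) ≠ 0 := by exact_mod_cast hΩ.ne'
    simp only [this]
    push_cast
    field_simp

theorem smoothOn_act_tetrad {w₀ w₁ : ℝ} {U : Set M} {N : ∀ y, AdaptedTetrad L y}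
    (hN : (tetradBundle L w₀ w₁).SmoothOn N U) (γ : GHPGroup) :
    (tetradBundle L w₀ w₁).SmoothOn (fun y => (N y).act w₀ w₁ γ) U :=
  ⟨hN.1.const_smul _, hN.2.1.const_smul _,
    (hN.2.2.1.const_smul _).sub (hN.2.2.2.const_smul _),
    (hN.2.2.2.const_smul _).add (hN.2.2.1.const_smul _)⟩

theorem tetradBundle_isPrincipal (L : NullDirections σ) {w₀ w₁ : ℝ} (hw : w₀ + w₁ + 1 = 0) :
    (tetradBundle L w₀ w₁).IsPrincipal where
  act_one _ N := N.act_one w₀ w₁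
  act_mul _ N γ γ' := N.act_mul w₀ w₁ γ γ'
  simply_transitive _ N N' := by
    obtain ⟨γ, h⟩ := AdaptedTetrad.exists_act hw N N'
    exact ⟨γ, h, fun γ' h' => N.act_injective hw (h'.symm.trans h)⟩
  local_section x N := by
    -- A smooth local frame is moved by the constant group element that carries it to `N` at x.
    obtain ⟨U, d, hU, hx, hd⟩ := exists_smoothOn_dyad L w₀ w₁ x
    obtain ⟨γ, h⟩ := AdaptedTetrad.exists_act hw (d x).toAdaptedTetrad N
    exact ⟨U, fun y => (d y).toAdaptedTetrad.act w₀ w₁ γ, hU, hx,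
      smoothOn_act_tetrad (toAdaptedTetrad_smoothOn hU hd) γ, h.symm⟩

theorem AdaptedDyad.act_one (w₀ w₁ : ℝ) (d : AdaptedDyad L x) : d.act w₀ w₁ 1 = d := by
  ext1 <;> simp [AdaptedDyad.act]

theorem AdaptedDyad.act_mul (w₀ w₁ : ℝ) (d : AdaptedDyad L x) (γ γ' : SpinGHPGroup) :
    (d.act w₀ w₁ γ).act w₀ w₁ γ' = d.act w₀ w₁ (γ * γ') := by
  have h := γ.2.2.le
  have h' := γ'.2.2.le
  ext1 <;> simp only [AdaptedDyad.act, smul_smul, Prod.snd_mul, Prod.fst_mul, Positive.val_mul,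
    Real.mul_rpow h h', Units.val_mul, mul_inv, Complex.ofReal_mul] <;> congr 1 <;> ring

/-- The product ε(o, ι) is multiplied by Ω^{w₀ + w₁} = Ω^{-1}, so the two normalizations force Ω = r
/ r'. The factor of o then fixes λ, and the factor of ι is consistent because a b = r' / r. -/
theorem AdaptedDyad.exists_act {w₀ w₁ : ℝ} (hw : w₀ + w₁ + 1 = 0) (d d' : AdaptedDyad L x) :
    ∃! γ : SpinGHPGroup, d' = d.act w₀ w₁ γ := by
  obtain ⟨a, b, ha, hb⟩ := d.exists_smul d'.o_mem d'.ι_mem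
  obtain ⟨r, hr, e⟩ := d.normalized
  obtain ⟨r', hr', e'⟩ := d'.normalized
  have hrC : (r : ℂ) ≠ 0 := by exact_mod_cast hr.ne'
  have hr'C : (r' : ℂ) ≠ 0 := by exact_mod_cast hr'.ne'
  have hab : a * b = (r' : ℂ) / r := by
    rw [ha, hb] at e'
    simp only [map_smul, LinearMap.smul_apply, smul_eq_mul, e] at e'
    field_simp
    linear_combination e'
  have ha0 : a ≠ 0 := fun h => d'.o_ne_zero (by rw [ha, h, zero_smul])
  have hΩ : 0 < r / r' := div_pos hr hr'
  have key : ∀ Ω : ℝ, 0 < Ω → Ω ^ w₀ * Ω ^ w₁ = Ω⁻¹ := fun Ω h => by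
    rw [← Real.rpow_add h, ← Real.rpow_neg_one]
    congr 1
    linarith
  refine ⟨(Units.mk0 (a * (((r / r') ^ w₀ : ℝ) : ℂ)⁻¹) (mul_ne_zero ha0 (inv_ne_zero
    (by exact_mod_cast (Real.rpow_pos_of_pos hΩ _).ne'))), ⟨r / r', hΩ⟩), ?_, ?_⟩
  · have p0 : (((r / r') ^ w₀ : ℝ) : ℂ) ≠ 0 := by
      exact_mod_cast (Real.rpow_pos_of_pos hΩ _).ne'
    have k : (((r / r') ^ w₀ : ℝ) : ℂ) * (((r / r') ^ w₁ : ℝ) : ℂ) = a * b := by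
      rw [← Complex.ofReal_mul, key _ hΩ, hab]
      push_cast
      rw [inv_div]
    ext1
    · simp only [AdaptedDyad.act, Units.val_mk0]
      rw [ha]
      congr 1
      field_simp
    · simp only [AdaptedDyad.act, Units.val_mk0, mul_inv, inv_inv]
      rw [hb]
      congr 1
      field_simp
      linear_combination -k
  · rintro γ h
    have ho : a • d.o = _ := ha.symm.trans (congrArg AdaptedDyad.o h)
    have hι : b • d.ι = _ := hb.symm.trans (congrArg AdaptedDyad.ι h)
    have ho' := smul_left_injective ℂ d.o_ne_zero ho
    have hι' := smul_left_injective ℂ d.ι_ne_zero hι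
    have h1 : (γ.1 : ℂ) ≠ 0 := γ.1.ne_zero
    have hΩ' : (γ.2 : ℝ) = r / r' := by
      have : ((γ.2 : ℝ) : ℂ)⁻¹ = (r' : ℂ) / r := by
        rw [← hab, ho', hι', ← Complex.ofReal_inv, ← key _ γ.2.2]
        push_cast
        field_simp
      rw [← inv_inv ((γ.2 : ℝ)), ← inv_div r' r]
      congr 1
      exact_mod_cast this
    have p0 : (((r / r') ^ w₀ : ℝ) : ℂ) ≠ 0 := by
      exact_mod_cast (Real.rpow_pos_of_pos hΩ _).ne'
    refine Prod.ext (Units.ext ?_) (Subtype.ext hΩ')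
    rw [hΩ'] at ho'
    simp only [Units.val_mk0]
    rw [ho']
    field_simp

variable [VectorBundle ℝ SpinModel S] [ContMDiffVectorBundle ∞ SpinModel S (𝓡 4)]

/-- The spinor bundle is a smooth vector bundle over ℝ only; complex multiples are assembled with
`smooth_I`. -/
theorem SmoothSpinor.const_smul (σ : SpinorStructure S g) {s : ∀ y, S y} {U : Set M}
    (hU : IsOpen U) (hs : SmoothSpinor s U) (c : ℂ) : SmoothSpinor (fun y => c • s y) U := by
  have h1 : SmoothSpinor (fun y => c.re • s y) U := ContMDiffOn.smul_section contMDiffOn_const hs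
  have h2 : SmoothSpinor (fun y => c.im • (Complex.I • s y)) U :=
    ContMDiffOn.smul_section contMDiffOn_const (σ.smooth_I U s hU hs)
  have h3 : SmoothSpinor (fun y => c.re • s y + c.im • (Complex.I • s y)) U :=
    ContMDiffOn.add_section h1 h2
  refine ContMDiffOn.congr h3 fun y _ => ?_
  congr 1
  show c • s y = c.re • s y + c.im • (Complex.I • s y)
  rw [← Complex.coe_smul c.re, ← Complex.coe_smul c.im, smul_smul, ← add_smul, Complex.re_add_im]

theorem smoothOn_act_dyad {w₀ w₁ : ℝ} {U : Set M} (hU : IsOpen U) {d : ∀ y, AdaptedDyad L y}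
    (hd : (dyadBundle L w₀ w₁).SmoothOn d U) (γ : SpinGHPGroup) :
    (dyadBundle L w₀ w₁).SmoothOn (fun y => (d y).act w₀ w₁ γ) U :=
  ⟨hd.1.const_smul σ hU _, hd.2.const_smul σ hU _⟩

theorem dyadBundle_isPrincipal (L : NullDirections σ) {w₀ w₁ : ℝ} (hw : w₀ + w₁ + 1 = 0) :
    (dyadBundle L w₀ w₁).IsPrincipal where
  act_one _ d := d.act_one w₀ w₁
  act_mul _ d γ γ' := d.act_mul w₀ w₁ γ γ'
  simply_transitive _ d d' := AdaptedDyad.exists_act hw d d'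
  local_section x d := by
    obtain ⟨U, s, hU, hx, hs⟩ := exists_smoothOn_dyad L w₀ w₁ x
    obtain ⟨γ, h, -⟩ := AdaptedDyad.exists_act hw (s x) d
    exact ⟨U, fun y => (s y).act w₀ w₁ γ, hU, hx, smoothOn_act_dyad hU hs γ, h.symm⟩

end AdaptedFrames

/-! ### Logarithmic differentials. -/

section LogarithmicDerivative

variable {M : Type*} [TopologicalSpace M] [ChartedSpace (EuclideanSpace ℝ (Fin 4)) M]
  [IsManifold (𝓡 4) ∞ M] {x : M}

theorem mvfderiv_comp_of_hasFDerivAt {F F' : Type*} [NormedAddCommGroup F] [NormedSpace ℝ F]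
    [NormedAddCommGroup F'] [NormedSpace ℝ F'] {φ : M → F}
    (hφ : MDifferentiableAt (𝓡 4) 𝓘(ℝ, F) φ x) {T : F → F'} {T' : F →L[ℝ] F'}
    (hT : HasFDerivAt T T' (φ x)) :
    MDifferentiableAt (𝓡 4) 𝓘(ℝ, F') (fun y => T (φ y)) x ∧
      ∀ X : TM x, mvfderiv (𝓡 4) (fun y => T (φ y)) x X = T' (mvfderiv (𝓡 4) φ x X) := by
  have h := hT.hasMFDerivAt.comp x hφ.hasMFDerivAt
  refine ⟨h.mdifferentiableAt, fun X => ?_⟩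
  unfold mvfderiv
  change NormedSpace.fromTangentSpace _ (mfderiv (𝓡 4) 𝓘(ℝ, F') (T ∘ φ) x X) = _
  rw [h.mfderiv]
  rfl

theorem DiffCAt.comp_hasDerivAt {φ : M → ℂ} (hφ : DiffCAt φ x) {T : ℂ → ℂ} {T' : ℂ}
    (hT : HasDerivAt T T' (φ x)) : DiffCAt (fun y => T (φ y)) x ∧
      ∀ X : TM x, dC (fun y => T (φ y)) x X = T' * dC φ x X := by
  obtain ⟨h1, h2⟩ := mvfderiv_comp_of_hasFDerivAt hφ (hT.hasFDerivAt.restrictScalars ℝ)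
  exact ⟨h1, fun X => (h2 X).trans (by simp [dC, mul_comm])⟩

theorem DiffRAt.comp_hasDerivAt {φ : M → ℝ} (hφ : DiffRAt φ x) {T : ℝ → ℝ} {T' : ℝ}
    (hT : HasDerivAt T T' (φ x)) : DiffRAt (fun y => T (φ y)) x ∧
      ∀ X : TM x, dR (fun y => T (φ y)) x X = T' * dR φ x X := by
  obtain ⟨h1, h2⟩ := mvfderiv_comp_of_hasFDerivAt hφ hT.hasFDerivAt
  exact ⟨h1, fun X => (h2 X).trans (by simp [dR, mul_comm])⟩

theorem DiffRAt.ofReal {φ : M → ℝ} (hφ : DiffRAt φ x) : DiffCAt (fun y => (φ y : ℂ)) x :=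
  Complex.ofRealCLM.mdifferentiableAt.comp x hφ

theorem DiffCAt.star {φ : M → ℂ} (hφ : DiffCAt φ x) :
    DiffCAt (fun y => (starRingEnd ℂ) (φ y)) x :=
  Complex.conjCLE.toContinuousLinearMap.mdifferentiableAt.comp x hφ

theorem DiffCAt.mul {φ ψ : M → ℂ} (hφ : DiffCAt φ x) (hψ : DiffCAt ψ x) :
    DiffCAt (fun y => φ y * ψ y) x := MDifferentiableAt.mul hφ hψ

theorem dC_mul {φ ψ : M → ℂ} (hφ : DiffCAt φ x) (hψ : DiffCAt ψ x) (X : TM x) :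
    dC (fun y => φ y * ψ y) x X = φ x * dC ψ x X + ψ x * dC φ x X := by
  have h := mvfderiv_comp_of_hasFDerivAt (hφ.prodMk_space hψ) (T := fun p : ℂ × ℂ => p.1 * p.2)
    (hasFDerivAt_fst.mul hasFDerivAt_snd)
  have h1 := mvfderiv_clm_comp (hφ.prodMk_space hψ) (ContinuousLinearMap.fst ℝ ℂ ℂ) X
  have h2 := mvfderiv_clm_comp (hφ.prodMk_space hψ) (ContinuousLinearMap.snd ℝ ℂ ℂ) X
  refine (h.2 X).trans ?_
  simp only [add_apply, smul_apply, smul_eq_mul, ← h1, ← h2]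
  rfl

/-- The logarithmic differential of a complex function. -/
noncomputable def dLog (φ : M → ℂ) (x : M) (X : TM x) : ℂ := (φ x)⁻¹ * dC φ x X

theorem mul_dLog {φ : M → ℂ} (h0 : φ x ≠ 0) (X : TM x) : φ x * dLog φ x X = dC φ x X := by
  rw [dLog, mul_inv_cancel_left₀ h0]

theorem dLog_mul {φ ψ : M → ℂ} (hφ : DiffCAt φ x) (hψ : DiffCAt ψ x) (h0 : φ x ≠ 0)
    (h0' : ψ x ≠ 0) (X : TM x) :
    dLog (fun y => φ y * ψ y) x X = dLog φ x X + dLog ψ x X := by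
  simp only [dLog, dC_mul hφ hψ]
  field_simp
  ring

theorem DiffCAt.inv {φ : M → ℂ} (hφ : DiffCAt φ x) (h0 : φ x ≠ 0) :
    DiffCAt (fun y => (φ y)⁻¹) x := (hφ.comp_hasDerivAt (hasDerivAt_inv h0)).1

theorem dLog_inv {φ : M → ℂ} (hφ : DiffCAt φ x) (h0 : φ x ≠ 0) (X : TM x) :
    dLog (fun y => (φ y)⁻¹) x X = -dLog φ x X := by
  simp only [dLog, (hφ.comp_hasDerivAt (hasDerivAt_inv h0)).2]
  field_simp

/-- Links the gauge terms written as a da⁻¹ with `dLog`. -/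
theorem mul_dC_inv {φ : M → ℂ} (hφ : DiffCAt φ x) (h0 : φ x ≠ 0) (X : TM x) :
    φ x * dC (fun y => (φ y)⁻¹) x X = -dLog φ x X := by
  rw [← dLog_inv hφ h0]
  simp [dLog]

theorem DiffCAt.zpow {φ : M → ℂ} (hφ : DiffCAt φ x) (h0 : φ x ≠ 0) (n : ℤ) :
    DiffCAt (fun y => φ y ^ n) x := (hφ.comp_hasDerivAt (hasDerivAt_zpow n _ (Or.inl h0))).1

theorem dLog_zpow {φ : M → ℂ} (hφ : DiffCAt φ x) (h0 : φ x ≠ 0) (n : ℤ) (X : TM x) :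
    dLog (fun y => φ y ^ n) x X = n * dLog φ x X := by
  simp only [dLog, (hφ.comp_hasDerivAt (hasDerivAt_zpow n _ (Or.inl h0))).2, zpow_sub_one₀ h0]
  have := zpow_ne_zero n h0
  field_simp

theorem DiffRAt.rpow {φ : M → ℝ} (hφ : DiffRAt φ x) (h0 : 0 < φ x) (w : ℝ) :
    DiffRAt (fun y => φ y ^ w) x :=
  (hφ.comp_hasDerivAt (Real.hasDerivAt_rpow_const (Or.inl h0.ne'))).1

theorem dLog_rpow {φ : M → ℝ} (hφ : DiffRAt φ x) (h0 : 0 < φ x) (w : ℝ) (X : TM x) :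
    dLog (fun y => ((φ y ^ w : ℝ) : ℂ)) x X = w * dLog (fun y => (φ y : ℂ)) x X := by
  have hd := hφ.comp_hasDerivAt (Real.hasDerivAt_rpow_const (p := w) (Or.inl h0.ne'))
  simp only [dLog, dC_ofReal hφ, dC_ofReal hd.1, hd.2, Real.rpow_sub_one h0.ne']
  have := (Real.rpow_pos_of_pos h0 w).ne'
  push_cast
  have h1 : ((φ x ^ w : ℝ) : ℂ) ≠ 0 := by exact_mod_cast this
  have h2 : (φ x : ℂ) ≠ 0 := by exact_mod_cast h0.ne'
  field_simp

end LogarithmicDerivative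

/-! ### Gauge behaviour of the connection form. -/

section Gauge

variable {M : Type*} [TopologicalSpace M] [ChartedSpace (EuclideanSpace ℝ (Fin 4)) M]
  [IsManifold (𝓡 4) ∞ M] {x : M}

/-- Differentiability at `x` of a function with values in the GHP-conformal group. -/
structure DiffGaugeAt (γ : M → GHPGroup) (x : M) : Prop where
  a : DiffRAt (fun y => ((γ y).1 : ℝ)) x
  z : DiffCAt (fun y => ((γ y).2.1 : ℂ)) x
  Ω : DiffRAt (fun y => ((γ y).2.2 : ℝ)) x

theorem SmoothGauge.diffGaugeAt {γ : M → GHPGroup} {U : Set M} (hγ : SmoothGauge γ U)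
    (hU : IsOpen U) (hx : x ∈ U) : DiffGaugeAt γ x where
  a := (hγ.1.contMDiffAt (hU.mem_nhds hx)).mdifferentiableAt (by simp)
  z := (hγ.2.1.contMDiffAt (hU.mem_nhds hx)).mdifferentiableAt (by simp)
  Ω := (hγ.2.2.contMDiffAt (hU.mem_nhds hx)).mdifferentiableAt (by simp)

/-- The action of the GHP-conformal group on tetrads. -/
noncomputable def Tetrad.act (w₀ w₁ : ℝ) (N : Tetrad x) (γ : GHPGroup) : Tetrad x :=
  N.scale ((γ.2.2 : ℝ) ^ (2 * w₀) * (γ.1 : ℝ)) ((γ.2.2 : ℝ) ^ (2 * w₁) * (γ.1 : ℝ)⁻¹)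
    (((γ.2.2 : ℝ) ^ (w₀ + w₁) : ℝ) * (γ.2.1 : ℂ))

theorem Tetrad.act_leg (w₀ w₁ : ℝ) (N : Tetrad x) (γ : GHPGroup) (j : Fin 4) :
    (N.act w₀ w₁ γ).leg j = csmul (legFactor w₀ w₁ j γ) (N.leg j) := by
  fin_cases j <;> simp [Tetrad.leg, Tetrad.act, Tetrad.scale, legFactor, ofReal_smul, conj_csmul]

/-- The factor by which l·n, and with it the normalization of the metric, changes. -/
theorem legFactor_zero_mul_one (w₀ w₁ : ℝ) (γ : GHPGroup) :
    (γ.2.2 : ℝ) ^ (2 * w₀) * (γ.1 : ℝ) * ((γ.2.2 : ℝ) ^ (2 * w₁) * (γ.1 : ℝ)⁻¹)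
      = ((γ.2.2 : ℝ) ^ (w₀ + w₁)) ^ 2 := by
  rw [mul_mul_mul_comm, mul_inv_cancel₀ γ.1.ne_zero, mul_one, ← Real.rpow_add γ.2.2.2,
    ← Real.rpow_mul_natCast γ.2.2.2.le]
  congr 1
  push_cast
  ring

theorem circle_mul_conj (z : Circle) : (z : ℂ) * (starRingEnd ℂ) (z : ℂ) = 1 := by
  rw [Complex.mul_conj, Circle.normSq_coe, Complex.ofReal_one]

theorem legFactor_ne_zero (w₀ w₁ : ℝ) (i : Fin 4) (γ : GHPGroup) : legFactor w₀ w₁ i γ ≠ 0 := by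
  have hp : ∀ w : ℝ, (((γ.2.2 : ℝ) ^ w : ℝ) : ℂ) ≠ 0 := fun w => by
    exact_mod_cast (Real.rpow_pos_of_pos γ.2.2.2 w).ne'
  have ha : ((γ.1 : ℝ) : ℂ) ≠ 0 := by exact_mod_cast γ.1.ne_zero
  have hz : (γ.2.1 : ℂ) ≠ 0 := Circle.coe_ne_zero _
  have hz' : (starRingEnd ℂ) (γ.2.1 : ℂ) ≠ 0 := by simp
  fin_cases i
  · exact mul_ne_zero (hp _) ha
  · exact mul_ne_zero (hp _) (inv_ne_zero ha)
  · exact mul_ne_zero (hp _) hz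
  · exact mul_ne_zero (hp _) hz'

theorem frameMetric_act (g : FormField M) (N : ∀ y : M, Tetrad y) (w₀ w₁ : ℝ) (γ : M → GHPGroup) :
    frameMetric g (fun y => (N y).act w₀ w₁ (γ y)) x
      = ((((γ x).2.2 : ℝ) ^ (w₀ + w₁)) ^ 2)⁻¹ • frameMetric g N x := by
  simp only [frameMetric, Tetrad.act, Tetrad.scale, map_smul, smul_apply, smul_eq_mul, smul_smul]
  congr 1
  rw [← legFactor_zero_mul_one, ← mul_inv]
  congr 1
  ring

/-- Dual frames scale inversely: the covector dual to a leg is its null partner lowered with the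
normalized metric, and the change of that metric divides by the product of the two factors. -/
theorem coleg_act (g : FormField M) (N : ∀ y : M, Tetrad y) (w₀ w₁ : ℝ) (γ : M → GHPGroup)
    (i : Fin 4) (v : CTM x) : coleg g (fun y => (N y).act w₀ w₁ (γ y)) x i v
      = (legFactor w₀ w₁ i (γ x))⁻¹ * coleg g N x i v := by
  have hz := circle_mul_conj (γ x).2.1
  have h0 : ((((γ x).2.2 : ℝ) ^ (w₀ + w₁) : ℝ) : ℂ) ≠ 0 := by
    exact_mod_cast (Real.rpow_pos_of_pos (γ x).2.2.2 _).ne'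
  have p := congrArg (fun r : ℝ => (r : ℂ)) (legFactor_zero_mul_one w₀ w₁ (γ x))
  have n0 := legFactor_ne_zero w₀ w₁ 0 (γ x)
  have n1 := legFactor_ne_zero w₀ w₁ 1 (γ x)
  have n2 := legFactor_ne_zero w₀ w₁ 2 (γ x)
  have n3 := legFactor_ne_zero w₀ w₁ 3 (γ x)
  simp only [Complex.ofReal_mul, Complex.ofReal_pow, Complex.ofReal_inv] at p
  simp only [legFactor, Matrix.cons_val] at n0 n1 n2 n3
  simp only [coleg, frameMetric_act, complexForm_smul_form]
  fin_cases i <;> simp only [Fin.zero_eta, Fin.mk_one, Fin.reduceFinMk, legFactor, Tetrad.act,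
    Tetrad.scale, Matrix.cons_val, ofReal_smul, conj_csmul, complexForm_neg_left,
    complexForm_csmul_left, Complex.ofReal_mul, Complex.ofReal_pow, Complex.ofReal_inv, map_mul,
    Complex.conj_ofReal]
  · rw [← p, mul_inv, ← mul_assoc, inv_mul_cancel_right₀ n1]
  · rw [← p, mul_comm (_ * _) (_ * _), mul_inv, ← mul_assoc, inv_mul_cancel_right₀ n0]
  · rw [eq_inv_of_mul_eq_one_right hz]
    have := Circle.coe_ne_zero (γ x).2.1
    field_simp
  · rw [eq_inv_of_mul_eq_one_right hz]
    have := Circle.coe_ne_zero (γ x).2.1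
    field_simp

theorem coleg_leg {g : FormField M} {N : ∀ y : M, Tetrad y} (hN : TetradFieldAt g N x)
    (i j : Fin 4) : coleg g N x i ((N x).leg j) = if i = j then 1 else 0 := by
  have h := hN.isNullTetrad x
  fin_cases i <;> fin_cases j <;> simp [coleg, Tetrad.leg, complexForm_neg_left, h.ln, h.ll, h.nn,
    h.lm, h.nm, h.mm, h.mmb, h.nl, h.ml, h.mn, h.mbm, h.mbmb, h.lmb, h.nmb, h.mbl, h.mbn]

theorem TetradFieldAt.leg_diff {g : FormField M} {N : ∀ y : M, Tetrad y}
    (hN : TetradFieldAt g N x) (j : Fin 4) : DiffCVFAt (fun y => (N y).leg j) x := by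
  fin_cases j
  exacts [hN.l.ofReal, hN.n.ofReal, hN.m, hN.m.conj]

namespace DiffGaugeAt

variable {γ : M → GHPGroup} (hγ : DiffGaugeAt γ x)
include hγ

theorem legFactor_diff (w₀ w₁ : ℝ) (i : Fin 4) :
    DiffCAt (fun y => legFactor w₀ w₁ i (γ y)) x := by
  have hΩ := fun w : ℝ => (hγ.Ω.rpow (γ x).2.2.2 w).ofReal
  have ha : ((((γ x).1 : ℝ)) : ℂ) ≠ 0 := by exact_mod_cast (γ x).1.ne_zero
  fin_cases i
  exacts [(hΩ _).mul hγ.a.ofReal, (hΩ _).mul (hγ.a.ofReal.inv ha), (hΩ _).mul hγ.z,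
    (hΩ _).mul hγ.z.star]

theorem dLog_legFactor (w₀ w₁ : ℝ) (X : TM x) :
    dLog (fun y => legFactor w₀ w₁ 0 (γ y)) x X
      = 2 * w₀ * dLog (fun y => (((γ y).2.2 : ℝ) : ℂ)) x X
        + dLog (fun y => (((γ y).1 : ℝ) : ℂ)) x X ∧
    dLog (fun y => legFactor w₀ w₁ 1 (γ y)) x X
      = 2 * w₁ * dLog (fun y => (((γ y).2.2 : ℝ) : ℂ)) x X
        - dLog (fun y => (((γ y).1 : ℝ) : ℂ)) x X ∧
    dLog (fun y => legFactor w₀ w₁ 2 (γ y)) x X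
      = (w₀ + w₁) * dLog (fun y => (((γ y).2.2 : ℝ) : ℂ)) x X
        + dLog (fun y => ((γ y).2.1 : ℂ)) x X ∧
    dLog (fun y => legFactor w₀ w₁ 3 (γ y)) x X
      = (w₀ + w₁) * dLog (fun y => (((γ y).2.2 : ℝ) : ℂ)) x X
        - dLog (fun y => ((γ y).2.1 : ℂ)) x X := by
  have hΩ := fun w : ℝ => (hγ.Ω.rpow (γ x).2.2.2 w).ofReal
  have h0 : ∀ w : ℝ, ((((γ x).2.2 : ℝ) ^ w : ℝ) : ℂ) ≠ 0 := fun w => by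
    exact_mod_cast (Real.rpow_pos_of_pos (γ x).2.2.2 w).ne'
  have ha : ((((γ x).1 : ℝ)) : ℂ) ≠ 0 := by exact_mod_cast (γ x).1.ne_zero
  have hz := Circle.coe_ne_zero (γ x).2.1
  -- On the unit circle conjugation is inversion, so `dLog_inv` covers the fourth leg.
  have e : (fun y => (starRingEnd ℂ) ((γ y).2.1 : ℂ)) = fun y => ((γ y).2.1 : ℂ)⁻¹ := by
    funext y
    exact eq_inv_of_mul_eq_one_right (circle_mul_conj _)
  have e3 : (fun y => legFactor w₀ w₁ 3 (γ y))
      = fun y => ((((γ y).2.2 : ℝ) ^ (w₀ + w₁) : ℝ) : ℂ) * ((γ y).2.1 : ℂ)⁻¹ := by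
    funext y
    rw [← congrFun e y]
    rfl
  rw [e3]
  refine ⟨(dLog_mul (hΩ _) hγ.a.ofReal (h0 _) ha X).trans ?_,
    (dLog_mul (hΩ _) (hγ.a.ofReal.inv ha) (h0 _) (inv_ne_zero ha) X).trans ?_,
    (dLog_mul (hΩ _) hγ.z (h0 _) hz X).trans ?_,
    (dLog_mul (hΩ _) (hγ.z.inv hz) (h0 _) (inv_ne_zero hz) X).trans ?_⟩ <;>
    simp only [dLog_rpow hγ.Ω (γ x).2.2.2, dLog_inv hγ.a.ofReal ha, dLog_inv hγ.z hz] <;>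
    push_cast <;> ring

variable {D : CConnection M} {g : FormField M} {N : ∀ y : M, Tetrad y} {f : TM x → ℂ}
  (hN : TetradFieldAt g N x) (hD : IsWeylAt (frameMetric g N) D x f)
include hN hD

/-- In the Leibniz rule the derivative of the factor multiplies the leg N_j itself, which the dual
frame detects only for i = j. -/
theorem connForm_act (w₀ w₁ : ℝ) (i j : Fin 4) (X : TM x) :
    connForm g D (fun y => (N y).act w₀ w₁ (γ y)) i j x X
      = (legFactor w₀ w₁ i (γ x))⁻¹ * legFactor w₀ w₁ j (γ x) * connForm g D N i j x X
        + if i = j then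
            (legFactor w₀ w₁ i (γ x))⁻¹ * dC (fun y => legFactor w₀ w₁ i (γ y)) x X
          else 0 := by
  simp only [connForm, Tetrad.act_leg, coleg_act]
  rw [hD.deriv_csmul (hγ.legFactor_diff w₀ w₁ j) (hN.leg_diff j)]
  have e := coleg_leg hN i j
  simp only [coleg, complexForm_add_right, complexForm_csmul_right] at e ⊢
  rw [e]
  split_ifs with h
  · subst h
    ring
  · ring

theorem connForm_act_diag (w₀ w₁ : ℝ) (i : Fin 4) (X : TM x) :
    connForm g D (fun y => (N y).act w₀ w₁ (γ y)) i i x X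
      = connForm g D N i i x X + dLog (fun y => legFactor w₀ w₁ i (γ y)) x X := by
  rw [hγ.connForm_act hN hD, if_pos rfl, inv_mul_cancel₀ (legFactor_ne_zero _ _ _ _), one_mul, dLog]

/-- In K the terms 2w₀w₁ d log Ω cancel and (w₀ + w₁) d log a = -d log a remains; this is the reason
for its weights. L keeps only the phase, and f only (w₀ + w₁) d log Ω. -/
theorem psi_act {w₀ w₁ : ℝ} (hw : w₀ + w₁ + 1 = 0) (X : TM x) :
    psi g D w₀ w₁ (fun y => (N y).act w₀ w₁ (γ y)) x X = psi g D w₀ w₁ N x X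
      + (-dLog (fun y => (((γ y).1 : ℝ) : ℂ)) x X, -dLog (fun y => ((γ y).2.1 : ℂ)) x X,
        -dLog (fun y => (((γ y).2.2 : ℝ) : ℂ)) x X) := by
  obtain rfl : w₁ = -1 - w₀ := by linarith
  obtain ⟨h0, h1, h2, h3⟩ := hγ.dLog_legFactor w₀ (-1 - w₀) X
  simp only [psi, hγ.connForm_act_diag hN hD, h0, h1, h2, h3, Prod.mk_add_mk]
  push_cast
  refine Prod.ext ?_ (Prod.ext ?_ ?_) <;> simp only <;> ring

end DiffGaugeAt

end Gauge

/-! ### Smoothness of derivatives and Lie brackets. -/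

section Smoothness

variable {M : Type*} [TopologicalSpace M] [ChartedSpace (EuclideanSpace ℝ (Fin 4)) M]
  [IsManifold (𝓡 4) ∞ M] {U : Set M}

/-- The derivative along X is the fibre component of the tangent map of φ composed with X. -/
theorem contMDiffOn_mvfderiv_apply {F : Type*} [NormedAddCommGroup F] [NormedSpace ℝ F]
    (hU : IsOpen U) {φ : M → F} (hφ : ContMDiffOn (𝓡 4) 𝓘(ℝ, F) ∞ φ U) {X : ∀ y : M, TM y}
    (hX : SmoothVF X U) :
    ContMDiffOn (𝓡 4) 𝓘(ℝ, F) ∞ (fun y => (mvfderiv (𝓡 4) φ y (X y) : F)) U := by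
  have h := hφ.contMDiffOn_tangentMapWithin (m := ∞) (by simp) hU.uniqueMDiffOn
  have h2 := (contMDiff_snd_tangentBundle_modelSpace F 𝓘(ℝ, F)).comp_contMDiffOn
    (h.comp hX (fun y hy => hy))
  refine h2.congr fun y hy => ?_
  simp only [Function.comp, tangentMapWithin, mfderivWithin_of_isOpen hU hy]
  rfl

theorem SmoothVF.mlieBracket (hU : IsOpen U) {X Y : ∀ y : M, TM y} (hX : SmoothVF X U)
    (hY : SmoothVF Y U) : SmoothVF (fun y => VectorField.mlieBracket (𝓡 4) X Y y) U := by
  intro x hx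
  have : IsManifold (𝓡 4) ((⊤ : ℕ∞) + 1) M := IsManifold.of_le (n := ∞) (by simp)
  have : IsManifold (𝓡 4) (minSmoothness ℝ 2) M := by
    rw [minSmoothness_of_isRCLikeNormedField]
    infer_instance
  have := ContMDiffAt.mlieBracket_vectorField (m := ⊤) (n := ⊤) (hX.contMDiffAt (hU.mem_nhds hx)) (hY.contMDiffAt (hU.mem_nhds hx)) (by simp)
  exact this.contMDiffWithinAt

end Smoothness
-- Lie algebra representations of the characters.
section LieRep

variable {M : Type*} [TopologicalSpace M] [ChartedSpace (EuclideanSpace ℝ (Fin 4)) M]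
  [IsManifold (𝓡 4) ∞ M]
  {S : M → Type*} [∀ x, AddCommGroup (S x)] [∀ x, Module ℂ (S x)]
  [∀ x, TopologicalSpace (S x)] [TopologicalSpace (Bundle.TotalSpace SpinModel S)]
  [FiberBundle SpinModel S] {g : LorentzMetric M} {σ : SpinorStructure S g}

/-- When the character is exponential along each one-parameter subgroup, its derivatives are the
rates `c`. The factor -i converts y = iθ to θ. -/
theorem FrameBundle.lieRep_of_exp {G : Type*} (P : FrameBundle M G) {χ : G → ℂ} {c : Fin 3 → ℂ}
    (h : ∀ (t : ℝ) i, χ (P.oneParam t i) = Complex.exp (c i * t)) (ξ : ℂ × ℂ × ℂ) :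
    P.lieRep χ ξ = c 0 * ξ.1 - Complex.I * c 1 * ξ.2.1 + c 2 * ξ.2.2 := by
  have d : ∀ i, deriv (fun t : ℝ => χ (P.oneParam t i)) 0 = c i := fun i => by
    have e : (fun t : ℝ => χ (P.oneParam t i)) = fun t : ℝ => Complex.exp (c i * t) :=
      funext fun t => h t i
    have h1 : HasDerivAt (fun t : ℝ => c i * (t : ℂ)) (c i) 0 := by
      simpa using (Complex.ofRealCLM.hasDerivAt (x := (0 : ℝ))).const_mul (c i)
    rw [e, h1.cexp.deriv]
    simp
  simp only [FrameBundle.lieRep, d]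
  ring

theorem exp_rpow_ofReal (t w : ℝ) : ((Real.exp t ^ w : ℝ) : ℂ) = Complex.exp (w * t) := by
  rw [← Real.exp_mul]
  push_cast
  rw [mul_comm]

theorem exp_zpow (z : ℂ) (n : ℤ) : Complex.exp z ^ n = Complex.exp (n * z) :=
  (Complex.exp_int_mul z n).symm

theorem lieRep_tetradRep (L : NullDirections σ) (w₀ w₁ : ℝ) (b s : ℤ) (w : ℝ) (ξ : ℂ × ℂ × ℂ) :
    (tetradBundle L w₀ w₁).lieRep (tetradRep b s w) ξ = b * ξ.1 + s * ξ.2.1 + w * ξ.2.2 := by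
  have h : ∀ (t : ℝ) i, tetradRep b s w ((tetradBundle L w₀ w₁).oneParam t i)
      = Complex.exp ((![(b : ℂ), s * Complex.I, w] : Fin 3 → ℂ) i * t) := by
    intro t i
    fin_cases i
    · simp [tetradBundle, tetradRep, ghpOneParam, exp_zpow]
    · simp [tetradBundle, tetradRep, ghpOneParam, exp_zpow]
      ring_nf
    · simp [tetradBundle, tetradRep, ghpOneParam, exp_rpow_ofReal, -Complex.ofReal_exp]
  rw [FrameBundle.lieRep_of_exp _ h]
  simp only [Matrix.cons_val]
  linear_combination -(s * ξ.2.1) * Complex.I_mul_I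

/-- On λ = e^{t/2} the rate is (p + q)/2; on λ = e^{it/2}, where \bar λ = λ⁻¹, it is i(p - q)/2. -/
theorem lieRep_dyadRep (L : NullDirections σ) (w₀ w₁ : ℝ) (p q : ℤ) (w : ℝ) (ξ : ℂ × ℂ × ℂ) :
    (dyadBundle L w₀ w₁).lieRep (dyadRep p q w) ξ
      = p * ((ξ.1 + ξ.2.1) / 2) + q * ((ξ.1 - ξ.2.1) / 2) + w * ξ.2.2 := by
  have h : ∀ (t : ℝ) i, dyadRep p q w ((dyadBundle L w₀ w₁).oneParam t i)
      = Complex.exp ((![((p + q) / 2 : ℂ), (p - q) * Complex.I / 2, w] : Fin 3 → ℂ) i * t) := by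
    intro t i
    fin_cases i
    · simp [dyadBundle, dyadRep, spinOneParam, exp_zpow, ← Complex.exp_conj, ← Complex.exp_add,
        Complex.conj_ofNat]
      ring_nf
    · simp [dyadBundle, dyadRep, spinOneParam, exp_zpow, ← Complex.exp_conj, ← Complex.exp_add,
        Complex.conj_ofNat]
      ring_nf
    · simp [dyadBundle, dyadRep, spinOneParam, exp_rpow_ofReal, -Complex.ofReal_exp]
  rw [FrameBundle.lieRep_of_exp _ h]
  simp only [Matrix.cons_val]
  linear_combination -((p - q) / 2 * ξ.2.1) * Complex.I_mul_I

theorem lieRep_legFactor (L : NullDirections σ) (w₀ w₁ : ℝ) (i : Fin 4) (ξ : ℂ × ℂ × ℂ) :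
    (tetradBundle L w₀ w₁).lieRep (legFactor w₀ w₁ i) ξ
      = (![ξ.1 + 2 * w₀ * ξ.2.2, -ξ.1 + 2 * w₁ * ξ.2.2, ξ.2.1 + (w₀ + w₁) * ξ.2.2,
          -ξ.2.1 + (w₀ + w₁) * ξ.2.2] : Fin 4 → ℂ) i := by
  have h : ∀ (t : ℝ) k, legFactor w₀ w₁ i ((tetradBundle L w₀ w₁).oneParam t k)
      = Complex.exp ((![![1, -1, 0, 0] i, ![0, 0, Complex.I, -Complex.I] i,
        (![2 * w₀, 2 * w₁, w₀ + w₁, w₀ + w₁] i : ℝ)] : Fin 3 → ℂ) k * t) := by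
    intro t k
    fin_cases k <;> fin_cases i <;>
      simp [tetradBundle, legFactor, ghpOneParam, exp_rpow_ofReal, Complex.exp_neg,
        ← Complex.exp_conj, mul_comm]
  rw [FrameBundle.lieRep_of_exp _ h]
  have := Complex.I_mul_I
  fin_cases i <;> simp

end LieRep

/-! ### Smoothness of the spin coefficients. -/

section SmoothCoefficients

variable {M : Type*} [TopologicalSpace M] [ChartedSpace (EuclideanSpace ℝ (Fin 4)) M]
  [IsManifold (𝓡 4) ∞ M] {U : Set M}

/-- Smoothness of a real function on a set. -/
abbrev SmoothR (φ : M → ℝ) (U : Set M) : Prop := ContMDiffOn (𝓡 4) 𝓘(ℝ, ℝ) ∞ φ U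

/-- Smoothness of a complex function on a set. -/
abbrev SmoothC (φ : M → ℂ) (U : Set M) : Prop := ContMDiffOn (𝓡 4) 𝓘(ℝ, ℂ) ∞ φ U

theorem smoothC_mk {φ ψ : M → ℝ} (hφ : SmoothR φ U) (hψ : SmoothR ψ U) :
    SmoothC (fun y => (⟨φ y, ψ y⟩ : ℂ)) U :=
  Complex.equivRealProdCLM.symm.toContinuousLinearMap.contMDiff.comp_contMDiffOn
    (hφ.prodMk_space hψ)

theorem SmoothC.star {φ : M → ℂ} (hφ : SmoothC φ U) :
    SmoothC (fun y => (starRingEnd ℂ) (φ y)) U :=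
  Complex.conjCLE.toContinuousLinearMap.contMDiff.comp_contMDiffOn hφ

theorem SmoothC.mul {φ ψ : M → ℂ} (hφ : SmoothC φ U) (hψ : SmoothC ψ U) :
    SmoothC (fun y => φ y * ψ y) U :=
  (contDiff_mul (𝕜 := ℝ) (𝔸 := ℂ)).contMDiff.comp_contMDiffOn (hφ.prodMk_space hψ)

theorem SmoothC.const_mul (c : ℂ) {φ : M → ℂ} (hφ : SmoothC φ U) :
    SmoothC (fun y => c * φ y) U := SmoothC.mul contMDiffOn_const hφ

theorem SmoothC.neg {φ : M → ℂ} (hφ : SmoothC φ U) : SmoothC (fun y => -φ y) U :=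
  ContMDiffOn.neg hφ

/-- The form field `h` takes vector fields that are smooth on `U` to smooth functions. -/
def SmoothForm (h : FormField M) (U : Set M) : Prop :=
  ∀ Y Z : ∀ y : M, TM y, SmoothVF Y U → SmoothVF Z U → SmoothR (fun y => h y (Y y) (Z y)) U

/-- Smoothness on `U` of a complex vector field. -/
def SmoothCVF (V : ∀ y : M, CTM y) (U : Set M) : Prop :=
  SmoothVF (fun y => (V y).1) U ∧ SmoothVF (fun y => (V y).2) U

theorem smoothVF_zero : SmoothVF (fun y : M => (0 : TM y)) U :=
  (Bundle.contMDiff_zeroSection ℝ (fun y : M => TM y)).contMDiffOn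

theorem SmoothVF.ofReal {X : ∀ y : M, TM y} (hX : SmoothVF X U) :
    SmoothCVF (fun y => ofReal (X y)) U := ⟨hX, smoothVF_zero⟩

theorem SmoothCVF.conj {V : ∀ y : M, CTM y} (hV : SmoothCVF V U) :
    SmoothCVF (fun y => conj (V y)) U := ⟨hV.1, hV.2.neg⟩

namespace SmoothForm

variable {h : FormField M} (hh : SmoothForm h U)
include hh

theorem complexForm {V W : ∀ y : M, CTM y} (hV : SmoothCVF V U) (hW : SmoothCVF W U) :
    SmoothC (fun y => complexForm (h y) (V y) (W y)) U :=
  smoothC_mk ((hh _ _ hV.1 hW.1).sub (hh _ _ hV.2 hW.2)) ((hh _ _ hV.1 hW.2).add (hh _ _ hV.2 hW.1))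

theorem leviCivita (hU : IsOpen U) {X Y Z : ∀ y : M, TM y} (hX : SmoothVF X U) (hY : SmoothVF Y U)
    (hZ : SmoothVF Z U) : SmoothR (leviCivita h X Y Z) U := by
  have d := fun {φ : M → ℝ} (hφ : SmoothR φ U) {X : ∀ y : M, TM y} (hX : SmoothVF X U) =>
    contMDiffOn_mvfderiv_apply hU hφ hX
  exact contMDiffOn_const.mul ((((((d (hh _ _ hY hZ) hX).add (d (hh _ _ hZ hX) hY)).sub
    (d (hh _ _ hX hY) hZ)).add (hh _ _ (hX.mlieBracket hU hY) hZ)).sub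
    (hh _ _ (hX.mlieBracket hU hZ) hY)).sub (hh _ _ (hY.mlieBracket hU hZ) hX))

theorem leviCivitaC (hU : IsOpen U) {X Y Z : ∀ y : M, CTM y} (hX : SmoothCVF X U)
    (hY : SmoothCVF Y U) (hZ : SmoothCVF Z U) : SmoothC (leviCivitaC h X Y Z) U :=
  smoothC_mk
    ((((hh.leviCivita hU hX.1 hY.1 hZ.1).sub (hh.leviCivita hU hX.1 hY.2 hZ.2)).sub
      (hh.leviCivita hU hX.2 hY.1 hZ.2)).sub (hh.leviCivita hU hX.2 hY.2 hZ.1))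
    ((((hh.leviCivita hU hX.1 hY.1 hZ.2).add (hh.leviCivita hU hX.1 hY.2 hZ.1)).add
      (hh.leviCivita hU hX.2 hY.1 hZ.1)).sub (hh.leviCivita hU hX.2 hY.2 hZ.2))

end SmoothForm

/-- A tetrad field that is smooth on the open set `U` and conformally null, for a smooth metric. -/
structure SmoothTetradOn (g : FormField M) (N : ∀ y : M, Tetrad y) (U : Set M) : Prop where
  isOpen : IsOpen U
  metric : SmoothForm g U
  symm : ∀ y u v, g y u v = g y v u
  ln : ∀ y, 0 < g y (N y).l (N y).n
  l : SmoothVF (fun y => (N y).l) U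
  n : SmoothVF (fun y => (N y).n) U
  m : SmoothCVF (fun y => (N y).m) U

namespace SmoothTetradOn

variable {g : FormField M} {N : ∀ y : M, Tetrad y} (hN : SmoothTetradOn g N U)
include hN

theorem prime : SmoothTetradOn g (fun y => (N y).prime) U where
  isOpen := hN.isOpen
  metric := hN.metric
  symm := hN.symm
  ln y := (hN.ln y).trans_eq (hN.symm y _ _)
  l := hN.n
  n := hN.l
  m := hN.m.conj

theorem frameMetric : SmoothForm (frameMetric g N) U := fun Y Z hY hZ => by
  have h1 := hN.metric _ _ hN.l hN.n
  have h2 : SmoothR (fun y => (g y (N y).l (N y).n)⁻¹) U := h1.inv₀ fun y _ => (hN.ln y).ne'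
  exact h2.mul (hN.metric Y Z hY hZ)

theorem nabla {X Y Z : ∀ y : M, CTM y} (hX : SmoothCVF X U)
    (hY : SmoothCVF Y U) (hZ : SmoothCVF Z U) : SmoothC (nabla g N X Y Z) U :=
  hN.frameMetric.leviCivitaC hN.isOpen hX hY hZ

theorem rho : SmoothC (rho g N) U := hN.nabla hN.m.conj hN.l.ofReal hN.m

theorem tau : SmoothC (tau g N) U := hN.nabla hN.n.ofReal hN.l.ofReal hN.m

theorem eps : SmoothC (eps g N) U := SmoothC.const_mul _
  ((hN.nabla hN.l.ofReal hN.l.ofReal hN.n.ofReal).add (hN.nabla hN.l.ofReal hN.m.conj hN.m))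

theorem beta : SmoothC (beta g N) U := SmoothC.const_mul _
  ((hN.nabla hN.m hN.l.ofReal hN.n.ofReal).add (hN.nabla hN.m hN.m.conj hN.m))

variable {X : ∀ y : M, TM y} (hX : SmoothVF X U)
include hX

theorem lower {V : ∀ y : M, CTM y} (hV : SmoothCVF V U) :
    SmoothC (fun y => lower g N (V y) (X y)) U := hN.frameMetric.complexForm hV hX.ofReal

theorem ghpForm : SmoothC (fun y => ghpForm g N y (X y)) U :=
  (((hN.eps.neg.mul (hN.lower hX hN.n.ofReal)).add
    (hN.prime.eps.mul (hN.lower hX hN.l.ofReal))).sub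
    (hN.prime.beta.mul (hN.lower hX hN.m))).add (hN.beta.mul (hN.lower hX hN.m.conj))

theorem fForm : SmoothC (fun y => fForm g N y (X y)) U :=
  (((hN.rho.mul (hN.lower hX hN.n.ofReal)).add
    (hN.prime.rho.mul (hN.lower hX hN.l.ofReal))).sub
    (hN.tau.mul (hN.lower hX hN.m.conj))).sub (hN.prime.tau.mul (hN.lower hX hN.m))

theorem bForm (w₀ w₁ : ℝ) : SmoothC (fun y => bForm g w₀ w₁ N y (X y)) U :=
  (SmoothC.const_mul _ ((hN.rho.mul (hN.lower hX hN.n.ofReal)).sub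
    (hN.tau.mul (hN.lower hX hN.m.conj)))).sub
  (SmoothC.const_mul _ ((hN.prime.rho.mul (hN.lower hX hN.l.ofReal)).sub
    (hN.prime.tau.mul (hN.lower hX hN.m))))

theorem cForm (w₀ w₁ : ℝ) : SmoothC (fun y => cForm g w₀ w₁ N y (X y)) U :=
  (SmoothC.const_mul _ ((hN.rho.mul (hN.lower hX hN.n.ofReal)).sub
    (hN.prime.tau.mul (hN.lower hX hN.m)))).sub
  (SmoothC.const_mul _ ((hN.prime.rho.mul (hN.lower hX hN.l.ofReal)).sub
    (hN.tau.mul (hN.lower hX hN.m.conj))))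

/-- The source of smoothness for π(ψ): a `CConnection` carries none of its own, but this expression
uses only the metric and the tetrad. -/
theorem slashed (w₀ w₁ : ℝ) (p q w : ℂ) : SmoothC (fun y => p * (ConformalGHP.ghpForm g N y (X y)
    + ConformalGHP.bForm g w₀ w₁ N y (X y)) + q * (ghpFormBar g N y (X y)
    + ConformalGHP.cForm g w₀ w₁ N y (X y)) + w * ConformalGHP.fForm g N y (X y)) U :=
  ((SmoothC.const_mul _ ((hN.ghpForm hX).add (hN.bForm hX w₀ w₁))).add
    (SmoothC.const_mul _ ((SmoothC.star (hN.ghpForm hX)).add (hN.cForm hX w₀ w₁)))).add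
    (SmoothC.const_mul _ (hN.fForm hX))

end SmoothTetradOn

end SmoothCoefficients

/-! ### Linearity of the connection forms. -/

section Linearity

variable {M : Type*} [TopologicalSpace M] [ChartedSpace (EuclideanSpace ℝ (Fin 4)) M]
  [IsManifold (𝓡 4) ∞ M] {x : M}

theorem connForm_add_vector (g : FormField M) (D : CConnection M) (N : ∀ y : M, Tetrad y)
    (i j : Fin 4) (X Y : TM x) :
    connForm g D N i j x (X + Y) = connForm g D N i j x X + connForm g D N i j x Y := by
  simp only [connForm, coleg, map_add, complexForm_add_right]

theorem connForm_smul_vector (g : FormField M) (D : CConnection M) (N : ∀ y : M, Tetrad y)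
    (i j : Fin 4) (r : ℝ) (X : TM x) :
    connForm g D N i j x (r • X) = r * connForm g D N i j x X := by
  simp only [connForm, coleg, map_smul]
  rw [← csmul_ofReal, complexForm_csmul_right]

/-- `π(ψ)` as a real linear form. -/
noncomputable def FrameBundle.lieRepPsi {G : Type*} (P : FrameBundle M G) (χ : G → ℂ)
    (g : FormField M) (D : CConnection M) (w₀ w₁ : ℝ) (N : ∀ y : M, Tetrad y) (x : M) :
    TM x →L[ℝ] ℂ :=
  LinearMap.toContinuousLinearMap
    { toFun := fun X => P.lieRep χ (psi g D w₀ w₁ N x X)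
      map_add' := fun X Y => by
        simp only [FrameBundle.lieRep, psi, connForm_add_vector]
        ring
      map_smul' := fun r X => by
        simp only [FrameBundle.lieRep, psi, connForm_smul_vector, Complex.real_smul,
          RingHom.id_apply]
        ring }

theorem FrameBundle.lieRepPsi_apply {G : Type*} (P : FrameBundle M G) (χ : G → ℂ)
    (g : FormField M) (D : CConnection M) (w₀ w₁ : ℝ) (N : ∀ y : M, Tetrad y) (X : TM x) :
    P.lieRepPsi χ g D w₀ w₁ N x X = P.lieRep χ (psi g D w₀ w₁ N x X) := rfl

end Linearity

/-! ### Covariant derivatives on associated line bundles. -/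

section InducedDerivative

variable {M : Type*} [TopologicalSpace M] [ChartedSpace (EuclideanSpace ℝ (Fin 4)) M]
  [IsManifold (𝓡 4) ∞ M] {G : Type*} [Group G] {P : FrameBundle M G} {χ : G → ℂ}
  {g : FormField M} {D : CConnection M} {w₀ w₁ : ℝ}

/-- The connection form `π(ψ)` is smooth in smooth frames, and changes by the logarithmic
differential of `χ` under changes of smooth frames. -/
structure FrameBundle.IsConnectionForm (P : FrameBundle M G) (χ : G → ℂ) (g : FormField M)
    (D : CConnection M) (w₀ w₁ : ℝ) : Prop where
  smooth : ∀ (U : Set M) (s : ∀ x, P.Fib x) (X : ∀ x : M, TM x), IsOpen U → P.SmoothOn s U →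
    SmoothVF X U → SmoothC (fun x => P.lieRep χ (psi g D w₀ w₁ (P.field s) x (X x))) U
  gauge : ∀ (U U' : Set M) (s s' : ∀ x, P.Fib x) (γ : M → G), IsOpen U → IsOpen U' →
    P.SmoothOn s U → P.SmoothOn s' U' → (∀ y, s' y = P.act y (s y) (γ y)) →
    ∀ x ∈ U ∩ U', DiffCAt (fun y => χ (γ y)) x ∧ ∀ X : TM x,
      P.lieRep χ (psi g D w₀ w₁ (P.field s') x X) = P.lieRep χ (psi g D w₀ w₁ (P.field s) x X)
        - dLog (fun y => χ (γ y)) x X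

/-- `∂ η + π(ψ) η` in the frame field `s`. -/
noncomputable def WeightedSection.localDeriv (g : FormField M) (D : CConnection M) (w₀ w₁ : ℝ)
    (η : WeightedSection P χ) (s : ∀ x, P.Fib x) (x : M) : TM x →L[ℝ] ℂ :=
  dC (η.comp s) x + η.comp s x • P.lieRepPsi χ g D w₀ w₁ (P.field s) x

theorem WeightedSection.localDeriv_apply (η : WeightedSection P χ) (s : ∀ x, P.Fib x) (x : M)
    (X : TM x) : η.localDeriv g D w₀ w₁ s x X
      = dC (η.comp s) x X + P.lieRep χ (psi g D w₀ w₁ (P.field s) x X) * η.comp s x := by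
  simp only [WeightedSection.localDeriv, add_apply, smul_apply, smul_eq_mul,
    FrameBundle.lieRepPsi_apply]
  ring

theorem WeightedSection.comp_diff (η : WeightedSection P χ) {U : Set M} {s : ∀ x, P.Fib x}
    (hU : IsOpen U) (hs : P.SmoothOn s U) {x : M} (hx : x ∈ U) : DiffCAt (η.comp s) x :=
  ((η.smooth U s hU hs).contMDiffAt (hU.mem_nhds hx)).mdifferentiableAt (by simp)

/-- The term η dχ from the product rule cancels against the inhomogeneous term -d log χ of π(ψ). -/
theorem WeightedSection.localDeriv_act (hP : P.IsPrincipal) (hχ : ∀ γ, χ γ ≠ 0)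
    (h : P.IsConnectionForm χ g D w₀ w₁) (η : WeightedSection P χ) {U U' : Set M}
    {s s' : ∀ x, P.Fib x} (hU : IsOpen U) (hU' : IsOpen U') (hs : P.SmoothOn s U)
    (hs' : P.SmoothOn s' U') {x : M} (hx : x ∈ U) (hx' : x ∈ U') {γ₀ : G}
    (e : s' x = P.act x (s x) γ₀) :
    η.localDeriv g D w₀ w₁ s' x = χ γ₀ • η.localDeriv g D w₀ w₁ s x := by
  -- The gauge function comes pointwise from simple transitivity; the regularity needed of χ ∘ γ is
  -- supplied by `h.gauge`.
  choose γ hγ hγ' using fun y => hP.simply_transitive y (s y) (s' y)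
  obtain rfl : γ₀ = γ x := hγ' x γ₀ e
  obtain ⟨hd, hg⟩ := h.gauge U U' s s' γ hU hU' hs hs' hγ x ⟨hx, hx'⟩
  have ec : η.comp s' = fun y => χ (γ y) * η.comp s y := by
    funext y
    simp only [WeightedSection.comp]
    rw [hγ y, η.equivariant]
  ext X
  rw [smul_apply, smul_eq_mul, WeightedSection.localDeriv_apply, WeightedSection.localDeriv_apply,
    hg X, ec, dC_mul hd (η.comp_diff hU hs hx), ← mul_dLog (φ := fun y => χ (γ y)) (hχ (γ x)) X]
  ring

/-- Existence and uniqueness of the covariant derivative on an associated line bundle. -/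
theorem FrameBundle.IsConnectionForm.existsUnique (hP : P.IsPrincipal) (hχ : ∀ γ, χ γ ≠ 0)
    (h1 : χ 1 = 1) (h : P.IsConnectionForm χ g D w₀ w₁) :
    ∃ Θ : WeightedSection P χ → ∀ x, P.Fib x → (TM x →L[ℝ] ℂ),
      IsInducedDeriv g D w₀ w₁ P χ Θ ∧ ∀ Θ', IsInducedDeriv g D w₀ w₁ P χ Θ' → Θ' = Θ := by
  -- A smooth local section through each single frame is fixed, and the derivative at that frame is
  -- computed in it.
  choose U s hU hx hs e using hP.local_section
  let Θ : WeightedSection P χ → ∀ x, P.Fib x → (TM x →L[ℝ] ℂ) := fun η x N =>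
    η.localDeriv g D w₀ w₁ (s x N) x
  -- Two smooth sections through the same frame at x are related there by the identity, and χ 1 = 1,
  -- so the choice is harmless.
  have loc : ∀ (η : WeightedSection P χ) (V : Set M) (N : ∀ x, P.Fib x), IsOpen V →
      P.SmoothOn N V → ∀ x ∈ V, Θ η x (N x) = η.localDeriv g D w₀ w₁ N x := by
    intro η V N hV hN x hxV
    have := η.localDeriv_act hP hχ h (γ₀ := 1) hV (hU x (N x)) hN (hs x (N x)) hxV (hx x (N x))
      (by rw [e, hP.act_one])
    rwa [h1, one_smul] at this
  have hΘ : IsInducedDeriv g D w₀ w₁ P χ Θ := by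
    constructor
    · intro η x N γ
      exact η.localDeriv_act hP hχ h (hU x N) (hU x _) (hs x N) (hs x _) (hx x N) (hx x _)
        (by rw [e, e])
    · intro η V N X hV hN hX
      have hη := η.smooth V N hV hN
      refine ((contMDiffOn_mvfderiv_apply hV hη hX).add
        (SmoothC.mul (h.smooth V N X hV hN hX) hη)).congr fun x hxV => ?_
      rw [loc η V N hV hN x hxV, WeightedSection.localDeriv_apply]
      rfl
    · intro η η' η'' hadd x N
      have ec : η''.comp (s x N) = fun y => η.comp (s x N) y + η'.comp (s x N) y :=
        funext fun y => hadd y _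
      have hd := η.comp_diff (hU x N) (hs x N) (hx x N)
      have hd' := η'.comp_diff (hU x N) (hs x N) (hx x N)
      ext X
      simp only [Θ, add_apply, WeightedSection.localDeriv_apply, ec, dC_add hd hd']
      ring
    · intro φ η η' hφ hmul x N
      have ec : η'.comp (s x N) = fun y => φ y * η.comp (s x N) y :=
        funext fun y => hmul y _
      have hd := η.comp_diff (hU x N) (hs x N) (hx x N)
      have e' : η.comp (s x N) x = η.toFun x N := by rw [WeightedSection.comp, e]
      ext X
      simp only [Θ, add_apply, smul_apply, smul_eq_mul, WeightedSection.localDeriv_apply, ec,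
        dC_mul (hφ.mdifferentiableAt (by simp)) hd, e']
      ring
    · intro η V N hV hN x hxV X
      rw [loc η V N hV hN x hxV, WeightedSection.localDeriv_apply]
  refine ⟨Θ, hΘ, fun Θ' hΘ' => ?_⟩
  funext η x N
  ext X
  -- Uniqueness: both derivatives obey the local formula in the same section through `N`.
  have a := hΘ'.local_formula η _ _ (hU x N) (hs x N) x (hx x N) X
  have b := hΘ.local_formula η _ _ (hU x N) (hs x N) x (hx x N) X
  rw [← b, e] at a
  exact a

end InducedDerivative

/-! ### Differentiability of gauge functions. -/

section GaugeDifferentiability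

variable {M : Type*} [TopologicalSpace M] [ChartedSpace (EuclideanSpace ℝ (Fin 4)) M]
  [IsManifold (𝓡 4) ∞ M] {x : M}

/-- The gauge function between two differentiable tetrad fields is differentiable. -/
theorem TetradFieldAt.diffGaugeAt {g : FormField M} {N N' : ∀ y : M, Tetrad y} {w₀ w₁ : ℝ}
    (hw : w₀ + w₁ + 1 = 0) (hN : TetradFieldAt g N x) (hN' : TetradFieldAt g N' x)
    {γ : M → GHPGroup} (hγ : ∀ y, N' y = (N y).act w₀ w₁ (γ y)) : DiffGaugeAt γ x := by
  have hi := hN.diff_inv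
  have h0 := fun y => (hN.null y).ln.ne'
  -- The leg factors are quotients of metric products: l'·n, l·n' and -m'·\bar m, each divided by
  -- l·n.
  have hr : DiffRAt (fun y => ((γ y).2.2 : ℝ) ^ (2 * w₀) * ((γ y).1 : ℝ)) x := by
    refine ((hN.metric.diff _ _ hN'.l hN.n).mul hi).congr_of_eventuallyEq (.of_forall fun y => ?_)
    simp [hγ, Tetrad.act, Tetrad.scale, h0 y]
  have hs : DiffRAt (fun y => ((γ y).2.2 : ℝ) ^ (2 * w₁) * ((γ y).1 : ℝ)⁻¹) x := by
    refine ((hN.metric.diff _ _ hN.l hN'.n).mul hi).congr_of_eventuallyEq (.of_forall fun y => ?_)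
    simp [hγ, Tetrad.act, Tetrad.scale, h0 y]
  have hc : DiffCAt (fun y => ((((γ y).2.2 : ℝ) ^ (w₀ + w₁) : ℝ) : ℂ) * ((γ y).2.1 : ℂ)) x := by
    refine (DiffCAt.mul (hN.metric.diffC hN'.m hN.m.conj) (DiffRAt.ofReal hi.neg)).congr_of_eventuallyEq
      (.of_forall fun y => ?_)
    have : ((g y (N y).l (N y).n : ℝ) : ℂ) ≠ 0 := by exact_mod_cast h0 y
    simp [hγ, Tetrad.act, Tetrad.scale, complexForm_csmul_left, (hN.null y).mm, this]
  have hrs := hr.mul hs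
  -- The factors of l and n multiply to Ω^{2(w₀ + w₁)} = Ω^{-2}, whence the exponent -1/2. Knowing
  -- Ω, one divides its powers out to get a and z.
  have hΩ : DiffRAt (fun y => ((γ y).2.2 : ℝ)) x := by
    have hp := (γ x).2.2.2
    refine (DiffRAt.rpow hrs ?_ (-(1 / 2))).congr_of_eventuallyEq (.of_forall fun y => ?_)
    · simp only [Pi.mul_apply]
      rw [legFactor_zero_mul_one]
      positivity
    · have hp := (γ y).2.2.2
      simp only [Pi.mul_apply]
      rw [legFactor_zero_mul_one, ← Real.rpow_mul_natCast hp.le, ← Real.rpow_mul hp.le]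
      have : (w₀ + w₁) * (2 : ℕ) * (-(1 / 2) : ℝ) = 1 := by
        push_cast
        linarith
      rw [this, Real.rpow_one]
  refine ⟨?_, ?_, hΩ⟩
  · refine (hr.mul (hΩ.rpow (γ x).2.2.2 (-(2 * w₀)))).congr_of_eventuallyEq
      (.of_forall fun y => ?_)
    have hp := Real.rpow_pos_of_pos (γ y).2.2.2 (2 * w₀)
    simp only [Pi.mul_apply]
    rw [Real.rpow_neg (γ y).2.2.2.le]
    field_simp
  · refine (DiffCAt.mul hc (hΩ.rpow (γ x).2.2.2 (-(w₀ + w₁))).ofReal).congr_of_eventuallyEq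
      (.of_forall fun y => ?_)
    have hp : ((((γ y).2.2 : ℝ) ^ (w₀ + w₁) : ℝ) : ℂ) ≠ 0 := by
      exact_mod_cast (Real.rpow_pos_of_pos (γ y).2.2.2 (w₀ + w₁)).ne'
    simp only [Real.rpow_neg (γ y).2.2.2.le]
    push_cast
    field_simp

theorem DiffGaugeAt.dLog_tetradRep {γ : M → GHPGroup} (hγ : DiffGaugeAt γ x) (b s : ℤ) (w : ℝ) :
    DiffCAt (fun y => tetradRep b s w (γ y)) x ∧ ∀ X : TM x,
      dLog (fun y => tetradRep b s w (γ y)) x X = b * dLog (fun y => (((γ y).1 : ℝ) : ℂ)) x X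
        + s * dLog (fun y => ((γ y).2.1 : ℂ)) x X
        + w * dLog (fun y => (((γ y).2.2 : ℝ) : ℂ)) x X := by
  have hΩ := (hγ.Ω.rpow (γ x).2.2.2 w).ofReal
  have h0 : ((((γ x).2.2 : ℝ) ^ w : ℝ) : ℂ) ≠ 0 := by
    exact_mod_cast (Real.rpow_pos_of_pos (γ x).2.2.2 w).ne'
  have ha : ((((γ x).1 : ℝ)) : ℂ) ≠ 0 := by exact_mod_cast (γ x).1.ne_zero
  have hz := Circle.coe_ne_zero (γ x).2.1
  have da := hγ.a.ofReal.zpow ha b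
  have dz := hγ.z.zpow hz s
  refine ⟨(da.mul dz).mul hΩ, fun X => (dLog_mul (da.mul dz) hΩ (mul_ne_zero (zpow_ne_zero b ha)
    (zpow_ne_zero s hz)) h0 X).trans ?_⟩
  rw [dLog_mul da dz (zpow_ne_zero b ha) (zpow_ne_zero s hz), dLog_zpow hγ.a.ofReal ha,
    dLog_zpow hγ.z hz, dLog_rpow hγ.Ω (γ x).2.2.2]

/-- The covering of the GHP-conformal group, `a = |λ|²`, `z = λ / \bar λ`. -/
noncomputable def spinToGHP (γ : SpinGHPGroup) : GHPGroup :=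
  (Units.mk0 (Complex.normSq (γ.1 : ℂ)) (Complex.normSq_eq_zero.not.2 γ.1.ne_zero),
    -- `Circle.ofConjDivSelf` divides the conjugate by its argument, so applied to \bar λ it yields
    -- λ / \bar λ.
    Circle.ofConjDivSelf ((starRingEnd ℂ) (γ.1 : ℂ))
      ((map_ne_zero (starRingEnd ℂ)).2 γ.1.ne_zero), γ.2)

/-- Half the sum and half the difference of d log a and d log z are d log λ and d log \bar λ, which
match the weights p and q. -/
theorem dLog_spinToGHP {γ : M → SpinGHPGroup} (hγ : DiffCAt (fun y => ((γ y).1 : ℂ)) x)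
    (X : TM x) :
    dLog (fun y => (((spinToGHP (γ y)).1 : ℝ) : ℂ)) x X = dLog (fun y => ((γ y).1 : ℂ)) x X
      + dLog (fun y => (starRingEnd ℂ) ((γ y).1 : ℂ)) x X ∧
    dLog (fun y => ((spinToGHP (γ y)).2.1 : ℂ)) x X = dLog (fun y => ((γ y).1 : ℂ)) x X
      - dLog (fun y => (starRingEnd ℂ) ((γ y).1 : ℂ)) x X := by
  have h0 : ((γ x).1 : ℂ) ≠ 0 := (γ x).1.ne_zero
  have h0' : (starRingEnd ℂ) ((γ x).1 : ℂ) ≠ 0 := (map_ne_zero (starRingEnd ℂ)).2 h0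
  have e1 : (fun y => (((spinToGHP (γ y)).1 : ℝ) : ℂ))
      = fun y => ((γ y).1 : ℂ) * (starRingEnd ℂ) ((γ y).1 : ℂ) := by
    funext y
    rw [Complex.mul_conj]
    rfl
  have e2 : (fun y => ((spinToGHP (γ y)).2.1 : ℂ))
      = fun y => ((γ y).1 : ℂ) * ((starRingEnd ℂ) ((γ y).1 : ℂ))⁻¹ := by
    funext y
    simp [spinToGHP, Circle.ofConjDivSelf, div_eq_mul_inv]
  rw [e1, e2, dLog_mul hγ hγ.star h0 h0', dLog_mul hγ (hγ.star.inv h0') h0 (inv_ne_zero h0'),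
    dLog_inv hγ.star h0']
  exact ⟨rfl, by ring⟩

theorem dLog_dyadRep {γ : M → SpinGHPGroup} (hγ : DiffCAt (fun y => ((γ y).1 : ℂ)) x)
    (hΩ : DiffRAt (fun y => ((γ y).2 : ℝ)) x) (p q : ℤ) (w : ℝ) :
    DiffCAt (fun y => dyadRep p q w (γ y)) x ∧ ∀ X : TM x,
      dLog (fun y => dyadRep p q w (γ y)) x X = p * dLog (fun y => ((γ y).1 : ℂ)) x X
        + q * dLog (fun y => (starRingEnd ℂ) ((γ y).1 : ℂ)) x X
        + w * dLog (fun y => (((γ y).2 : ℝ) : ℂ)) x X := by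
  have h0 : ((γ x).1 : ℂ) ≠ 0 := (γ x).1.ne_zero
  have h0' : (starRingEnd ℂ) ((γ x).1 : ℂ) ≠ 0 := (map_ne_zero (starRingEnd ℂ)).2 h0
  have dΩ := (hΩ.rpow (γ x).2.2 w).ofReal
  have hw : ((((γ x).2 : ℝ) ^ w : ℝ) : ℂ) ≠ 0 := by
    exact_mod_cast (Real.rpow_pos_of_pos (γ x).2.2 w).ne'
  have d1 := hγ.zpow h0 p
  have d2 := hγ.star.zpow h0' q
  refine ⟨(d1.mul d2).mul dΩ, fun X => (dLog_mul (d1.mul d2) dΩ (mul_ne_zero (zpow_ne_zero p h0)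
    (zpow_ne_zero q h0')) hw X).trans ?_⟩
  rw [dLog_mul d1 d2 (zpow_ne_zero p h0) (zpow_ne_zero q h0'), dLog_zpow hγ h0,
    dLog_zpow hγ.star h0', dLog_rpow hΩ (γ x).2.2]

end GaugeDifferentiability

/-! ### The reduced form as a connection form on both bundles. -/

section AssociatedBundles

variable {M : Type*} [TopologicalSpace M] [ChartedSpace (EuclideanSpace ℝ (Fin 4)) M]
  [IsManifold (𝓡 4) ∞ M]
  {S : M → Type*} [∀ x, AddCommGroup (S x)] [∀ x, Module ℂ (S x)]
  [∀ x, TopologicalSpace (S x)] [TopologicalSpace (Bundle.TotalSpace SpinModel S)]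
  [FiberBundle SpinModel S] {g : LorentzMetric M} {σ : SpinorStructure S g} {x : M}
  {L : NullDirections σ} {D : CConnection M} (hD : IsCompatibleWeyl g.form L.J D) {w₀ w₁ : ℝ}

theorem smoothTetradOn {U : Set M} {N : ∀ y, AdaptedTetrad L y} (hU : IsOpen U)
    (hN : (tetradBundle L w₀ w₁).SmoothOn N U) :
    SmoothTetradOn g.form ((tetradBundle L w₀ w₁).field N) U where
  isOpen := hU
  metric _ _ hY hZ := g.contMDiffOn hY hZ
  symm := g.symm
  ln y := (N y).conformalNull.ln
  l := hN.1
  n := hN.2.1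
  m := hN.2.2

theorem AdaptedDyad.ε_act (w₀ w₁ : ℝ) (d : AdaptedDyad L x) (γ : SpinGHPGroup) :
    σ.ε x (d.act w₀ w₁ γ).o d.ι = (((γ.2 : ℝ) ^ w₀ : ℝ) * (γ.1 : ℂ)) * σ.ε x d.o d.ι := by
  simp only [AdaptedDyad.act, map_smul, LinearMap.smul_apply, smul_eq_mul]

/-- Equivariance of the map from dyads to tetrads; it transports the gauge law of ψ to dyads. -/
theorem dyadTetrad_act (d : AdaptedDyad L x) (γ : SpinGHPGroup) :
    dyadTetrad σ (d.act w₀ w₁ γ).o (d.act w₀ w₁ γ).ι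
      = (dyadTetrad σ d.o d.ι).act w₀ w₁ (spinToGHP γ) := by
  have hp := γ.2.2
  have h2 : ∀ w : ℝ, (γ.2 : ℝ) ^ (2 * w) = (γ.2 : ℝ) ^ w * (γ.2 : ℝ) ^ w := fun w => by
    rw [two_mul, Real.rpow_add hp]
  simp only [AdaptedDyad.act, dyadTetrad_smul, Tetrad.act]
  congr 1
  · rw [Complex.normSq_mul, Complex.normSq_ofReal, ← h2]
    rfl
  · rw [Complex.normSq_mul, Complex.normSq_ofReal, Complex.normSq_inv, ← h2]
    rfl
  · simp only [spinToGHP, Circle.ofConjDivSelf, Real.rpow_add hp, map_mul, map_inv₀,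
      Complex.conj_ofReal, Complex.ofReal_mul]
    simp
    ring

include hD

theorem IsCompatibleWeyl.isWeylAt_field {U : Set M} {N : ∀ y, AdaptedTetrad L y} (hU : IsOpen U)
    (hN : (tetradBundle L w₀ w₁).SmoothOn N U) (hx : x ∈ U) :
    IsWeylAt (frameMetric g.form ((tetradBundle L w₀ w₁).field N)) D x
      (fForm g.form ((tetradBundle L w₀ w₁).field N) x) :=
  hD.isWeylAt (tetradFieldAt_of_smoothOn hU hN hx) fun y => L.J_eq (N y)

theorem IsCompatibleWeyl.lieRep_psi (hw : w₀ + w₁ + 1 = 0) {U : Set M}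
    {N : ∀ y, AdaptedTetrad L y} (hU : IsOpen U) (hN : (tetradBundle L w₀ w₁).SmoothOn N U)
    (hx : x ∈ U) (p q w : ℂ) (X : TM x) :
    let N₀ := (tetradBundle L w₀ w₁).field N
    let ψ := psi g.form D w₀ w₁ N₀ x X
    p * ((ψ.1 + ψ.2.1) / 2) + q * ((ψ.1 - ψ.2.1) / 2) + w * ψ.2.2
      = p * (ghpForm g.form N₀ x X + bForm g.form w₀ w₁ N₀ x X)
        + q * (ghpFormBar g.form N₀ x X + cForm g.form w₀ w₁ N₀ x X) + w * fForm g.form N₀ x X := by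
  intro N₀ ψ
  have hT := tetradFieldAt_of_smoothOn hU hN hx
  have hW := hD.isWeylAt_field hU hN hx
  rw [← hW.psi_add hT hw X, ← hW.psi_sub hT hw X, ← hW.psi_weyl hT w₀ w₁ X]
  ring

theorem IsCompatibleWeyl.tetradBundle_isConnectionForm (hw : w₀ + w₁ + 1 = 0) (b s : ℤ) (w : ℝ) :
    (tetradBundle L w₀ w₁).IsConnectionForm (tetradRep b s w) g.form D w₀ w₁ where
  smooth U N X hU hN hX := by
    refine ((smoothTetradOn hU hN).slashed hX w₀ w₁ (b + s) (b - s) w).congr fun x hx => ?_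
    rw [← hD.lieRep_psi hw hU hN hx, lieRep_tetradRep]
    ring
  gauge U U' N N' γ hU hU' hN hN' hγ x hx := by
    have hT := tetradFieldAt_of_smoothOn hU hN hx.1
    have hT' := tetradFieldAt_of_smoothOn hU' hN' hx.2
    have e : ∀ y, (tetradBundle L w₀ w₁).field N' y
        = ((tetradBundle L w₀ w₁).field N y).act w₀ w₁ (γ y) := fun y =>
      congrArg AdaptedTetrad.toTetrad (hγ y)
    have hd := hT.diffGaugeAt hw hT' e
    obtain ⟨h1, h2⟩ := hd.dLog_tetradRep b s w
    refine ⟨h1, fun X => ?_⟩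
    rw [funext e, hd.psi_act hT (hD.isWeylAt_field hU hN hx.1) hw, h2, lieRep_tetradRep,
      lieRep_tetradRep]
    simp only [Prod.fst_add, Prod.snd_add]
    ring

theorem IsCompatibleWeyl.dyadBundle_isConnectionForm (hw : w₀ + w₁ + 1 = 0) (p q : ℤ) (w : ℝ) :
    (dyadBundle L w₀ w₁).IsConnectionForm (dyadRep p q w) g.form D w₀ w₁ where
  smooth U d X hU hd hX := by
    have hN := toAdaptedTetrad_smoothOn hU hd
    refine ((smoothTetradOn hU hN).slashed hX w₀ w₁ p q w).congr fun x hx => ?_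
    rw [← hD.lieRep_psi hw hU hN hx, lieRep_dyadRep]
    rfl
  gauge U U' d d' γ hU hU' hd hd' hγ x hx := by
    have hN := toAdaptedTetrad_smoothOn hU hd
    have hT := tetradFieldAt_of_smoothOn hU hN hx.1
    have hT' := tetradFieldAt_of_smoothOn hU' (toAdaptedTetrad_smoothOn hU' hd') hx.2
    have e : ∀ y, (dyadBundle L w₀ w₁).field d' y
        = ((dyadBundle L w₀ w₁).field d y).act w₀ w₁ (spinToGHP (γ y)) := fun y =>
      (congrArg (fun c : AdaptedDyad L y => dyadTetrad σ c.o c.ι) (hγ y)).trans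
        (dyadTetrad_act (d y) (γ y))
    have hg : DiffGaugeAt (fun y => spinToGHP (γ y)) x := hT.diffGaugeAt hw hT' e
    have hΩ : DiffRAt (fun y => ((γ y).2 : ℝ)) x := hg.Ω
    -- The tetrads determine λ only up to sign. Its differentiability is read from the spinor metric
    -- instead: ε(o', ι) / ε(o, ι) = Ω^{w₀} λ.
    have hl : DiffCAt (fun y => ((γ y).1 : ℂ)) x := by
      have a1 : DiffCAt (fun y => σ.ε y (d y).o (d y).ι) x :=
        ((σ.smooth_ε U _ _ hU hd.1 hd.2).contMDiffAt (hU.mem_nhds hx.1)).mdifferentiableAt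
          (by simp)
      have a2 : DiffCAt (fun y => ((((γ y).2 : ℝ) ^ w₀ : ℝ) * ((γ y).1 : ℂ))
          * σ.ε y (d y).o (d y).ι) x := by
        refine (((σ.smooth_ε (U ∩ U') _ _ (hU.inter hU') (hd'.1.mono Set.inter_subset_right)
          (hd.2.mono Set.inter_subset_left)).contMDiffAt
          ((hU.inter hU').mem_nhds hx)).mdifferentiableAt (by simp)).congr_of_eventuallyEq
          (.of_forall fun y => ?_)
        refine (AdaptedDyad.ε_act w₀ w₁ (d y) (γ y)).symm.trans ?_
        exact congrArg (fun c : AdaptedDyad L y => σ.ε y c.o (d y).ι) (hγ y).symm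
      refine ((a2.mul (a1.inv (d x).ε_ne_zero)).mul
        (hΩ.rpow (γ x).2.2 (-w₀)).ofReal).congr_of_eventuallyEq (.of_forall fun y => ?_)
      have h1 := (d y).ε_ne_zero
      have h2 : ((((γ y).2 : ℝ) ^ w₀ : ℝ) : ℂ) ≠ 0 := by
        exact_mod_cast (Real.rpow_pos_of_pos (γ y).2.2 w₀).ne'
      simp only [Real.rpow_neg (γ y).2.2.le]
      push_cast
      field_simp
    obtain ⟨h1, h2⟩ := dLog_dyadRep hl hΩ p q w
    refine ⟨h1, fun X => ?_⟩
    obtain ⟨k1, k2⟩ := dLog_spinToGHP hl X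
    have hψ := hg.psi_act hT (hD.isWeylAt_field hU hN hx.1) hw X
    rw [k1, k2] at hψ
    change psi g.form D w₀ w₁ (fun y => ((dyadBundle L w₀ w₁).field d y).act w₀ w₁
      (spinToGHP (γ y))) x X = psi g.form D w₀ w₁ ((dyadBundle L w₀ w₁).field d) x X
      + (_, _, -dLog (fun y => (((γ y).2 : ℝ) : ℂ)) x X) at hψ
    rw [funext e, hψ, h2, lieRep_dyadRep, lieRep_dyadRep]
    simp only [Prod.fst_add, Prod.snd_add]
    ring

end AssociatedBundles

/-! ### Remaining lemmas and the main theorem. -/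

section MainLemmas

variable {M : Type*} [TopologicalSpace M] [ChartedSpace (EuclideanSpace ℝ (Fin 4)) M]
  [IsManifold (𝓡 4) ∞ M] {x : M}

theorem tetradRep_one (b s : ℤ) (w : ℝ) : tetradRep b s w 1 = 1 := by
  simp [tetradRep]

theorem dyadRep_one (p q : ℤ) (w : ℝ) : dyadRep p q w 1 = 1 := by
  simp [dyadRep]

theorem tetradRep_ne_zero (b s : ℤ) (w : ℝ) (γ : GHPGroup) : tetradRep b s w γ ≠ 0 := by
  have ha : ((γ.1 : ℝ) : ℂ) ≠ 0 := by exact_mod_cast γ.1.ne_zero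
  have hΩ : ((((γ.2.2 : ℝ) ^ w : ℝ)) : ℂ) ≠ 0 := by
    exact_mod_cast (Real.rpow_pos_of_pos γ.2.2.2 w).ne'
  exact mul_ne_zero (mul_ne_zero (zpow_ne_zero b ha) (zpow_ne_zero s (Circle.coe_ne_zero _))) hΩ

theorem dyadRep_ne_zero (p q : ℤ) (w : ℝ) (γ : SpinGHPGroup) : dyadRep p q w γ ≠ 0 := by
  have hΩ : ((((γ.2 : ℝ) ^ w : ℝ)) : ℂ) ≠ 0 := by
    exact_mod_cast (Real.rpow_pos_of_pos γ.2.2 w).ne'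
  exact mul_ne_zero (mul_ne_zero (zpow_ne_zero p γ.1.ne_zero)
    (zpow_ne_zero q ((map_ne_zero (starRingEnd ℂ)).2 γ.1.ne_zero))) hΩ

theorem slashedTheta_eq_teukolsky (g : FormField M) (p : ℤ) (N : ∀ y : M, Tetrad y) (η : M → ℂ)
    {w₀ w₁ w : ℝ} {q : ℤ} (h₀ : w₀ = 0) (h₁ : w₁ = -1) (hw : w = 0) (hq : q = 0) (X : TM x) :
    slashedTheta g w₀ w₁ w p q N η x X = teukolsky g p N η x X := by
  subst h₀ h₁ hw hq
  simp only [slashedTheta, teukolsky, ghpDeriv, bForm]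
  push_cast
  ring

/-- Since ω^0_0 + ω^1_1 = ω^2_2 + ω^3_3, the definitions of K, L, f can be inverted, so ψ holds the
whole diagonal. The sign is explained by the gauge terms: diagonal forms shift by +d log of the leg
factor, ψ by -d log of the group parameters. -/
theorem IsWeylAt.connForm_diag {g : FormField M} {D : CConnection M} {N : ∀ y : M, Tetrad y}
    {w₀ w₁ : ℝ} (hD : IsWeylAt (frameMetric g N) D x (fForm g N x)) (hN : TetradFieldAt g N x)
    (hw : w₀ + w₁ + 1 = 0) (i : Fin 4) (X : TM x) :
    let ψ := psi g D w₀ w₁ N x X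
    connForm g D N i i x X
      = -(![ψ.1 + 2 * w₀ * ψ.2.2, -ψ.1 + 2 * w₁ * ψ.2.2, ψ.2.1 + (w₀ + w₁) * ψ.2.2,
          -ψ.2.1 + (w₀ + w₁) * ψ.2.2] : Fin 4 → ℂ) i := by
  obtain rfl : w₁ = -1 - w₀ := by linarith
  have s := hD.connForm_add hN X
  rw [← s.2] at s
  fin_cases i <;> simp [psi]
  · linear_combination (-w₀ : ℂ) * s.1
  · linear_combination (1 + w₀ : ℂ) * s.1
  · ring
  · ring

end MainLemmas

end ConformalGHP

theorem mainTheorem1 {M : Type*} [TopologicalSpace M]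
    [ChartedSpace (EuclideanSpace ℝ (Fin 4)) M] [IsManifold (𝓡 4) ∞ M]
    {S : M → Type*} [∀ x, AddCommGroup (S x)] [∀ x, Module ℂ (S x)]
    [∀ x, TopologicalSpace (S x)] [TopologicalSpace (Bundle.TotalSpace SpinModel S)]
    [FiberBundle SpinModel S] [VectorBundle ℝ SpinModel S]
    [ContMDiffVectorBundle ∞ SpinModel S (𝓡 4)]
    (g : LorentzMetric M) (σ : SpinorStructure S g) (L : NullDirections σ) :
    -- `J` is an almost-complex structure compatible with the metric, and it is built in the same
    -- way from every conformal null tetrad and every conformal dyad along the null directions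
    (∀ x, (∀ X, complexify (L.J x) (L.J x X) = -ofReal X) ∧
      (∀ X Y, complexForm (g.form x) (L.J x X) (L.J x Y) = g.form x X Y) ∧
      (∀ N : AdaptedTetrad L x, L.J x = acs (g.form x) N.toTetrad) ∧
      ∀ d : AdaptedDyad L x, L.J x = acs (g.form x) (dyadTetrad σ d.o d.ι)) ∧
    -- existence of the compatible Weyl connection `D`
    ∃ D : CConnection M, IsCompatibleWeyl g.form L.J D ∧
    -- uniqueness
    (∀ D' : CConnection M, IsCompatibleWeyl g.form L.J D' →
      ∀ (x : M) (Y Z : ∀ y : M, TM y), DiffVFAt Y x → DiffVFAt Z x →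
        D' (fun y => (Y y, Z y)) x = D (fun y => (Y y, Z y)) x) ∧
    ∀ w₀ w₁ : ℝ, w₀ + w₁ + 1 = 0 →
    -- the reduced bundles are principal bundles
    (tetradBundle L w₀ w₁).IsPrincipal ∧ (dyadBundle L w₀ w₁).IsPrincipal ∧
    -- the connection form of `D` in adapted tetrads: gauge behaviour
    (∀ (U : Set M) (N : ∀ x, AdaptedTetrad L x) (γ : M → GHPGroup), IsOpen U →
      (tetradBundle L w₀ w₁).SmoothOn N U → SmoothGauge γ U → ∀ x ∈ U, ∀ X : TM x,
      let N₀ := (tetradBundle L w₀ w₁).field N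
      let N₁ := (tetradBundle L w₀ w₁).field (fun y => (N y).act w₀ w₁ (γ y))
      (∀ i j, connForm g.form D N₁ i j x X
        = (legFactor w₀ w₁ i (γ x))⁻¹ * legFactor w₀ w₁ j (γ x) * connForm g.form D N₀ i j x X
          + if i = j then
              (legFactor w₀ w₁ i (γ x))⁻¹ * dC (fun y => legFactor w₀ w₁ i (γ y)) x X
            else 0) ∧
      (psi g.form D w₀ w₁ N₁ x X).1 = (psi g.form D w₀ w₁ N₀ x X).1
        + ((γ x).1 : ℝ) * dC (fun y => (((γ y).1 : ℝ) : ℂ)⁻¹) x X ∧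
      (psi g.form D w₀ w₁ N₁ x X).2.1 = (psi g.form D w₀ w₁ N₀ x X).2.1
        + ((γ x).2.1 : ℂ) * dC (fun y => ((γ y).2.1 : ℂ)⁻¹) x X ∧
      (psi g.form D w₀ w₁ N₁ x X).2.2 = (psi g.form D w₀ w₁ N₀ x X).2.2
        + ((γ x).2.2 : ℝ) * dC (fun y => (((γ y).2.2 : ℝ) : ℂ)⁻¹) x X) ∧
    -- the inhomogeneous (diagonal) part is the reduced connection form, given explicitly by the
    -- spin coefficients; its `ℝ^+` part is the Weyl 1-form
    (∀ (U : Set M) (N : ∀ x, AdaptedTetrad L x), IsOpen U →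
      (tetradBundle L w₀ w₁).SmoothOn N U →
      let N₀ := (tetradBundle L w₀ w₁).field N
      IsWeylForm (frameMetric g.form N₀) D (fForm g.form N₀) U ∧
      ∀ x ∈ U, ∀ X : TM x,
        (∀ i, connForm g.form D N₀ i i x X
          = -(tetradBundle L w₀ w₁).lieRep (legFactor w₀ w₁ i) (psi g.form D w₀ w₁ N₀ x X)) ∧
        (psi g.form D w₀ w₁ N₀ x X).2.2 = fForm g.form N₀ x X ∧
        (1 / 2) * ((psi g.form D w₀ w₁ N₀ x X).1 + (psi g.form D w₀ w₁ N₀ x X).2.1)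
          = ghpForm g.form N₀ x X + bForm g.form w₀ w₁ N₀ x X ∧
        (1 / 2) * ((psi g.form D w₀ w₁ N₀ x X).1 - (psi g.form D w₀ w₁ N₀ x X).2.1)
          = ghpFormBar g.form N₀ x X + cForm g.form w₀ w₁ N₀ x X) ∧
    -- the induced covariant derivative on the line bundles associated to adapted tetrads, for the
    -- weights `p = b + s`, `q = b - s`
    (∀ (b s : ℤ) (w : ℝ),
      (∀ ξ : ℂ × ℂ × ℂ, (tetradBundle L w₀ w₁).lieRep (tetradRep b s w) ξ
        = (b + s : ℤ) * ((ξ.1 + ξ.2.1) / 2) + (b - s : ℤ) * ((ξ.1 - ξ.2.1) / 2) + w * ξ.2.2) ∧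
      ∃ Θ : WeightedSection (tetradBundle L w₀ w₁) (tetradRep b s w) →
          ∀ x, AdaptedTetrad L x → (TM x →L[ℝ] ℂ),
        IsInducedDeriv g.form D w₀ w₁ (tetradBundle L w₀ w₁) (tetradRep b s w) Θ ∧
        (∀ Θ', IsInducedDeriv g.form D w₀ w₁ (tetradBundle L w₀ w₁) (tetradRep b s w) Θ' →
          Θ' = Θ) ∧
        ∀ (η : WeightedSection (tetradBundle L w₀ w₁) (tetradRep b s w)) (U : Set M)
          (N : ∀ x, AdaptedTetrad L x), IsOpen U → (tetradBundle L w₀ w₁).SmoothOn N U →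
          ∀ x ∈ U, ∀ X : TM x,
          let N₀ := (tetradBundle L w₀ w₁).field N
          Θ η x (N x) X = slashedTheta g.form w₀ w₁ w (b + s) (b - s) N₀ (η.comp N) x X ∧
          (w₀ = 0 → w₁ = -1 → w = 0 → b - s = 0 →
            Θ η x (N x) X = teukolsky g.form (b + s) N₀ (η.comp N) x X)) ∧
    -- the same on the line bundles associated to adapted spin dyads, for all integers `p`, `q`
    (∀ (p q : ℤ) (w : ℝ),
      (∀ ξ : ℂ × ℂ × ℂ, (dyadBundle L w₀ w₁).lieRep (dyadRep p q w) ξ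
        = p * ((ξ.1 + ξ.2.1) / 2) + q * ((ξ.1 - ξ.2.1) / 2) + w * ξ.2.2) ∧
      ∃ Θ : WeightedSection (dyadBundle L w₀ w₁) (dyadRep p q w) →
          ∀ x, AdaptedDyad L x → (TM x →L[ℝ] ℂ),
        IsInducedDeriv g.form D w₀ w₁ (dyadBundle L w₀ w₁) (dyadRep p q w) Θ ∧
        (∀ Θ', IsInducedDeriv g.form D w₀ w₁ (dyadBundle L w₀ w₁) (dyadRep p q w) Θ' → Θ' = Θ) ∧
        ∀ (η : WeightedSection (dyadBundle L w₀ w₁) (dyadRep p q w)) (U : Set M)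
          (d : ∀ x, AdaptedDyad L x), IsOpen U → (dyadBundle L w₀ w₁).SmoothOn d U →
          ∀ x ∈ U, ∀ X : TM x,
          let N₀ := (dyadBundle L w₀ w₁).field d
          Θ η x (d x) X = slashedTheta g.form w₀ w₁ w p q N₀ (η.comp d) x X ∧
          (w₀ = 0 → w₁ = -1 → w = 0 → q = 0 →
            Θ η x (d x) X = teukolsky g.form p N₀ (η.comp d) x X)) := by 
  refine ⟨fun x => ?_, ?_⟩
  · have acs_eq : ∀ N : AdaptedTetrad L x, L.J x = acs (g.form x) N.toTetrad := L.J_eq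
    obtain ⟨d⟩ := L.nonempty_dyad x
    have hd := d.toAdaptedTetrad.conformalNull
    have hn := hd.isNullTetrad (g.symm x)
    have c0 : g.form x d.toAdaptedTetrad.l d.toAdaptedTetrad.n ≠ 0 := hd.ln.ne'
    have hJ := (acs_eq d.toAdaptedTetrad).trans
      (acs_smul_form (g.form x) (inv_ne_zero c0) d.toAdaptedTetrad.toTetrad).symm
    refine ⟨fun X => ?_, fun X Y => ?_, acs_eq, fun d => acs_eq d.toAdaptedTetrad⟩
    · rw [hJ, hn.acs_acs]
    -- The isometry is known for the normalized metric; the factor (l·n)⁻¹ on both sides cancels.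
    · have h := hn.acs_isometry X Y
      rw [← hJ, complexForm_smul_form, smul_apply, smul_apply, smul_eq_mul] at h
      push_cast at h
      exact mul_left_cancel₀ (inv_ne_zero (by exact_mod_cast c0)) h
  -- One tetrad field around each point suffices to build the connection. The weights play no part,
  -- so the same connection serves every w₀, w₁.
  choose T hT hJ using exists_tetradFieldAt L
  have hD := weylDeriv_isCompatibleWeyl hT hJ
  refine ⟨weylDeriv hT, hD, fun D' hD' x Y Z hY hZ => hD.unique hD' (hT x) (hJ x) ⟨hY, hZ⟩,
    fun w₀ w₁ hw => ⟨tetradBundle_isPrincipal L hw, dyadBundle_isPrincipal L hw, ?_, ?_, ?_, ?_⟩⟩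
  · intro U N γ hU hN hγ x hx X N₀ N₁
    have hT₀ := tetradFieldAt_of_smoothOn hU hN hx
    have hW := hD.isWeylAt_field hU hN hx
    have hγ' := hγ.diffGaugeAt hU hx
    have e := hγ'.psi_act hT₀ hW hw X
    refine ⟨fun i j => hγ'.connForm_act hT₀ hW w₀ w₁ i j X, ?_, ?_, ?_⟩
    · rw [mul_dC_inv hγ'.a.ofReal (by exact_mod_cast (γ x).1.ne_zero)]
      exact congrArg Prod.fst e
    · rw [mul_dC_inv hγ'.z (Circle.coe_ne_zero _)]
      exact congrArg (fun ψ => ψ.2.1) e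
    · rw [mul_dC_inv hγ'.Ω.ofReal (by exact_mod_cast (γ x).2.2.2.ne')]
      exact congrArg (fun ψ => ψ.2.2) e
  · intro U N hU hN N₀
    refine ⟨fun x hx => (hD.isWeylAt_field hU hN hx).weyl, fun x hx X => ?_⟩
    have hT₀ := tetradFieldAt_of_smoothOn hU hN hx
    have hW := hD.isWeylAt_field hU hN hx
    refine ⟨fun i => ?_, hW.psi_weyl hT₀ w₀ w₁ X, hW.psi_add hT₀ hw X, hW.psi_sub hT₀ hw X⟩
    rw [lieRep_legFactor]
    exact hW.connForm_diag hT₀ hw i X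
  · intro b s w
    have lie : ∀ ξ : ℂ × ℂ × ℂ, (tetradBundle L w₀ w₁).lieRep (tetradRep b s w) ξ
        = (b + s : ℤ) * ((ξ.1 + ξ.2.1) / 2) + (b - s : ℤ) * ((ξ.1 - ξ.2.1) / 2) + w * ξ.2.2 :=
      fun ξ => by
        rw [lieRep_tetradRep]
        push_cast
        ring
    refine ⟨lie, ?_⟩
    obtain ⟨Θ, hΘ, huniq⟩ := (hD.tetradBundle_isConnectionForm hw b s w).existsUnique
      (tetradBundle_isPrincipal L hw) (tetradRep_ne_zero b s w) (tetradRep_one b s w)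
    refine ⟨Θ, hΘ, huniq, ?_⟩
    intro η U N hU hN x hx X N₀
    have main : Θ η x (N x) X = slashedTheta g.form w₀ w₁ w (b + s) (b - s) N₀ (η.comp N) x X := by
      rw [hΘ.local_formula η U N hU hN x hx X, lie, hD.lieRep_psi hw hU hN hx, slashedTheta]
      ring
    refine ⟨main, fun h₀ h₁ hw' hq => ?_⟩
    exact main.trans (slashedTheta_eq_teukolsky g.form _ _ _ h₀ h₁ hw' hq X)
  · intro p q w
    refine ⟨lieRep_dyadRep L w₀ w₁ p q w, ?_⟩
    obtain ⟨Θ, hΘ, huniq⟩ := (hD.dyadBundle_isConnectionForm hw p q w).existsUnique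
      (dyadBundle_isPrincipal L hw) (dyadRep_ne_zero p q w) (dyadRep_one p q w)
    refine ⟨Θ, hΘ, huniq, ?_⟩
    intro η U d hU hd x hx X N₀
    have hN := toAdaptedTetrad_smoothOn hU hd
    have main : Θ η x (d x) X = slashedTheta g.form w₀ w₁ w p q N₀ (η.comp d) x X := by
      have e : (dyadBundle L w₀ w₁).lieRep (dyadRep p q w) (psi g.form (weylDeriv hT) w₀ w₁ N₀ x X)
          = p * (ghpForm g.form N₀ x X + bForm g.form w₀ w₁ N₀ x X)
            + q * (ghpFormBar g.form N₀ x X + cForm g.form w₀ w₁ N₀ x X) + w * fForm g.form N₀ x X :=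
        (lieRep_dyadRep L w₀ w₁ p q w _).trans (hD.lieRep_psi hw hU hN hx p q w X)
      rw [hΘ.local_formula η U d hU hd x hx X, e, slashedTheta]
      ring
    refine ⟨main, fun h₀ h₁ hw' hq => ?_⟩
    exact main.trans (slashedTheta_eq_teukolsky g.form _ _ _ h₀ h₁ hw' hq X)
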